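/- Let $k>2$, $0\le\lambda<1$, $b_0\ge 1$ and $K>0$ be fixed real numbers, and put $q=\frac{k}{k-1}$, $e(w)=e^{2\pi i w}$, $\psi(w)=w-[w]-\frac12$. For $W>0$ let $$\Delta_k(W)=\sum_{(W/2)^{1/k}<n\le W^{1/k}}\psi\bigl((W-n^k)^{1/k}\bigr)$$ be the fractional-part sum belonging to the number of lattice points in the Lamé disc $|u_1|^k+|u_2|^k\le W$. For $c_0\in[1,b_0]$ and $j\ge 0$ put $$J=\left\lceil\frac{\log\bigl((W/c_0)^{(1-\lambda)/k}\bigr)}{q\log 2}\right\rceil+1,\qquad N_j=W^{1/k}(1+2^{-jq})^{-1/k}.$$ For integers $0<h<H$ let $$\alpha_{h,H}=\frac1{\pi h}\,\rho\!\left(\frac hH\right),\quad \rho(\xi)=\pi\xi(1-\xi)\cot(\pi\xi)+\xi,\qquad \beta_{h,H}=\frac1H\left(1-\frac hH\right),$$ and, for $\gamma$ denoting either $\alpha$ or $\beta$ and integers $H_{W,j}>1$, put $$\Sigma^{(\gamma)}_{H,W,k,j}=\frac{W^{1/(2k)}}{\sqrt{k-1}}\sum_{0<h<H_{W,j}}\gamma_{h,H_{W,j}}\,h\sum_{2^jh\le\ell\le2^{j+1}h}^{*}(h\ell)^{q/2-1}(h^q+\ell^q)^{-1+1/(2q)}\,e\!\left(W^{1/k}(h^q+\ell^q)^{1/q}-\tfrac18\right),$$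 where $\sum^*$ means that the two terms with $\ell=2^jh$ and $\ell=2^{j+1}h$ are counted with weight $\frac12$. Then there are constants $C>0$ and $W_0$, depending only on $k,\lambda,b_0,K$, such that for all $W\ge W_0$, all $c_0\in[1,b_0]$ and all integers $H_{W,j}>1$ with $\log H_{W,j}\le K\log W$ $(0\le j\le J-1)$, $$\left|\Delta_k(W)+\sum_{j=0}^{J-1}\Im\bigl(\Sigma^{(\alpha)}_{H,W,k,j}\bigr)\right|\le\sum_{j=0}^{J-1}\Re\bigl(\Sigma^{(\beta)}_{H,W,k,j}\bigr)+\sum_{j=0}^{J-1}\frac{\#([N_j,N_{j+1}]\cap\mathbb Z)}{H_{W,j}}+C\bigl(W^{\lambda/k}+(\log W)^3\bigr).$$ -/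

import Mathlib

noncomputable section

namespace LameDisc

/-- The row-of-teeth function `ψ(w) = w - [w] - 1/2`. -/
def psi (w : ℝ) : ℝ := w - (⌊w⌋ : ℝ) - 1 / 2

/-- `Δ_k(W)`, the sum of `ψ((W - n^k)^{1/k})` over the integers `n` with
`(W/2)^{1/k} < n ≤ W^{1/k}`. -/
def Delta (k W : ℝ) : ℝ :=
  ∑ n ∈ Finset.Ioc ⌊(W / 2) ^ (1 / k)⌋₊ ⌊W ^ (1 / k)⌋₊, psi ((W - (n : ℝ) ^ k) ^ (1 / k))

/-- `ρ(ξ) = π ξ (1 - ξ) cot(π ξ) + ξ`, used for `0 < ξ < 1`. -/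
def rho (ξ : ℝ) : ℝ := Real.pi * ξ * (1 - ξ) * Real.cot (Real.pi * ξ) + ξ

/-- `α_{h,H} = ρ(h/H) / (π h)`, used for `0 < h < H`. -/
def alpha (h H : ℕ) : ℝ := 1 / (Real.pi * h) * rho ((h : ℝ) / H)

/-- `β_{h,H} = (1 - h/H) / H`, used for `0 < h < H`. -/
def beta (h H : ℕ) : ℝ := 1 / (H : ℝ) * (1 - (h : ℝ) / H)

/-- The conjugate exponent `q = k / (k - 1)`. -/
def q (k : ℝ) : ℝ := k / (k - 1)

/-- `e(w) = exp(2 π i w)`. -/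
def e (w : ℝ) : ℂ := Complex.exp (2 * Real.pi * Complex.I * w)

/-- The sum of `Φ(ℓ)` over `a ≤ ℓ ≤ b` in which the terms `ℓ = a` and `ℓ = b` get weight `1/2`
(used for integers `a < b`). -/
def starSum (a b : ℕ) (Φ : ℕ → ℂ) : ℂ :=
  1 / 2 * (Φ a + Φ b) + ∑ ℓ ∈ Finset.Ioo a b, Φ ℓ

/-- The number of dyadic pieces,
`J = ⌈log((W/c₀)^{(1-lam)/k}) / (q log 2)⌉ + 1`. -/
def numPieces (k lam c₀ W : ℝ) : ℕ :=
  ⌈Real.log ((W / c₀) ^ ((1 - lam) / k)) / (q k * Real.log 2)⌉₊ + 1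

/-- The points of division `N_j = W^{1/k} (1 + 2^{-jq})^{-1/k}`. -/
def node (k W : ℝ) (j : ℕ) : ℝ :=
  W ^ (1 / k) * (1 + (2 : ℝ) ^ (-(j : ℝ) * q k)) ^ (-1 / k)

/-- The exponential sum `Σ^{(γ)}_{H,W,k,j}`, where `H` stands for the integer `H_{W,j}`. -/
def expSum (γ : ℕ → ℕ → ℝ) (H : ℕ) (W k : ℝ) (j : ℕ) : ℂ :=
  ((W ^ (1 / (2 * k)) / Real.sqrt (k - 1) : ℝ) : ℂ) *
    ∑ h ∈ Finset.Ioo 0 H, ((γ h H * h : ℝ) : ℂ) *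
      starSum (2 ^ j * h) (2 ^ (j + 1) * h) fun ℓ =>
        ((((h : ℝ) * ℓ) ^ (q k / 2 - 1) *
          ((h : ℝ) ^ q k + (ℓ : ℝ) ^ q k) ^ (-1 + 1 / (2 * q k)) : ℝ) : ℂ) *
        e (W ^ (1 / k) * ((h : ℝ) ^ q k + (ℓ : ℝ) ^ q k) ^ (1 / q k) - 1 / 8)

end LameDisc

end

/-!
The curve `y = (W - x ^ k) ^ (1 / k)` is cut at the points `node k W j`, where its slope is
`-2 ^ j`. To the right of `node k W J` only `O (W ^ (lam / k))` integers are left, which are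
estimated trivially (`abs_tail_le`). On each of the remaining pieces two tools are combined.

* Vaaler's inequality `|ψ x + ∑ α_{h,H} sin (2 π h x)| ≤ ∑ β_{h,H} cos (2 π h x) + 1 / (2 H)`. The
  partial fractions of the trigonometric functions reduce it to a comparison of `t cot t` at two
  points with its tangent; `t cot t` is concave on `(-π, π)` (`mul_cot_le_tangent`), and the
  resulting inequalities telescope.

* The van der Corput transform of `∑ e (-g n)` for a phase `g` whose slope runs from an integer `a`
  to `2 * a`, with an error `O (1 + log a)` (`ArcPhase.norm_sum_sub_starSum_le`). A truncated Poisson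
  formula replaces the sum by the integrals with the phases `g - ℓ t`, `a ≤ ℓ ≤ 2 * a`
  (`ArcPhase.norm_sum_sub_integrals_le`). Each integral is split at its stationary point, and each
  half is evaluated by one-sided stationary phase (`HalfPhase.norm_integral_sub_main_le`). For
  `ℓ = a` and `ℓ = 2 * a` the stationary point is an end point and there is only one half, whence
  the weights `1 / 2` in `starSum`.

No power of `W` may be lost in the second tool. After the substitution of the phase `φ` as the
variable, the difference of the half integral and its Fresnel model has the amplitude
`1 / φ' - √(2 / φ''(0)) / (2 √φ)`, and what counts is its total variation, hence the number of
changes of sign of its derivative. By repeated use of Rolle's idea (`OneSignChange.of_deriv`) this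
is traced back to the sign of `5 φ''' ^ 2 - 3 φ'' φ''''`, which is opposite to that of the equiaffine
curvature of the graph. It does not depend on the linear term `ℓ t`, and for the Lamé curve it
changes at most once on every piece (`curve_sign_eq`).

For `γ = α, β` the weights satisfy `∑ |γ_{h,H}| = O (log H)`, so each of the `O (log W)` pieces
contributes an error `O ((log W) ^ 2)`, which gives the term `(log W) ^ 3`.
-/

noncomputable section

namespace LameDisc

open Real Finset

/-! ### Vaaler's approximation of the row-of-teeth function -/

/-- Minus the derivative of `t ↦ t * cot t`. -/
def cotDefect (t : ℝ) : ℝ := t / sin t ^ 2 - cos t / sin t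

theorem hasDerivAt_mul_cot {t : ℝ} (ht : sin t ≠ 0) :
    HasDerivAt (fun x => x * (cos x / sin x)) (-cotDefect t) t := by
  have h := (hasDerivAt_id t).mul ((hasDerivAt_cos t).div (hasDerivAt_sin t) ht)
  refine h.congr_deriv ?_
  have h1 := sin_sq_add_cos_sq t
  simp only [id, cotDefect, Pi.div_apply]
  field_simp
  linear_combination (-t) * h1

theorem hasDerivAt_cotDefect {t : ℝ} (ht : sin t ≠ 0) :
    HasDerivAt cotDefect (2 * (sin t - t * cos t) / sin t ^ 3) t := by
  have h := ((hasDerivAt_id t).div ((hasDerivAt_sin t).pow 2) (pow_ne_zero 2 ht)).sub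
    ((hasDerivAt_cos t).div (hasDerivAt_sin t) ht)
  refine h.congr_deriv ?_
  have h1 := sin_sq_add_cos_sq t
  simp only [id, Pi.pow_apply]
  field_simp
  norm_num
  linear_combination (sin t ^ 2) * h1

theorem mul_cos_le_sin {t : ℝ} (h0 : 0 < t) (h1 : t < π) : t * cos t ≤ sin t := by
  rcases lt_or_ge t (π / 2) with h | h
  · have hc : 0 < cos t := cos_pos_of_mem_Ioo ⟨by linarith, h⟩
    have := lt_tan h0 h
    rw [tan_eq_sin_div_cos, lt_div_iff₀ hc] at this
    exact this.le
  · have hc : cos t ≤ 0 := cos_nonpos_of_pi_div_two_le_of_le h (by linarith)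
    have hs := sin_pos_of_pos_of_lt_pi h0 h1
    nlinarith

theorem monotoneOn_cotDefect : MonotoneOn cotDefect (Set.Ioo 0 π) := by
  have hs : ∀ t ∈ Set.Ioo 0 π, sin t ≠ 0 := fun t ht => (sin_pos_of_mem_Ioo ht).ne'
  refine monotoneOn_of_deriv_nonneg (convex_Ioo _ _)
    (fun t ht => (hasDerivAt_cotDefect (hs t ht)).continuousAt.continuousWithinAt) ?_ ?_
  · intro t ht
    rw [interior_Ioo] at ht
    exact (hasDerivAt_cotDefect (hs t ht)).differentiableAt.differentiableWithinAt
  · intro t ht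
    rw [interior_Ioo] at ht
    rw [(hasDerivAt_cotDefect (hs t ht)).deriv]
    have := sin_pos_of_mem_Ioo ht
    have := mul_cos_le_sin ht.1 ht.2
    have : 0 ≤ sin t - t * cos t := by linarith
    positivity

theorem cotDefect_nonneg {t : ℝ} (ht : t ∈ Set.Ioo 0 π) : 0 ≤ cotDefect t := by
  have hs := sin_pos_of_mem_Ioo ht
  have h2 : sin t * cos t ≤ t := by
    have := sin_le (x := 2 * t) (by linarith [ht.1])
    rw [sin_two_mul] at this
    linarith
  have : cotDefect t = (t - sin t * cos t) / sin t ^ 2 := by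
    unfold cotDefect
    field_simp
  rw [this]
  have : 0 ≤ t - sin t * cos t := by linarith
  positivity

theorem mul_cot_le_tangent_of_pos {u v : ℝ} (hu : u ∈ Set.Ioo 0 π) (hv : v ∈ Set.Ioo 0 π) :
    v * (cos v / sin v) ≤ u * (cos u / sin u) + (u - v) * cotDefect u := by
  have hd : ∀ t ∈ Set.Ioo 0 π, HasDerivAt (fun x => x * (cos x / sin x)) (-cotDefect t) t :=
    fun t ht => hasDerivAt_mul_cot (sin_pos_of_mem_Ioo ht).ne'
  rcases lt_trichotomy u v with h | h | h
  · obtain ⟨c, hc, hc'⟩ := exists_hasDerivAt_eq_slope (fun x => x * (cos x / sin x))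
      (fun t => -cotDefect t) h
      (fun t ht => (hd t ⟨hu.1.trans_le ht.1, ht.2.trans_lt hv.2⟩).continuousAt.continuousWithinAt)
      (fun t ht => hd t ⟨hu.1.trans ht.1, ht.2.trans hv.2⟩)
    have hm := monotoneOn_cotDefect hu ⟨hu.1.trans hc.1, hc.2.trans hv.2⟩ hc.1.le
    rw [eq_div_iff (by linarith)] at hc'
    nlinarith
  · subst h; simp
  · obtain ⟨c, hc, hc'⟩ := exists_hasDerivAt_eq_slope (fun x => x * (cos x / sin x))
      (fun t => -cotDefect t) h
      (fun t ht => (hd t ⟨hv.1.trans_le ht.1, ht.2.trans_lt hu.2⟩).continuousAt.continuousWithinAt)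
      (fun t ht => hd t ⟨hv.1.trans ht.1, ht.2.trans hu.2⟩)
    have hm := monotoneOn_cotDefect ⟨hv.1.trans hc.1, hc.2.trans hu.2⟩ hu hc.2.le
    rw [eq_div_iff (by linarith)] at hc'
    nlinarith

/-- The concave even function `t * cot t` on `(-π, π)` lies below its tangents; the removable
singularity at `0` is avoided. -/
theorem mul_cot_le_tangent {u v : ℝ} (hu : u < π) (hv : -π < v) (hvu : v < u) (hu0 : u ≠ 0)
    (hv0 : v ≠ 0) :
    v * (cos v / sin v) ≤ u * (cos u / sin u) + (u - v) * cotDefect u := by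
  have hev : ∀ t : ℝ, -t * (cos (-t) / sin (-t)) = t * (cos t / sin t) := by
    intro t
    rw [cos_neg, sin_neg, div_neg]
    ring
  have hodd : ∀ t : ℝ, cotDefect (-t) = -cotDefect t := by
    intro t
    simp only [cotDefect, cos_neg, sin_neg, div_neg]
    ring
  rcases lt_or_gt_of_ne hu0 with h | h
  · have := mul_cot_le_tangent_of_pos (u := -u) (v := -v) ⟨by linarith, by linarith⟩
      ⟨by linarith, by linarith⟩
    rw [hev, hev, hodd] at this
    linarith
  · rcases lt_or_gt_of_ne hv0 with h' | h'
    · have := mul_cot_le_tangent_of_pos (u := u) (v := -v) ⟨h, hu⟩ ⟨by linarith, by linarith⟩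
      rw [hev] at this
      have hn := cotDefect_nonneg ⟨h, hu⟩
      nlinarith
    · exact mul_cot_le_tangent_of_pos ⟨h, hu⟩ ⟨h', hvu.trans hu⟩

theorem sin_mul_one_add_sum_cos (H : ℕ) (t : ℝ) :
    sin t * (1 + 2 * ∑ h ∈ Ioc 0 H, cos (2 * h * t)) = sin ((2 * H + 1) * t) := by
  induction H with
  | zero => simp
  | succ n ih =>
    rw [sum_Ioc_succ_top (Nat.zero_le n)]
    have h1 := sin_sub_sin ((2 * ((n + 1 : ℕ) : ℝ) + 1) * t) ((2 * n + 1) * t)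
    have e1 : ((2 * ((n + 1 : ℕ) : ℝ) + 1) * t - (2 * n + 1) * t) / 2 = t := by push_cast; ring
    have e2 : ((2 * ((n + 1 : ℕ) : ℝ) + 1) * t + (2 * n + 1) * t) / 2 = 2 * ((n + 1 : ℕ) : ℝ) * t := by
      push_cast; ring
    rw [e1, e2] at h1
    linear_combination ih - h1

theorem sin_sq_sub_sin_sq_step (H : ℕ) (t : ℝ) :
    sin (((H + 1 : ℕ) : ℝ) * t) ^ 2 - sin (H * t) ^ 2 = sin t * sin ((2 * H + 1) * t) := by
  have e : (2 * (H : ℝ) + 1) * t = ((H + 1 : ℕ) : ℝ) * t + H * t := by push_cast; ring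
  have e' : t = ((H + 1 : ℕ) : ℝ) * t - H * t := by push_cast; ring
  rw [e]
  conv_rhs => rw [show sin t = sin (((H + 1 : ℕ) : ℝ) * t - H * t) from congrArg sin e']
  rw [sin_sub, sin_add]
  have h1 := sin_sq_add_cos_sq (((H + 1 : ℕ) : ℝ) * t)
  have h2 := sin_sq_add_cos_sq ((H : ℝ) * t)
  linear_combination (-sin (((H + 1 : ℕ) : ℝ) * t) ^ 2) * h2 + sin (H * t) ^ 2 * h1

theorem sin_sq_mul_fejer (H : ℕ) (t : ℝ) :
    sin t ^ 2 * (H + 2 * ∑ h ∈ Ioo 0 H, ((H : ℝ) - h) * cos (2 * h * t)) = sin (H * t) ^ 2 := by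
  have hIoc : ∀ n : ℕ, ∑ h ∈ Ioo 0 n, ((n : ℝ) - h) * cos (2 * h * t) =
      ∑ h ∈ Ioc 0 n, ((n : ℝ) - h) * cos (2 * h * t) := by
    intro n
    refine sum_subset Ioo_subset_Ioc_self fun h h1 h2 => ?_
    have : h = n := by simp at h1 h2; omega
    simp [this]
  rw [hIoc]
  induction H with
  | zero => simp
  | succ n ih =>
    rw [sum_Ioc_succ_top (Nat.zero_le n)]
    have h1 := sin_sq_sub_sin_sq_step n t
    have h2 := sin_mul_one_add_sum_cos n t
    have h3 : ∑ h ∈ Ioc 0 n, (((n + 1 : ℕ) : ℝ) - h) * cos (2 * h * t) =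
        ∑ h ∈ Ioc 0 n, ((n : ℝ) - h) * cos (2 * h * t) + ∑ h ∈ Ioc 0 n, cos (2 * h * t) := by
      rw [← sum_add_distrib]
      refine sum_congr rfl fun h _ => ?_
      push_cast; ring
    rw [h3]
    push_cast at h1 ⊢
    linear_combination ih - h1 + sin t * h2

theorem sin_mul_sum_sin (H : ℕ) (hH : 0 < H) (t : ℝ) :
    sin t * (∑ h ∈ Ioo 0 H, sin (2 * h * t) + 1 / 2 * sin (2 * H * t)) =
      cos t * sin (H * t) ^ 2 := by
  induction H, hH using Nat.le_induction with
  | base =>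
    have : Ioo 0 (Nat.succ 0) = ∅ := by ext; simp; omega
    rw [this]
    simp [sin_two_mul]; ring
  | succ n hn ih =>
    have : Ioo 0 (n + 1) = insert n (Ioo 0 n) := by ext; simp; omega
    rw [this, sum_insert (by simp)]
    have h1 := sin_sq_sub_sin_sq_step n t
    have e : 2 * ((n + 1 : ℕ) : ℝ) * t = (2 * n + 1) * t + t := by push_cast; ring
    have e' : 2 * (n : ℝ) * t = (2 * n + 1) * t - t := by ring
    rw [e', sin_sub] at ih ⊢
    rw [e, sin_add]
    linear_combination ih - cos t * h1

theorem sum_range_mul_pow {r : ℂ} {n : ℕ} :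
    (∑ m ∈ range n, (m : ℂ) * r ^ m) * (r - 1) = n * r ^ n - r * ∑ m ∈ range n, r ^ m := by
  induction n with
  | zero => simp
  | succ n ih =>
    rw [sum_range_succ, sum_range_succ, add_mul, ih]
    push_cast
    ring

/-- `exp(-2πih/H)`, the root of unity that describes the effect of a shift by `1/H`. -/
theorem exp_shift_facts {h H : ℕ} (h0 : 0 < h) (hH : h < H) :
    let r := Complex.exp (-(2 * π * h / H : ℝ) * Complex.I)
    r ^ H = 1 ∧ r ≠ 1 := by
  intro r
  have hH0 : (H : ℝ) ≠ 0 := by exact_mod_cast (h0.trans hH).ne'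
  constructor
  · simp only [r]
    rw [← Complex.exp_nat_mul, Complex.exp_eq_one_iff]
    refine ⟨-h, ?_⟩
    push_cast
    have : (H : ℂ) ≠ 0 := by exact_mod_cast hH0
    field_simp
  · intro hr
    simp only [r] at hr
    rw [Complex.exp_eq_one_iff] at hr
    obtain ⟨n, hn⟩ := hr
    have h2 := congrArg Complex.im hn
    simp at h2
    have h3 : (h : ℝ) = -n * H := by
      field_simp at h2
      linarith
    have h4 : (h : ℤ) = -n * H := by exact_mod_cast h3
    have h5 : (H : ℤ) ∣ h := ⟨-n, by rw [h4]; ring⟩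
    have := Int.le_of_dvd (by exact_mod_cast h0) h5
    omega

theorem sum_exp_shift {h H : ℕ} (h0 : 0 < h) (hH : h < H) (x : ℝ) :
    ∑ m ∈ range H, Complex.exp ((2 * π * h * (x - m / H) : ℝ) * Complex.I) = 0 := by
  obtain ⟨h1, h2⟩ := exp_shift_facts h0 hH
  have : ∀ m : ℕ, Complex.exp ((2 * π * h * (x - m / H) : ℝ) * Complex.I) =
      Complex.exp ((2 * π * h * x : ℝ) * Complex.I) *
        Complex.exp (-(2 * π * h / H : ℝ) * Complex.I) ^ m := by
    intro m
    rw [← Complex.exp_nat_mul, ← Complex.exp_add]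
    congr 1
    push_cast
    ring
  simp_rw [this]
  rw [← mul_sum, geom_sum_eq h2, h1]
  simp

theorem sum_cos_shift {h H : ℕ} (h0 : 0 < h) (hH : h < H) (x : ℝ) :
    ∑ m ∈ range H, cos (2 * π * h * (x - m / H)) = 0 := by
  have := congrArg Complex.re (sum_exp_shift h0 hH x)
  rw [Complex.re_sum] at this
  simpa only [Complex.exp_ofReal_mul_I_re, Complex.zero_re] using this

theorem sum_sin_shift {h H : ℕ} (h0 : 0 < h) (hH : h < H) (x : ℝ) :
    ∑ m ∈ range H, sin (2 * π * h * (x - m / H)) = 0 := by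
  have := congrArg Complex.im (sum_exp_shift h0 hH x)
  rw [Complex.im_sum] at this
  simpa only [Complex.exp_ofReal_mul_I_im, Complex.zero_im] using this

theorem sum_mul_cos_shift {h H : ℕ} (h0 : 0 < h) (hH : h < H) (x : ℝ) :
    ∑ m ∈ range H, (m : ℝ) * cos (2 * π * h * (x - m / H)) =
      -(H / 2) * (cos (2 * π * h * x) + cot (π * (h / H)) * sin (2 * π * h * x)) := by
  obtain ⟨h1, h2⟩ := exp_shift_facts h0 hH
  have hHr : (0 : ℝ) < H := by exact_mod_cast h0.trans hH
  set r := Complex.exp (-(2 * π * h / H : ℝ) * Complex.I) with hr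
  have hterm : ∀ m : ℕ, (m : ℂ) * Complex.exp ((2 * π * h * (x - m / H) : ℝ) * Complex.I) =
      Complex.exp ((2 * π * h * x : ℝ) * Complex.I) * (m * r ^ m) := by
    intro m
    rw [hr, ← Complex.exp_nat_mul, mul_left_comm, ← Complex.exp_add]
    congr 2
    push_cast
    ring
  have hsum : ∑ m ∈ range H, (m : ℂ) * r ^ m = H / (r - 1) := by
    rw [eq_div_iff (sub_ne_zero.mpr h2), sum_range_mul_pow, h1, geom_sum_eq h2, h1]
    simp
  -- the half-angle formula for `1 / (exp(-iθ) - 1)`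
  have hpos : 0 < sin (π * (h / H)) := by
    apply sin_pos_of_pos_of_lt_pi
    · have : (0 : ℝ) < h := by exact_mod_cast h0
      positivity
    · have : (h : ℝ) / H < 1 := by
        rw [div_lt_one hHr]
        exact_mod_cast hH
      nlinarith [pi_pos]
  have hinv : 1 / (r - 1) = -1 / 2 + (cot (π * (h / H)) / 2 : ℝ) * Complex.I := by
    rw [div_eq_iff (sub_ne_zero.mpr h2)]
    have hr' : r = ((1 - 2 * sin (π * (h / H)) ^ 2 : ℝ) : ℂ) -
        ((2 * sin (π * (h / H)) * cos (π * (h / H)) : ℝ) : ℂ) * Complex.I := by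
      have e1 : (-(2 * π * h / H : ℝ) : ℂ) * Complex.I =
          ((-(2 * (π * (h / H))) : ℝ) : ℂ) * Complex.I := by
        congr 1
        push_cast
        ring
      rw [hr, e1, Complex.exp_mul_I, ← Complex.ofReal_cos, ← Complex.ofReal_sin, cos_neg, sin_neg,
        cos_two_mul, sin_two_mul, cos_sq']
      push_cast
      ring
    rw [hr', cot_eq_cos_div_sin]
    have hc := sin_sq_add_cos_sq (π * (h / H))
    set s := sin (π * (h / H))
    set c := cos (π * (h / H))
    have hs : (s : ℂ) ≠ 0 := by exact_mod_cast hpos.ne'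
    have hc' : (s : ℂ) ^ 2 + (c : ℂ) ^ 2 = 1 := by exact_mod_cast hc
    push_cast
    field_simp
    linear_combination (-2 * (s : ℂ)) * hc' + (2 * (c : ℂ) ^ 2 * s) * Complex.I_sq
  have hfin : ∑ m ∈ range H, (m : ℂ) * Complex.exp ((2 * π * h * (x - m / H) : ℝ) * Complex.I) =
      Complex.exp ((2 * π * h * x : ℝ) * Complex.I) *
        (H * (-1 / 2 + (cot (π * (h / H)) / 2 : ℝ) * Complex.I)) := by
    simp_rw [hterm]
    rw [← mul_sum, hsum, ← hinv]
    ring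
  have := congrArg Complex.re hfin
  rw [Complex.re_sum] at this
  have hl : ∀ m : ℕ, ((m : ℂ) * Complex.exp ((2 * π * h * (x - m / H) : ℝ) * Complex.I)).re =
      (m : ℝ) * cos (2 * π * h * (x - m / H)) := by
    intro m
    rw [← Complex.exp_ofReal_mul_I_re, ← Complex.ofReal_natCast, Complex.re_ofReal_mul]
  simp_rw [hl] at this
  rw [this, Complex.mul_re, Complex.exp_ofReal_mul_I_re, Complex.exp_ofReal_mul_I_im]
  have e3 : (H * (-1 / 2 + (cot (π * (h / H)) / 2 : ℝ) * Complex.I) : ℂ) =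
      ((-(H : ℝ) / 2 : ℝ) : ℂ) + ((H * cot (π * (h / H)) / 2 : ℝ) : ℂ) * Complex.I := by
    push_cast; ring
  rw [e3]
  simp only [Complex.add_re, Complex.ofReal_re, Complex.re_ofReal_mul, Complex.I_re,
    Complex.add_im, Complex.ofReal_im, Complex.im_ofReal_mul, Complex.I_im]
  ring

/-- The approximating trigonometric sum misses `x - 1/2` by an amount that a Riemann sum of the
monotone function `cotDefect` controls. -/
theorem vaaler_lower_of_sin_ne_zero {H : ℕ} (hH : 0 < H) {x : ℝ} (h0 : 0 < x) (h1 : x < 1)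
    (hx : sin (H * (π * x)) ≠ 0) :
    0 ≤ x - 1 / 2 + ∑ h ∈ Ioo 0 H, alpha h H * sin (2 * π * h * x) +
      (1 / (2 * H) + ∑ h ∈ Ioo 0 H, beta h H * cos (2 * π * h * x)) := by
  have hHr : (0 : ℝ) < H := by exact_mod_cast hH
  have hπ := pi_pos
  set s := sin (H * (π * x)) ^ 2 with hs
  have hs0 : 0 < s := by positivity
  -- sine and cosine at the shifted points
  have hshift : ∀ m : ℕ, H * (π * (x - m / H)) = H * (π * x) - m * π := by
    intro m; field_simp
  have hsm : ∀ m : ℕ, sin (H * (π * (x - m / H))) ^ 2 = s := by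
    intro m
    rw [hshift, sin_sub_nat_mul_pi, mul_pow, ← pow_mul, mul_comm m 2, pow_mul]
    simp [hs]
  have hne : ∀ m : ℕ, sin (π * (x - m / H)) ≠ 0 := by
    intro m h
    have := sin_sq_mul_fejer H (π * (x - m / H))
    rw [hsm, h] at this
    simp at this
    exact hs0.ne this
  have htwo : ∀ m : ℕ, sin (2 * H * (π * (x - m / H))) = sin (2 * H * (π * x)) := by
    intro m
    rw [show 2 * (H : ℝ) * (π * (x - m / H)) = 2 * H * (π * x) - m * (2 * π) by field_simp]
    exact sin_sub_nat_mul_two_pi _ _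
  have hcs : ∀ m : ℕ, cos (π * (x - m / H)) / sin (π * (x - m / H)) * s =
      ∑ h ∈ Ioo 0 H, sin (2 * π * h * (x - m / H)) + 1 / 2 * sin (2 * H * (π * x)) := by
    intro m
    have := sin_mul_sum_sin H hH (π * (x - m / H))
    rw [hsm, htwo] at this
    rw [div_mul_eq_mul_div, ← this, mul_div_cancel_left₀ _ (hne m)]
    congr 1
    refine sum_congr rfl fun h _ => ?_
    congr 1; ring
  have hss : ∀ m : ℕ, 1 / sin (π * (x - m / H)) ^ 2 * s =
      H + 2 * ∑ h ∈ Ioo 0 H, ((H : ℝ) - h) * cos (2 * π * h * (x - m / H)) := by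
    intro m
    have := sin_sq_mul_fejer H (π * (x - m / H))
    rw [hsm] at this
    rw [div_mul_eq_mul_div, one_mul, ← this, mul_div_cancel_left₀ _ (pow_ne_zero 2 (hne m))]
    congr 2
    refine sum_congr rfl fun h _ => ?_
    congr 2; ring
  -- the telescoped tangent inequalities
  have hrie : -(H * (cos (π * x) / sin (π * x))) ≤
      ∑ m ∈ range H, cotDefect (π * (x - m / H)) := by
    set G : ℕ → ℝ := fun i => π * (x - i / H) * (cos (π * (x - i / H)) / sin (π * (x - i / H)))
      with hG
    have hstep : ∀ m ∈ range H, G (m + 1) - G m ≤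
          π / H * cotDefect (π * (x - m / H)) := by
      intro m hm
      have hmH : ((m + 1 : ℕ) : ℝ) / H ≤ 1 := by
        rw [div_le_one hHr]
        exact_mod_cast mem_range.mp hm
      have hm0 : (0 : ℝ) ≤ (m : ℝ) / H := by positivity
      have hdiff : π * (x - m / H) - π * (x - ((m + 1 : ℕ) : ℝ) / H) = π / H := by
        push_cast; field_simp; ring
      have hpH : 0 < π / H := by positivity
      have := mul_cot_le_tangent (u := π * (x - m / H)) (v := π * (x - ((m + 1 : ℕ) : ℝ) / H))
        (by nlinarith) (by nlinarith) (by linarith)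
        (fun h => hne m (by rw [h, sin_zero])) (fun h => hne (m + 1) (by rw [h, sin_zero]))
      rw [hdiff] at this
      simp only [hG]
      linarith
    have := sum_le_sum hstep
    rw [sum_range_sub, ← mul_sum] at this
    simp only [hG] at this
    have hlast : (H : ℝ) / H = 1 := div_self hHr.ne'
    simp only [hlast, Nat.cast_zero, zero_div, sub_zero] at this
    have hc : cos (π * (x - 1)) / sin (π * (x - 1)) = cos (π * x) / sin (π * x) := by
      rw [mul_sub, mul_one, cos_sub_pi, sin_sub_pi, neg_div_neg_eq]
    rw [hc] at this
    have h3 : -(H * (cos (π * x) / sin (π * x))) =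
        H / π * (π * (x - 1) * (cos (π * x) / sin (π * x)) - π * x * (cos (π * x) / sin (π * x))) := by
      field_simp
      ring
    rw [h3]
    calc _ ≤ H / π * (π / H * ∑ m ∈ range H, cotDefect (π * (x - m / H))) := by gcongr
      _ = _ := by field_simp
  -- evaluation of the two sides by finite Fourier analysis
  have h0' : sin (π * x) ≠ 0 := by simpa using hne 0
  have hc0 : cos (π * x) / sin (π * x) * s =
      ∑ h ∈ Ioo 0 H, sin (2 * π * h * x) + 1 / 2 * sin (2 * H * (π * x)) := by
    simpa using hcs 0
  have hsumc : (∑ m ∈ range H, cos (π * (x - m / H)) / sin (π * (x - m / H))) * s =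
      H * (1 / 2 * sin (2 * H * (π * x))) := by
    rw [sum_mul]
    simp_rw [hcs]
    rw [sum_add_distrib, sum_comm, sum_eq_zero, sum_const, card_range, nsmul_eq_mul, zero_add]
    intro h hh
    rw [mem_Ioo] at hh
    exact sum_sin_shift hh.1 hh.2 x
  have hsums : (∑ m ∈ range H, (x - m / H) / sin (π * (x - m / H)) ^ 2) * s =
      H ^ 2 * x - H * (H - 1) / 2 + ∑ h ∈ Ioo 0 H, ((H : ℝ) - h) *
        (cos (2 * π * h * x) + cot (π * (h / H)) * sin (2 * π * h * x)) := by
    have e1 : ∀ m : ℕ, (x - m / H) / sin (π * (x - m / H)) ^ 2 * s =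
        (H * x - m) + ∑ h ∈ Ioo 0 H, 2 * ((H : ℝ) - h) *
          (x * cos (2 * π * h * (x - m / H)) - 1 / H * (m * cos (2 * π * h * (x - m / H)))) := by
      intro m
      rw [div_eq_mul_one_div, mul_assoc, hss, mul_add, mul_left_comm, mul_sum, mul_sum]
      congr 1
      · field_simp
      · refine sum_congr rfl fun h _ => ?_
        ring
    rw [sum_mul]
    simp_rw [e1]
    rw [sum_add_distrib, sum_comm]
    congr 1
    · rw [sum_sub_distrib, sum_const, card_range, nsmul_eq_mul]
      have hg : ((∑ i ∈ range H, i : ℕ) : ℝ) * 2 = H * (H - 1) := by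
        have := Finset.sum_range_id_mul_two H
        have h4 : ((H - 1 : ℕ) : ℝ) = (H : ℝ) - 1 := by
          rw [Nat.cast_sub hH]; simp
        rw [← h4]
        exact_mod_cast this
      push_cast at hg
      linear_combination (-1 / 2) * hg
    · refine sum_congr rfl fun h hh => ?_
      rw [mem_Ioo] at hh
      rw [← mul_sum, sum_sub_distrib, ← mul_sum, ← mul_sum, sum_cos_shift hh.1 hh.2,
        sum_mul_cos_shift hh.1 hh.2]
      field_simp
      ring
  have hdef : ∑ m ∈ range H, cotDefect (π * (x - m / H)) =
      π * (∑ m ∈ range H, (x - m / H) / sin (π * (x - m / H)) ^ 2) -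
        ∑ m ∈ range H, cos (π * (x - m / H)) / sin (π * (x - m / H)) := by
    rw [mul_sum, ← sum_sub_distrib]
    refine sum_congr rfl fun m _ => ?_
    simp only [cotDefect]
    ring
  have hab : x - 1 / 2 + ∑ h ∈ Ioo 0 H, alpha h H * sin (2 * π * h * x) +
      (1 / (2 * H) + ∑ h ∈ Ioo 0 H, beta h H * cos (2 * π * h * x)) =
      x - 1 / 2 + 1 / (2 * H) + 1 / H ^ 2 * (∑ h ∈ Ioo 0 H, ((H : ℝ) - h) *
        (cos (2 * π * h * x) + cot (π * (h / H)) * sin (2 * π * h * x))) +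
        1 / (π * H) * ∑ h ∈ Ioo 0 H, sin (2 * π * h * x) := by
    have : ∑ h ∈ Ioo 0 H, alpha h H * sin (2 * π * h * x) +
        ∑ h ∈ Ioo 0 H, beta h H * cos (2 * π * h * x) =
        1 / H ^ 2 * (∑ h ∈ Ioo 0 H, ((H : ℝ) - h) *
        (cos (2 * π * h * x) + cot (π * (h / H)) * sin (2 * π * h * x))) +
        1 / (π * H) * ∑ h ∈ Ioo 0 H, sin (2 * π * h * x) := by
      rw [mul_sum, mul_sum, ← sum_add_distrib, ← sum_add_distrib]
      refine sum_congr rfl fun h hh => ?_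
      rw [mem_Ioo] at hh
      have : (0 : ℝ) < h := by exact_mod_cast hh.1
      simp only [alpha, beta, rho]
      field_simp
      ring
    linear_combination this
  rw [hab]
  have hmul := mul_le_mul_of_nonneg_right hrie hs0.le
  rw [hdef] at hmul
  have hfin : 0 ≤ π * H ^ 2 * (x - 1 / 2 + 1 / (2 * H) + 1 / H ^ 2 * (∑ h ∈ Ioo 0 H, ((H : ℝ) - h) *
        (cos (2 * π * h * x) + cot (π * (h / H)) * sin (2 * π * h * x))) +
        1 / (π * H) * ∑ h ∈ Ioo 0 H, sin (2 * π * h * x)) := by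
    have e2 : π * H ^ 2 * (x - 1 / 2 + 1 / (2 * H) + 1 / H ^ 2 * (∑ h ∈ Ioo 0 H, ((H : ℝ) - h) *
        (cos (2 * π * h * x) + cot (π * (h / H)) * sin (2 * π * h * x))) +
        1 / (π * H) * ∑ h ∈ Ioo 0 H, sin (2 * π * h * x)) =
        π * (H ^ 2 * x - H * (H - 1) / 2 + ∑ h ∈ Ioo 0 H, ((H : ℝ) - h) *
        (cos (2 * π * h * x) + cot (π * (h / H)) * sin (2 * π * h * x))) +
        H * ∑ h ∈ Ioo 0 H, sin (2 * π * h * x) := by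
      field_simp
      ring
    rw [e2]
    rw [sub_mul, mul_assoc π, hsums, hsumc] at hmul
    linear_combination hmul + H * hc0
  exact nonneg_of_mul_nonneg_right (by linarith) (by positivity : 0 < π * (H : ℝ) ^ 2)

theorem vaaler_lower {H : ℕ} (hH : 0 < H) {x : ℝ} (h0 : 0 ≤ x) (h1 : x ≤ 1) :
    0 ≤ x - 1 / 2 + ∑ h ∈ Ioo 0 H, alpha h H * sin (2 * π * h * x) +
      (1 / (2 * H) + ∑ h ∈ Ioo 0 H, beta h H * cos (2 * π * h * x)) := by
  have hHr : (0 : ℝ) < H := by exact_mod_cast hH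
  have hclosed : IsClosed {y : ℝ | 0 ≤ y - 1 / 2 + ∑ h ∈ Ioo 0 H, alpha h H * sin (2 * π * h * y) +
      (1 / (2 * H) + ∑ h ∈ Ioo 0 H, beta h H * cos (2 * π * h * y))} :=
    isClosed_le continuous_const (by fun_prop)
  have key : ∀ m : ℕ, m < H → Set.Icc ((m : ℝ) / H) ((m + 1) / H) ⊆
      {y : ℝ | 0 ≤ y - 1 / 2 + ∑ h ∈ Ioo 0 H, alpha h H * sin (2 * π * h * y) +
      (1 / (2 * H) + ∑ h ∈ Ioo 0 H, beta h H * cos (2 * π * h * y))} := by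
    intro m hm
    have hlt : (m : ℝ) / H < (m + 1) / H := by gcongr; linarith
    rw [← closure_Ioo hlt.ne]
    refine hclosed.closure_subset_iff.mpr fun y hy => ?_
    have hmH : (m : ℝ) + 1 ≤ H := by exact_mod_cast hm
    have hy1 : (m : ℝ) < y * H := by rw [← div_lt_iff₀ hHr]; exact hy.1
    have hy2 : y * H < m + 1 := by rw [← lt_div_iff₀ hHr]; exact hy.2
    have hm0 : (0 : ℝ) ≤ m := by positivity
    refine vaaler_lower_of_sin_ne_zero hH (by by_contra h; nlinarith) (by by_contra h; nlinarith) ?_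
    have hp : 0 < sin (H * (π * y) - m * π) := by
      apply sin_pos_of_pos_of_lt_pi
      · nlinarith [pi_pos]
      · nlinarith [pi_pos]
    rw [sin_sub_nat_mul_pi] at hp
    exact right_ne_zero_of_mul hp.ne'
  rcases h1.lt_or_eq with h | h
  · have hm : ⌊x * H⌋₊ < H := by
      rw [Nat.floor_lt (by positivity)]
      nlinarith
    refine key _ hm ⟨?_, ?_⟩
    · rw [div_le_iff₀ hHr]
      exact Nat.floor_le (by positivity)
    · rw [le_div_iff₀ hHr]
      exact (Nat.lt_floor_add_one _).le
  · refine key (H - 1) (by omega) ⟨?_, ?_⟩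
    · rw [div_le_iff₀ hHr, h, one_mul]
      exact_mod_cast Nat.sub_le H 1
    · rw [le_div_iff₀ hHr, h, one_mul, Nat.cast_sub hH]
      simp

/-- Vaaler's inequality. -/
theorem vaaler {H : ℕ} (hH : 0 < H) (w : ℝ) :
    |psi w + ∑ h ∈ Ioo 0 H, alpha h H * sin (2 * π * h * w)| ≤
      1 / (2 * H) + ∑ h ∈ Ioo 0 H, beta h H * cos (2 * π * h * w) := by
  set x := w - ⌊w⌋ with hx
  have hs : ∀ h : ℕ, 2 * π * h * w = 2 * π * h * x + ((h * ⌊w⌋ : ℤ) : ℝ) * (2 * π) := by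
    intro h; rw [hx]; push_cast; ring
  simp_rw [hs, sin_add_int_mul_two_pi, cos_add_int_mul_two_pi]
  have h0 : 0 ≤ x := sub_nonneg.mpr (Int.floor_le w)
  have h1 : x ≤ 1 := by linarith [Int.lt_floor_add_one w]
  have hps : psi w = x - 1 / 2 := rfl
  have hl := vaaler_lower hH h0 h1
  have hu := vaaler_lower hH (x := 1 - x) (by linarith) (by linarith)
  have hr : ∀ h : ℕ, 2 * π * h * (1 - x) = (h : ℝ) * (2 * π) - 2 * π * h * x := by intro h; ring
  simp_rw [hr, sin_nat_mul_two_pi_sub, cos_nat_mul_two_pi_sub, mul_neg] at hu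
  rw [sum_neg_distrib] at hu
  rw [hps, abs_le]
  constructor <;> linarith

/-! ### Functions with at most one change of sign -/

/-- `f` changes its sign at most once on the open interval `(a, b)`, at `c`; the number `ε = ±1`
tells the direction of the change. -/
def OneSignChange (f : ℝ → ℝ) (a b : ℝ) : Prop :=
  ∃ c ∈ Set.Icc a b, ∃ ε : ℝ, (ε = 1 ∨ ε = -1) ∧
    (∀ t ∈ Set.Ioo a c, ε * f t ≤ 0) ∧ ∀ t ∈ Set.Ioo c b, 0 ≤ ε * f t

theorem OneSignChange.transfer {f g : ℝ → ℝ} {a b : ℝ} (hf : OneSignChange f a b)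
    (hpos : ∀ t ∈ Set.Ioo a b, 0 ≤ f t → 0 ≤ g t)
    (hneg : ∀ t ∈ Set.Ioo a b, f t ≤ 0 → g t ≤ 0) : OneSignChange g a b := by
  obtain ⟨c, hc, ε, hε, h1, h2⟩ := hf
  refine ⟨c, hc, ε, hε, fun t ht => ?_, fun t ht => ?_⟩
  · have h := h1 t ht
    have ht' : t ∈ Set.Ioo a b := ⟨ht.1, ht.2.trans_le hc.2⟩
    rcases hε with rfl | rfl
    · have := hneg t ht' (by linarith)
      linarith
    · have := hpos t ht' (by linarith)
      linarith
  · have h := h2 t ht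
    have ht' : t ∈ Set.Ioo a b := ⟨hc.1.trans_lt ht.1, ht.2⟩
    rcases hε with rfl | rfl
    · have := hpos t ht' (by linarith)
      linarith
    · have := hneg t ht' (by linarith)
      linarith

theorem exists_sign_change_of_monotoneOn {f : ℝ → ℝ} {a b : ℝ} (hab : a ≤ b)
    (hf : MonotoneOn f (Set.Ioo a b)) :
    ∃ c ∈ Set.Icc a b, (∀ t ∈ Set.Ioo a c, f t ≤ 0) ∧ ∀ t ∈ Set.Ioo c b, 0 ≤ f t := by
  set s := insert a {t | t ∈ Set.Ioo a b ∧ f t ≤ 0} with hs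
  have hbd : BddAbove s := ⟨b, by
    rintro t (rfl | ht)
    · exact hab
    · exact ht.1.2.le⟩
  have hne : s.Nonempty := ⟨a, Set.mem_insert _ _⟩
  refine ⟨sSup s, ⟨le_csSup hbd (Set.mem_insert _ _), csSup_le hne ?_⟩, fun t ht => ?_,
    fun t ht => ?_⟩
  · rintro t (rfl | ht)
    · exact hab
    · exact ht.1.2.le
  · obtain ⟨r, hr, htr⟩ := exists_lt_of_lt_csSup hne ht.2
    rcases hr with rfl | hr
    · exact absurd ht.1 (not_lt.mpr htr.le)
    · exact (hf ⟨ht.1, htr.trans hr.1.2⟩ hr.1 htr.le).trans hr.2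
  · by_contra! h
    have hat : a < t := (le_csSup hbd (Set.mem_insert _ _)).trans_lt ht.1
    have := le_csSup hbd (Set.mem_insert_of_mem a (⟨⟨hat, ht.2⟩, h.le⟩ : t ∈ Set.Ioo a b ∧ f t ≤ 0))
    exact absurd ht.1 (not_lt.mpr this)

theorem OneSignChange.of_monotoneOn {f : ℝ → ℝ} {a b : ℝ} (hab : a ≤ b)
    (hf : MonotoneOn f (Set.Ioo a b)) : OneSignChange f a b := by
  obtain ⟨c, hc, h1, h2⟩ := exists_sign_change_of_monotoneOn hab hf
  exact ⟨c, hc, 1, Or.inl rfl, by simpa using h1, by simpa using h2⟩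

theorem OneSignChange.mono {f : ℝ → ℝ} {a b a' b' : ℝ} (hf : OneSignChange f a b) (ha : a ≤ a')
    (hb : b' ≤ b) (hab : a' ≤ b') : OneSignChange f a' b' := by
  obtain ⟨c, hc, ε, hε, h1, h2⟩ := hf
  refine ⟨max a' (min c b'), ⟨le_max_left _ _, max_le hab (min_le_right _ _)⟩, ε, hε,
    fun t ht => h1 t ⟨ha.trans_lt ht.1, ?_⟩, fun t ht => h2 t ⟨?_, ht.2.trans_le hb⟩⟩
  · rcases lt_max_iff.mp ht.2 with h | h
    · exact absurd ht.1 (not_lt.mpr h.le)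
    · exact h.trans_le (min_le_left _ _)
  · rcases min_lt_iff.mp ((le_max_right _ _).trans_lt ht.1) with h | h
    · exact h
    · exact absurd ht.2 (not_lt.mpr h.le)

theorem OneSignChange.comp_add {f : ℝ → ℝ} {a b : ℝ} (hf : OneSignChange f a b) (τ : ℝ) :
    OneSignChange (fun t => f (τ + t)) (a - τ) (b - τ) := by
  obtain ⟨c, hc, ε, hε, h1, h2⟩ := hf
  refine ⟨c - τ, ⟨by linarith [hc.1], by linarith [hc.2]⟩, ε, hε, fun t ht => h1 _ ?_,
    fun t ht => h2 _ ?_⟩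
  · exact ⟨by linarith [ht.1], by linarith [ht.2]⟩
  · exact ⟨by linarith [ht.1], by linarith [ht.2]⟩

theorem OneSignChange.comp_sub {f : ℝ → ℝ} {a b : ℝ} (hf : OneSignChange f a b) (τ : ℝ) :
    OneSignChange (fun t => f (τ - t)) (τ - b) (τ - a) := by
  obtain ⟨c, hc, ε, hε, h1, h2⟩ := hf
  refine ⟨τ - c, ⟨by linarith [hc.2], by linarith [hc.1]⟩, -ε, ?_, fun t ht => ?_,
    fun t ht => ?_⟩
  · rcases hε with rfl | rfl <;> simp
  · have := h2 (τ - t) ⟨by linarith [ht.2], by linarith [ht.1]⟩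
    linarith
  · have := h1 (τ - t) ⟨by linarith [ht.2], by linarith [ht.1]⟩
    linarith

/-- An antiderivative that starts from `0` inherits the property of changing its sign at most
once. -/
theorem OneSignChange.of_deriv {f f' : ℝ → ℝ} {a b : ℝ}
    (hd : ∀ t ∈ Set.Icc a b, HasDerivAt f (f' t) t) (h0 : f a = 0)
    (hf : OneSignChange f' a b) : OneSignChange f a b := by
  obtain ⟨c, hc, ε, hε, h1, h2⟩ := hf
  have hd' : ∀ t ∈ Set.Icc a b, HasDerivAt (fun x => ε * f x) (ε * f' t) t :=
    fun t ht => (hd t ht).const_mul ε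
  have hcont : ContinuousOn (fun x => ε * f x) (Set.Icc a b) :=
    fun t ht => (hd' t ht).continuousAt.continuousWithinAt
  have hanti : AntitoneOn (fun x => ε * f x) (Set.Icc a c) := by
    refine antitoneOn_of_hasDerivWithinAt_nonpos (f' := fun t => ε * f' t) (convex_Icc _ _)
      (hcont.mono (Set.Icc_subset_Icc_right hc.2)) (fun t ht => ?_) (fun t ht => ?_)
    · rw [interior_Icc] at ht
      exact (hd' t ⟨ht.1.le, ht.2.le.trans hc.2⟩).hasDerivWithinAt
    · rw [interior_Icc] at ht
      exact h1 t ht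
  have hmono : MonotoneOn (fun x => ε * f x) (Set.Icc c b) := by
    refine monotoneOn_of_hasDerivWithinAt_nonneg (f' := fun t => ε * f' t) (convex_Icc _ _)
      (hcont.mono (Set.Icc_subset_Icc_left hc.1)) (fun t ht => ?_) (fun t ht => ?_)
    · rw [interior_Icc] at ht
      exact (hd' t ⟨hc.1.trans ht.1.le, ht.2.le⟩).hasDerivWithinAt
    · rw [interior_Icc] at ht
      exact h2 t ht
  have hneg : ∀ t ∈ Set.Icc a c, ε * f t ≤ 0 := by
    intro t ht
    have := hanti (Set.left_mem_Icc.mpr hc.1) ht ht.1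
    simpa [h0] using this
  obtain ⟨c', hc', h1', h2'⟩ :=
    exists_sign_change_of_monotoneOn hc.2 (hmono.mono Set.Ioo_subset_Icc_self)
  refine ⟨c', ⟨hc.1.trans hc'.1, hc'.2⟩, ε, hε, fun t ht => ?_, h2'⟩
  rcases le_or_gt t c with h | h
  · exact hneg t ⟨ht.1.le, h⟩
  · exact h1' t ⟨h, ht.2⟩

/-! ### Oscillating integrals with monotone amplitude -/

theorem norm_integral_mul_deriv_le {F : ℝ → ℂ} {Q Q' : ℝ → ℝ} {a b ε : ℝ} (hab : a ≤ b)
    (hd : ∀ t ∈ Set.Icc a b, HasDerivAt Q (Q' t) t) (hc : ContinuousOn Q' (Set.Icc a b))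
    (hF : ∀ t, ‖F t‖ ≤ 1) (hε : ε = 1 ∨ ε = -1) (hs : ∀ t ∈ Set.Ioo a b, 0 ≤ ε * Q' t) :
    ‖∫ t in a..b, F t * (Q' t : ℂ)‖ ≤ |Q b - Q a| := by
  have hint : IntervalIntegrable (fun t => ε * Q' t) MeasureTheory.volume a b :=
    (ContinuousOn.intervalIntegrable (by rwa [Set.uIcc_of_le hab])).const_mul ε
  have h1 : ‖∫ t in a..b, F t * (Q' t : ℂ)‖ ≤ ∫ t in a..b, ε * Q' t := by
    refine intervalIntegral.norm_integral_le_of_norm_le hab ?_ hint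
    filter_upwards [(Set.finite_singleton b).countable.ae_notMem MeasureTheory.volume] with t ht ht'
    have h := hs t ⟨ht'.1, lt_of_le_of_ne ht'.2 ht⟩
    rw [norm_mul, Complex.norm_real, Real.norm_eq_abs]
    have : |Q' t| = ε * Q' t := by
      rcases hε with rfl | rfl
      · rw [abs_of_nonneg (by linarith)]; ring
      · rw [abs_of_nonpos (by linarith)]; ring
    rw [this]
    have := hF t
    nlinarith
  have h2 : ∫ t in a..b, ε * Q' t = ε * Q b - ε * Q a :=
    intervalIntegral.integral_eq_sub_of_hasDerivAt (f := fun t => ε * Q t)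
      (fun t ht => (hd t (by rwa [Set.uIcc_of_le hab] at ht)).const_mul ε) hint
  rw [h2] at h1
  refine h1.trans ?_
  rcases hε with rfl | rfl
  · rw [one_mul, one_mul]; exact le_abs_self _
  · rw [abs_sub_comm]
    refine le_trans (le_of_eq (by ring)) (le_abs_self _)

theorem norm_integral_mul_deriv_le_of_oneSignChange {F : ℝ → ℂ} {Q Q' : ℝ → ℝ} {a b M : ℝ}
    (hab : a ≤ b) (hFc : ContinuousOn F (Set.Icc a b))
    (hd : ∀ t ∈ Set.Icc a b, HasDerivAt Q (Q' t) t) (hc : ContinuousOn Q' (Set.Icc a b))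
    (hF : ∀ t, ‖F t‖ ≤ 1) (hs : OneSignChange Q' a b) (hM : ∀ t ∈ Set.Icc a b, |Q t| ≤ M) :
    ‖∫ t in a..b, F t * (Q' t : ℂ)‖ ≤ 4 * M := by
  obtain ⟨c, hcm, ε, hε, h1, h2⟩ := hs
  have hcont : ContinuousOn (fun t => F t * (Q' t : ℂ)) (Set.Icc a b) :=
    hFc.mul (Complex.continuous_ofReal.comp_continuousOn hc)
  have hsub1 : Set.Icc a c ⊆ Set.Icc a b := Set.Icc_subset_Icc_right hcm.2
  have hsub2 : Set.Icc c b ⊆ Set.Icc a b := Set.Icc_subset_Icc_left hcm.1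
  rw [← intervalIntegral.integral_add_adjacent_intervals (b := c)
    (ContinuousOn.intervalIntegrable (by rw [Set.uIcc_of_le hcm.1]; exact hcont.mono hsub1))
    (ContinuousOn.intervalIntegrable (by rw [Set.uIcc_of_le hcm.2]; exact hcont.mono hsub2))]
  have e1 := norm_integral_mul_deriv_le (F := F) (ε := -ε) hcm.1 (fun t ht => hd t (hsub1 ht))
    (hc.mono hsub1) hF (by rcases hε with rfl | rfl <;> simp)
    (fun t ht => by have := h1 t ht; linarith)
  have e2 := norm_integral_mul_deriv_le (F := F) (ε := ε) hcm.2 (fun t ht => hd t (hsub2 ht))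
    (hc.mono hsub2) hF hε h2
  have b1 := abs_le.mp (hM a ⟨le_rfl, hab⟩)
  have b2 := abs_le.mp (hM b ⟨hab, le_rfl⟩)
  have b3 := abs_le.mp (hM c hcm)
  have d1 : |Q c - Q a| ≤ 2 * M := abs_le.mpr ⟨by linarith, by linarith⟩
  have d2 : |Q b - Q c| ≤ 2 * M := abs_le.mpr ⟨by linarith, by linarith⟩
  refine (norm_add_le _ _).trans ?_
  linarith

theorem norm_e (x : ℝ) : ‖e x‖ = 1 := by
  have : e x = Complex.exp ((2 * π * x : ℝ) * Complex.I) := by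
    unfold e; congr 1; push_cast; ring
  rw [this, Complex.norm_exp_ofReal_mul_I]

theorem continuous_e : Continuous e := by
  unfold e; fun_prop

theorem e_add (x y : ℝ) : e (x + y) = e x * e y := by
  unfold e; rw [← Complex.exp_add]; congr 1; push_cast; ring

theorem hasDerivAt_e_comp {f : ℝ → ℝ} {f' t : ℝ} (hf : HasDerivAt f f' t) :
    HasDerivAt (fun x => e (f x)) (2 * π * Complex.I * f' * e (f t)) t := by
  have h := (hf.ofReal_comp.const_mul (2 * π * Complex.I)).cexp
  refine h.congr_deriv ?_
  unfold e
  ring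

/-- Integration by parts against `e ∘ f`. -/
theorem integral_e_mul_deriv_mul {f f' Q Q' : ℝ → ℝ} {a b : ℝ} (hab : a ≤ b)
    (hf : ∀ t ∈ Set.Icc a b, HasDerivAt f (f' t) t) (hf' : ContinuousOn f' (Set.Icc a b))
    (hQ : ∀ t ∈ Set.Icc a b, HasDerivAt Q (Q' t) t) (hQ' : ContinuousOn Q' (Set.Icc a b)) :
    ∫ t in a..b, e (f t) * ((f' t * Q t : ℝ) : ℂ) =
      1 / (2 * π * Complex.I) * (e (f b) * Q b - e (f a) * Q a -
        ∫ t in a..b, e (f t) * (Q' t : ℂ)) := by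
  have hcf : ContinuousOn (fun t => e (f t)) (Set.Icc a b) :=
    continuous_e.comp_continuousOn fun t ht => (hf t ht).continuousAt.continuousWithinAt
  have hu : Set.uIcc a b = Set.Icc a b := Set.uIcc_of_le hab
  have h := intervalIntegral.integral_mul_deriv_eq_deriv_mul (a := a) (b := b)
    (u := fun t => (Q t : ℂ)) (u' := fun t => (Q' t : ℂ)) (v := fun t => e (f t))
    (v' := fun t => 2 * π * Complex.I * f' t * e (f t))
    (fun t ht => (hQ t (hu ▸ ht)).ofReal_comp) (fun t ht => hasDerivAt_e_comp (hf t (hu ▸ ht)))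
    (ContinuousOn.intervalIntegrable (hu ▸ Complex.continuous_ofReal.comp_continuousOn hQ'))
    (ContinuousOn.intervalIntegrable (hu ▸ (ContinuousOn.mul (continuousOn_const.mul
      (Complex.continuous_ofReal.comp_continuousOn hf')) hcf)))
  have hI : (2 * π * Complex.I : ℂ) ≠ 0 := Complex.two_pi_I_ne_zero
  have e1 : ∫ t in a..b, (Q t : ℂ) * (2 * π * Complex.I * f' t * e (f t)) =
      2 * π * Complex.I * ∫ t in a..b, e (f t) * ((f' t * Q t : ℝ) : ℂ) := by
    rw [← intervalIntegral.integral_const_mul]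
    refine intervalIntegral.integral_congr fun t _ => ?_
    push_cast; ring
  have e2 : ∫ t in a..b, (Q' t : ℂ) * e (f t) = ∫ t in a..b, e (f t) * (Q' t : ℂ) :=
    intervalIntegral.integral_congr fun t _ => mul_comm _ _
  rw [e1, e2] at h
  rw [one_div, eq_inv_mul_iff_mul_eq₀ hI, h]
  ring

/-- The first derivative test, for an amplitude `Q` bounded by `M` whose derivative has at most
one change of sign. -/
theorem norm_integral_e_mul_deriv_mul_le {f f' Q Q' : ℝ → ℝ} {a b M : ℝ} (hab : a ≤ b)
    (hf : ∀ t ∈ Set.Icc a b, HasDerivAt f (f' t) t) (hf' : ContinuousOn f' (Set.Icc a b))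
    (hQ : ∀ t ∈ Set.Icc a b, HasDerivAt Q (Q' t) t) (hQ' : ContinuousOn Q' (Set.Icc a b))
    (hs : OneSignChange Q' a b) (hM : ∀ t ∈ Set.Icc a b, |Q t| ≤ M) :
    ‖∫ t in a..b, e (f t) * ((f' t * Q t : ℝ) : ℂ)‖ ≤ M := by
  rw [integral_e_mul_deriv_mul hab hf hf' hQ hQ', norm_mul]
  have h4 := norm_integral_mul_deriv_le_of_oneSignChange (F := fun t => e (f t)) hab
    (continuous_e.comp_continuousOn fun t ht => (hf t ht).continuousAt.continuousWithinAt)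
    hQ hQ' (fun t => (norm_e _).le) hs hM
  have hb := hM b ⟨hab, le_rfl⟩
  have ha := hM a ⟨le_rfl, hab⟩
  have hM0 : 0 ≤ M := (abs_nonneg _).trans ha
  have hn : ∀ t, ‖e (f t) * (Q t : ℂ)‖ = |Q t| := by
    intro t; rw [norm_mul, norm_e, one_mul, Complex.norm_real, Real.norm_eq_abs]
  have h6 : ‖e (f b) * Q b - e (f a) * Q a - ∫ t in a..b, e (f t) * (Q' t : ℂ)‖ ≤ 6 * M := by
    refine (norm_sub_le _ _).trans ?_
    have := norm_sub_le (e (f b) * Q b) (e (f a) * (Q a : ℂ))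
    rw [hn, hn] at this
    linarith
  have hpi : ‖1 / (2 * π * Complex.I : ℂ)‖ = 1 / (2 * π) := by
    simp [abs_of_pos pi_pos]
  rw [hpi]
  have h3 := pi_gt_three
  calc _ ≤ 1 / (2 * π) * (6 * M) := by gcongr
    _ ≤ M := by
      rw [div_mul_eq_mul_div, div_le_iff₀ (by positivity)]
      nlinarith

/-! ### The Fresnel integral -/

/-- A bound of the tail of the complex Gaussian integral that persists on the line `re b = 0`. -/
theorem norm_integral_gaussian_tail_le {b : ℂ} (hb : 0 ≤ b.re) (hb0 : b ≠ 0) {X Y : ℝ} (hX : 0 < X)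
    (hXY : X ≤ Y) : ‖∫ x in X..Y, Complex.exp (-b * (x : ℂ) ^ 2)‖ ≤ 1 / (‖b‖ * X) := by
  have hY : 0 < Y := hX.trans_le hXY
  have hu : Set.uIcc X Y = Set.Icc X Y := Set.uIcc_of_le hXY
  have hpos : ∀ x ∈ Set.uIcc X Y, 0 < x := fun x hx => hX.trans_le (hu ▸ hx).1
  have hd : ∀ x : ℝ, HasDerivAt (fun x : ℝ => Complex.exp (-b * (x : ℂ) ^ 2))
      (Complex.exp (-b * (x : ℂ) ^ 2) * (-b * (2 * x))) x := by
    intro x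
    have h := (((hasDerivAt_id x).ofReal_comp.pow 2).const_mul (-b)).cexp
    refine h.congr_deriv ?_
    simp
  have hi : ∀ x ∈ Set.uIcc X Y, HasDerivAt (fun x : ℝ => ((x⁻¹ : ℝ) : ℂ)) ((-(x ^ 2)⁻¹ : ℝ) : ℂ) x :=
    fun x hx => (hasDerivAt_inv (hpos x hx).ne').ofReal_comp
  have hci : ContinuousOn (fun x : ℝ => -(x ^ 2)⁻¹) (Set.uIcc X Y) :=
    (ContinuousOn.inv₀ (by fun_prop) fun x hx => (pow_pos (hpos x hx) 2).ne').neg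
  have hparts := intervalIntegral.integral_mul_deriv_eq_deriv_mul hi (fun x _ => hd x)
    (ContinuousOn.intervalIntegrable (Complex.continuous_ofReal.comp_continuousOn hci))
    (Continuous.intervalIntegrable (by fun_prop) _ _)
  have e1 : ∫ x in X..Y, ((x⁻¹ : ℝ) : ℂ) * (Complex.exp (-b * (x : ℂ) ^ 2) * (-b * (2 * x))) =
      (-2 * b) * ∫ x in X..Y, Complex.exp (-b * (x : ℂ) ^ 2) := by
    rw [← intervalIntegral.integral_const_mul]
    refine intervalIntegral.integral_congr fun x hx => ?_
    have : (x : ℂ) ≠ 0 := by exact_mod_cast (hpos x hx).ne'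
    simp only [Complex.ofReal_inv]
    field_simp
  rw [e1] at hparts
  have hE : ∀ x : ℝ, ‖Complex.exp (-b * (x : ℂ) ^ 2)‖ ≤ 1 := by
    intro x
    rw [Complex.norm_exp, Real.exp_le_one_iff, ← Complex.ofReal_pow, mul_comm,
      Complex.re_ofReal_mul, Complex.neg_re]
    nlinarith [sq_nonneg x]
  have hint : ‖∫ x in X..Y, ((-(x ^ 2)⁻¹ : ℝ) : ℂ) * Complex.exp (-b * (x : ℂ) ^ 2)‖ ≤
      X⁻¹ - Y⁻¹ := by
    have hii : IntervalIntegrable (fun x : ℝ => (x ^ 2)⁻¹) MeasureTheory.volume X Y := by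
      refine ContinuousOn.intervalIntegrable (ContinuousOn.inv₀ (by fun_prop) fun x hx => ?_)
      exact (pow_pos (hpos x hx) 2).ne'
    have h1 : ∫ x in X..Y, (x ^ 2)⁻¹ = X⁻¹ - Y⁻¹ := by
      rw [intervalIntegral.integral_eq_sub_of_hasDerivAt (f := fun x => -x⁻¹)
        (fun x hx => by simpa using (hasDerivAt_inv (hpos x hx).ne').fun_neg) hii]
      ring
    rw [← h1]
    refine intervalIntegral.norm_integral_le_of_norm_le hXY ?_ hii
    refine Filter.Eventually.of_forall fun x hx => ?_
    rw [norm_mul, Complex.norm_real, norm_neg, Real.norm_eq_abs, abs_of_nonneg (by positivity)]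
    exact mul_le_of_le_one_right (by positivity) (hE x)
  have hn : ‖(-2 * b) * ∫ x in X..Y, Complex.exp (-b * (x : ℂ) ^ 2)‖ ≤ 2 * X⁻¹ := by
    rw [hparts]
    refine (norm_sub_le _ _).trans ?_
    have h2 := norm_sub_le (((Y⁻¹ : ℝ) : ℂ) * Complex.exp (-b * (Y : ℂ) ^ 2))
      (((X⁻¹ : ℝ) : ℂ) * Complex.exp (-b * (X : ℂ) ^ 2))
    have h3 : ∀ x : ℝ, 0 < x → ‖((x⁻¹ : ℝ) : ℂ) * Complex.exp (-b * (x : ℂ) ^ 2)‖ ≤ x⁻¹ := by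
      intro x hx
      rw [norm_mul, Complex.norm_real, Real.norm_eq_abs, abs_of_nonneg (by positivity)]
      exact mul_le_of_le_one_right (by positivity) (hE x)
    linarith [h3 X hX, h3 Y hY]
  rw [norm_mul, norm_mul] at hn
  have hb' : 0 < ‖b‖ := norm_pos_iff.mpr hb0
  simp only [norm_neg, Complex.norm_ofNat] at hn
  rw [le_div_iff₀ (by positivity)]
  have : X * X⁻¹ = 1 := mul_inv_cancel₀ hX.ne'
  nlinarith

theorem pi_div_neg_two_pi_I :
    (π : ℂ) / (-(2 * π * Complex.I)) = ((1 / 2 : ℝ) : ℂ) * Complex.I := by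
  have hπ : (π : ℂ) ≠ 0 := by exact_mod_cast pi_ne_zero
  field_simp
  push_cast
  linear_combination (-1 : ℂ) * Complex.I_sq

theorem fresnel_constant :
    ((π : ℂ) / (-(2 * π * Complex.I))) ^ (1 / 2 : ℂ) = e (1 / 8) / (Real.sqrt 2 : ℝ) := by
  have h2 : ((1 / 2 : ℝ) : ℂ) * Complex.I ≠ 0 := by simp
  rw [pi_div_neg_two_pi_I, Complex.cpow_def_of_ne_zero h2, Complex.log_ofReal_mul (by norm_num) Complex.I_ne_zero,
    Complex.log_I, add_mul, Complex.exp_add]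
  have h3 : Complex.exp (((Real.log (1 / 2) : ℝ) : ℂ) * (1 / 2)) = ((1 / Real.sqrt 2 : ℝ) : ℂ) := by
    have : ((Real.log (1 / 2) : ℝ) : ℂ) * (1 / 2) = ((Real.log (1 / 2) / 2 : ℝ) : ℂ) := by
      push_cast; ring
    rw [this, ← Complex.ofReal_exp]
    congr 1
    rw [← Real.log_sqrt (by norm_num), Real.exp_log (by positivity), Real.sqrt_div (by norm_num),
      Real.sqrt_one]
  have h4 : Complex.exp ((π : ℂ) / 2 * Complex.I * (1 / 2)) = e (1 / 8) := by
    unfold e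
    congr 1
    push_cast
    ring
  rw [h3, h4]
  push_cast
  ring

/-- The incomplete Fresnel integral. The complex Gaussian integral with exponent
`-(ε - 2πi) x ^ 2` is used for `ε > 0`, with a bound of its tail that is uniform in `ε`. -/
theorem norm_fresnel_sub_le {X : ℝ} (hX : 0 < X) :
    ‖(∫ x in (0 : ℝ)..X, e (x ^ 2)) - e (1 / 8) / (2 * (Real.sqrt 2 : ℝ))‖ ≤ 1 / X := by
  set b : ℝ → ℂ := fun ε => (ε : ℂ) - 2 * π * Complex.I with hb
  have hbc : Continuous b := by rw [hb]; fun_prop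
  have hre : ∀ ε, (b ε).re = ε := by intro ε; simp [hb]
  have him : ∀ ε, (b ε).im = -(2 * π) := by intro ε; simp [hb]
  have hb0 : ∀ ε, b ε ≠ 0 := by
    intro ε h
    have := him ε
    rw [h] at this
    simp at this
  have hnorm : ∀ ε, 1 ≤ ‖b ε‖ := by
    intro ε
    have := Complex.abs_im_le_norm (b ε)
    rw [him, abs_neg, abs_of_pos (by positivity)] at this
    linarith [pi_gt_three]
  have hpos : ∀ ε : ℝ, 0 < ε → ‖(∫ x in (0 : ℝ)..X, Complex.exp (-b ε * (x : ℂ) ^ 2)) -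
      (π / b ε) ^ (1 / 2 : ℂ) / 2‖ ≤ 1 / X := by
    intro ε hε
    have hε' : 0 < (b ε).re := by rw [hre]; exact hε
    have hint : MeasureTheory.IntegrableOn (fun x : ℝ => Complex.exp (-b ε * (x : ℂ) ^ 2))
        (Set.Ioi 0) := (integrable_cexp_neg_mul_sq hε').integrableOn
    have ht := MeasureTheory.intervalIntegral_tendsto_integral_Ioi 0 hint Filter.tendsto_id
    rw [integral_gaussian_complex_Ioi hε'] at ht
    have ht2 := (ht.const_sub (∫ x in (0 : ℝ)..X, Complex.exp (-b ε * (x : ℂ) ^ 2))).norm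
    refine le_of_tendsto ht2 ?_
    filter_upwards [Filter.eventually_ge_atTop X] with Y hY
    have hi : ∀ c d : ℝ, IntervalIntegrable (fun x : ℝ => Complex.exp (-b ε * (x : ℂ) ^ 2))
      MeasureTheory.volume c d := fun c d => Continuous.intervalIntegrable (by fun_prop) _ _
    rw [id, ← intervalIntegral.integral_add_adjacent_intervals (hi 0 X) (hi X Y), sub_add_cancel_left,
      norm_neg]
    refine (norm_integral_gaussian_tail_le hε'.le (hb0 ε) hX hY).trans ?_
    gcongr
    exact le_mul_of_one_le_left hX.le (hnorm ε)
  have hcont : Continuous fun ε : ℝ => ∫ x in (0 : ℝ)..X, Complex.exp (-b ε * (x : ℂ) ^ 2) := by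
    apply intervalIntegral.continuous_parametric_intervalIntegral_of_continuous'
    fun_prop
  have hb00 : b 0 = -(2 * π * Complex.I) := by simp [hb]
  have hpow : ContinuousAt (fun ε : ℝ => ((π : ℂ) / b ε) ^ (1 / 2 : ℂ)) 0 := by
    refine ContinuousAt.cpow (continuousAt_const.div hbc.continuousAt (hb0 0))
      continuousAt_const (Or.inr ?_)
    rw [hb00]
    rw [pi_div_neg_two_pi_I]
    simp
  have hlim : Filter.Tendsto (fun ε : ℝ => ‖(∫ x in (0 : ℝ)..X, Complex.exp (-b ε * (x : ℂ) ^ 2)) -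
      (π / b ε) ^ (1 / 2 : ℂ) / 2‖) (nhdsWithin 0 (Set.Ioi 0))
      (nhds ‖(∫ x in (0 : ℝ)..X, Complex.exp (-b 0 * (x : ℂ) ^ 2)) -
      (π / b 0) ^ (1 / 2 : ℂ) / 2‖) :=
    ((hcont.continuousAt.sub (hpow.div_const 2)).norm).tendsto.mono_left nhdsWithin_le_nhds
  have hle := le_of_tendsto hlim (by
    filter_upwards [self_mem_nhdsWithin] with ε hε
    exact hpos ε hε)
  rw [hb00, fresnel_constant] at hle
  convert! hle using 3
  · refine intervalIntegral.integral_congr fun x _ => ?_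
    simp only [e]
    congr 1
    push_cast
    ring
  · rw [div_div, mul_comm]

/-! ### One-sided stationary phase -/

theorem nonneg_of_hasDerivAt_nonneg {f f' : ℝ → ℝ} {T : ℝ}
    (hd : ∀ t ∈ Set.Icc 0 T, HasDerivAt f (f' t) t) (h0 : f 0 = 0)
    (hf : ∀ t ∈ Set.Icc 0 T, 0 ≤ f' t) : ∀ t ∈ Set.Icc 0 T, 0 ≤ f t := by
  have hmono : MonotoneOn f (Set.Icc 0 T) := by
    refine monotoneOn_of_hasDerivWithinAt_nonneg (f' := f') (convex_Icc _ _)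
      (fun t ht => (hd t ht).continuousAt.continuousWithinAt) (fun t ht => ?_) (fun t ht => ?_)
    · exact (hd t (interior_subset ht)).hasDerivWithinAt
    · exact hf t (interior_subset ht)
  intro t ht
  have := hmono ⟨le_rfl, ht.1.trans ht.2⟩ ht ht.1
  rwa [h0] at this

/-- A phase `φ` on `[0, T]` with `φ = φ' = 0` at `0`, where `u = φ'`, `v = φ''`, `v₁ = φ'''` and
`v₂ = φ''''`; `m` is a lower bound of `φ''` and `V` an upper bound of `|φ'''|`. The last field
says that the second derivative of `(φ'')^(-2/3)`, the equiaffine curvature of the graph up to a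
constant factor, has at most one change of sign. -/
structure HalfPhase (φ u v v₁ v₂ : ℝ → ℝ) (T m V : ℝ) : Prop where
  m_pos : 0 < m
  T_pos : 0 < T
  phase_zero : φ 0 = 0
  deriv_zero : u 0 = 0
  hasDeriv_phase : ∀ t ∈ Set.Icc 0 T, HasDerivAt φ (u t) t
  hasDeriv_u : ∀ t ∈ Set.Icc 0 T, HasDerivAt u (v t) t
  hasDeriv_v : ∀ t ∈ Set.Icc 0 T, HasDerivAt v (v₁ t) t
  hasDeriv_v₁ : ∀ t ∈ Set.Icc 0 T, HasDerivAt v₁ (v₂ t) t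
  m_le : ∀ t ∈ Set.Icc 0 T, m ≤ v t
  abs_le_V : ∀ t ∈ Set.Icc 0 T, |v₁ t| ≤ V
  sign : OneSignChange (fun t => 5 * v₁ t ^ 2 - 3 * v t * v₂ t) 0 T

namespace HalfPhase

variable {φ u v v₁ v₂ : ℝ → ℝ} {T m V : ℝ}

theorem mul_le_u (h : HalfPhase φ u v v₁ v₂ T m V) {t : ℝ} (ht : t ∈ Set.Icc 0 T) :
    m * t ≤ u t := by
  have := nonneg_of_hasDerivAt_nonneg (f := fun t => u t - m * t) (f' := fun t => v t - m * 1)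
    (fun t ht => (h.hasDeriv_u t ht).sub ((hasDerivAt_id t).const_mul m))
    (by simp [h.deriv_zero]) (fun t ht => by linarith [h.m_le t ht]) t ht
  linarith

theorem sq_le_phase (h : HalfPhase φ u v v₁ v₂ T m V) {t : ℝ} (ht : t ∈ Set.Icc 0 T) :
    m * t ^ 2 / 2 ≤ φ t := by
  have hd : ∀ t ∈ Set.Icc 0 T, HasDerivAt (fun t => φ t - m / 2 * t ^ 2) (u t - m * t) t := by
    intro t ht
    refine ((h.hasDeriv_phase t ht).sub ((hasDerivAt_pow 2 t).const_mul (m / 2))).congr_deriv ?_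
    push_cast; ring
  have := nonneg_of_hasDerivAt_nonneg hd (by simp [h.phase_zero])
    (fun t ht => by linarith [h.mul_le_u ht]) t ht
  linarith

theorem u_nonneg (h : HalfPhase φ u v v₁ v₂ T m V) {t : ℝ} (ht : t ∈ Set.Icc 0 T) : 0 ≤ u t :=
  (mul_nonneg h.m_pos.le ht.1).trans (h.mul_le_u ht)

theorem u_pos (h : HalfPhase φ u v v₁ v₂ T m V) {t : ℝ} (ht : t ∈ Set.Ioc 0 T) : 0 < u t :=
  (mul_pos h.m_pos ht.1).trans_le (h.mul_le_u ⟨ht.1.le, ht.2⟩)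

theorem phase_nonneg (h : HalfPhase φ u v v₁ v₂ T m V) {t : ℝ} (ht : t ∈ Set.Icc 0 T) :
    0 ≤ φ t := by
  have := h.sq_le_phase ht
  have := h.m_pos
  exact le_trans (by positivity) (h.sq_le_phase ht)

theorem phase_pos (h : HalfPhase φ u v v₁ v₂ T m V) {t : ℝ} (ht : t ∈ Set.Ioc 0 T) : 0 < φ t := by
  have h1 := h.m_pos
  have h2 := ht.1
  exact lt_of_lt_of_le (by positivity) (h.sq_le_phase ⟨ht.1.le, ht.2⟩)

theorem v_pos (h : HalfPhase φ u v v₁ v₂ T m V) {t : ℝ} (ht : t ∈ Set.Icc 0 T) : 0 < v t :=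
  h.m_pos.trans_le (h.m_le t ht)

theorem zero_mem (h : HalfPhase φ u v v₁ v₂ T m V) : (0 : ℝ) ∈ Set.Icc 0 T := ⟨le_rfl, h.T_pos.le⟩

theorem V_nonneg (h : HalfPhase φ u v v₁ v₂ T m V) : 0 ≤ V :=
  (abs_nonneg _).trans (h.abs_le_V 0 h.zero_mem)

theorem abs_v_sub_le (h : HalfPhase φ u v v₁ v₂ T m V) {t : ℝ} (ht : t ∈ Set.Icc 0 T) :
    |v t - v 0| ≤ V * t := by
  have h1 := nonneg_of_hasDerivAt_nonneg (f := fun t => V * t - (v t - v 0))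
    (f' := fun t => V * 1 - v₁ t)
    (fun t ht => ((hasDerivAt_id t).const_mul V).sub ((h.hasDeriv_v t ht).sub_const (v 0)))
    (by simp) (fun t ht => by linarith [(abs_le.mp (h.abs_le_V t ht)).2]) t ht
  have h2 := nonneg_of_hasDerivAt_nonneg (f := fun t => V * t + (v t - v 0))
    (f' := fun t => V * 1 + v₁ t)
    (fun t ht => ((hasDerivAt_id t).const_mul V).add ((h.hasDeriv_v t ht).sub_const (v 0)))
    (by simp) (fun t ht => by linarith [(abs_le.mp (h.abs_le_V t ht)).1]) t ht
  exact abs_le.mpr ⟨by linarith, by linarith⟩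

/-- To first order the phase is quadratic: `φ ≈ u ^ 2 / (2 φ''(0))`. -/
theorem abs_phase_sub_sq_le (h : HalfPhase φ u v v₁ v₂ T m V) {t : ℝ} (ht : t ∈ Set.Icc 0 T) :
    |2 * v 0 * φ t - u t ^ 2| ≤ 2 * V * t * φ t := by
  have hd : ∀ t ∈ Set.Icc 0 T, HasDerivAt (fun t => 2 * v 0 * φ t - u t ^ 2)
      (-(2 * u t * (v t - v 0))) t := by
    intro t ht
    refine (((h.hasDeriv_phase t ht).const_mul (2 * v 0)).sub
      ((h.hasDeriv_u t ht).pow 2)).congr_deriv ?_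
    push_cast; ring
  have hV : ∀ t ∈ Set.Icc 0 T, HasDerivAt (fun t => 2 * V * (t * φ t))
      (2 * V * (1 * φ t + t * u t)) t := fun t ht =>
    ((hasDerivAt_id t).mul (h.hasDeriv_phase t ht)).const_mul (2 * V)
  have hb : ∀ t ∈ Set.Icc 0 T, |2 * u t * (v t - v 0)| ≤ 2 * V * (1 * φ t + t * u t) := by
    intro t ht
    rw [abs_mul, abs_of_nonneg (by linarith [h.u_nonneg ht] : 0 ≤ 2 * u t)]
    have h1 := mul_le_mul_of_nonneg_left (h.abs_v_sub_le ht) (h.u_nonneg ht)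
    have h2 := mul_nonneg h.V_nonneg (h.phase_nonneg ht)
    linarith
  have h1 := nonneg_of_hasDerivAt_nonneg (fun t ht => (hV t ht).sub (hd t ht))
    (by simp [h.phase_zero, h.deriv_zero])
    (fun t ht => by linarith [(abs_le.mp (hb t ht)).1]) t ht
  have h2 := nonneg_of_hasDerivAt_nonneg (fun t ht => (hV t ht).add (hd t ht))
    (by simp [h.phase_zero, h.deriv_zero])
    (fun t ht => by linarith [(abs_le.mp (hb t ht)).2]) t ht
  simp only [Pi.sub_apply, Pi.add_apply] at h1 h2
  exact abs_le.mpr ⟨by linarith, by linarith⟩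

/-- The amplitude that is left when the integral of `e(φ)` is compared with that of the quadratic
phase `x ^ 2`, `x = √φ`. -/
def amp (φ u : ℝ → ℝ) (p t : ℝ) : ℝ := 1 / u t - √(2 / p) / (2 * √(φ t))

theorem abs_amp_le (h : HalfPhase φ u v v₁ v₂ T m V) {t : ℝ} (ht : t ∈ Set.Ioc 0 T) :
    |amp φ u (v 0) t| ≤ V / m ^ 2 := by
  have ht' : t ∈ Set.Icc 0 T := ⟨ht.1.le, ht.2⟩
  have hu := h.u_pos ht
  have hφ := h.phase_pos ht
  have hp := h.v_pos h.zero_mem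
  have hm := h.m_pos
  have hV := h.V_nonneg
  have ht0 := ht.1
  set s := √(φ t) with hs
  set w := √(2 / v 0) with hw
  have hs2 : s ^ 2 = φ t := sq_sqrt hφ.le
  have hw2 : v 0 * w ^ 2 = 2 := by
    rw [hw, sq_sqrt (by positivity)]
    field_simp
  have hs0 : 0 < s := sqrt_pos.mpr hφ
  have hw0 : 0 < w := sqrt_pos.mpr (by positivity)
  have hden : 0 < v 0 * (u t * s * (2 * s + w * u t)) := by positivity
  have e1 : amp φ u (v 0) t = (2 * v 0 * φ t - u t ^ 2) / (v 0 * (u t * s * (2 * s + w * u t))) := by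
    rw [eq_div_iff hden.ne']
    simp only [amp, ← hs, ← hw]
    field_simp
    linear_combination (-u t ^ 2) * hw2 + 4 * v 0 * hs2
  rw [e1, abs_div, abs_of_pos hden, div_le_div_iff₀ hden (by positivity)]
  have h1 := h.abs_phase_sub_sq_le ht'
  have h2 : m * (m * t) ≤ v 0 * u t :=
    mul_le_mul (h.m_le 0 h.zero_mem) (h.mul_le_u ht') (by positivity) hp.le
  have h3 : 0 ≤ v 0 * (u t * s * (w * u t)) := by positivity
  calc |2 * v 0 * φ t - u t ^ 2| * m ^ 2 ≤ 2 * V * t * φ t * m ^ 2 := by gcongr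
    _ = V * (2 * φ t * (m * (m * t))) := by ring
    _ ≤ V * (2 * φ t * (v 0 * u t)) := by gcongr
    _ ≤ V * (v 0 * (u t * s * (2 * s + w * u t))) := by
      refine mul_le_mul_of_nonneg_left ?_ hV
      rw [← hs2]
      linarith

theorem hasDerivAt_amp (h : HalfPhase φ u v v₁ v₂ T m V) {t : ℝ} (ht : t ∈ Set.Ioc 0 T) :
    HasDerivAt (amp φ u (v 0)) (-v t / u t ^ 2 + √(2 / v 0) * u t / (4 * √(φ t) ^ 3)) t := by
  have ht' : t ∈ Set.Icc 0 T := ⟨ht.1.le, ht.2⟩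
  have hu := h.u_pos ht
  have hφ := h.phase_pos ht
  have hs0 : 0 < √(φ t) := sqrt_pos.mpr hφ
  have h1 := (hasDerivAt_const t (1 : ℝ)).div (h.hasDeriv_u t ht') hu.ne'
  have h2 := (hasDerivAt_const t (√(2 / v 0))).div
    (((h.hasDeriv_phase t ht').sqrt hφ.ne').const_mul 2) (by positivity)
  refine (h1.sub h2).congr_deriv ?_
  field_simp
  ring

/-- The sign of the derivative of the amplitude is that of this function, whose successive
derivatives lead back to `5 v₁ ^ 2 - 3 v v₂`. -/
theorem oneSignChange_aux (h : HalfPhase φ u v v₁ v₂ T m V) :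
    OneSignChange (fun t => u t ^ 2 * v t ^ (-(2 / 3) : ℝ) - 2 * v 0 ^ (1 / 3 : ℝ) * φ t) 0 T := by
  have hY : ∀ t ∈ Set.Icc 0 T, HasDerivAt
      (fun t => 2 * v t ^ (1 / 3 : ℝ) - 2 / 3 * (u t * v t ^ (-(5 / 3) : ℝ) * v₁ t) -
        2 * v 0 ^ (1 / 3 : ℝ))
      (2 / 9 * u t * v t ^ (-(8 / 3) : ℝ) * (5 * v₁ t ^ 2 - 3 * v t * v₂ t)) t := by
    intro t ht
    have hv := h.v_pos ht
    have d1 := (h.hasDeriv_v t ht).rpow_const (p := 1 / 3) (Or.inl hv.ne')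
    have d2 := (h.hasDeriv_v t ht).rpow_const (p := -(5 / 3)) (Or.inl hv.ne')
    refine (((d1.const_mul 2).sub ((((h.hasDeriv_u t ht).mul d2).mul
      (h.hasDeriv_v₁ t ht)).const_mul (2 / 3))).sub_const _).congr_deriv ?_
    have e1 : v t ^ (-(5 / 3) : ℝ) = v t ^ (-(8 / 3) : ℝ) * v t := by
      rw [← rpow_add_one hv.ne']; norm_num
    have e2 : v t ^ (1 / 3 - 1 : ℝ) = v t ^ (-(8 / 3) : ℝ) * v t ^ 2 := by
      rw [← rpow_natCast, ← rpow_add hv]; norm_num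
    have e3 : v t ^ (-(5 / 3) - 1 : ℝ) = v t ^ (-(8 / 3) : ℝ) := by norm_num
    simp only [Pi.mul_apply]
    rw [e2, e3, e1]
    ring
  have hZ : ∀ t ∈ Set.Icc 0 T, HasDerivAt
      (fun t => u t ^ 2 * v t ^ (-(2 / 3) : ℝ) - 2 * v 0 ^ (1 / 3 : ℝ) * φ t)
      (u t * (2 * v t ^ (1 / 3 : ℝ) - 2 / 3 * (u t * v t ^ (-(5 / 3) : ℝ) * v₁ t) -
        2 * v 0 ^ (1 / 3 : ℝ))) t := by
    intro t ht
    have hv := h.v_pos ht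
    have d1 := (h.hasDeriv_v t ht).rpow_const (p := -(2 / 3)) (Or.inl hv.ne')
    refine ((((h.hasDeriv_u t ht).pow 2).mul d1).sub
      ((h.hasDeriv_phase t ht).const_mul _)).congr_deriv ?_
    have e1 : v t ^ (1 / 3 : ℝ) = v t ^ (-(2 / 3) : ℝ) * v t := by
      rw [← rpow_add_one hv.ne']; norm_num
    have e2 : v t ^ (-(2 / 3) - 1 : ℝ) = v t ^ (-(5 / 3) : ℝ) := by norm_num
    simp only [Pi.pow_apply]
    rw [e2, e1]
    push_cast
    ring
  refine OneSignChange.of_deriv hZ (by simp [h.phase_zero, h.deriv_zero]) ?_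
  refine OneSignChange.transfer (OneSignChange.of_deriv hY (by simp [h.deriv_zero])
    (h.sign.transfer ?_ ?_)) ?_ ?_
  · intro t ht hs
    have hu := h.u_nonneg ⟨ht.1.le, ht.2.le⟩
    have hv := rpow_nonneg (h.v_pos ⟨ht.1.le, ht.2.le⟩).le (-(8 / 3))
    exact mul_nonneg (by positivity) hs
  · intro t ht hs
    have hu := h.u_nonneg ⟨ht.1.le, ht.2.le⟩
    have hv := rpow_nonneg (h.v_pos ⟨ht.1.le, ht.2.le⟩).le (-(8 / 3))
    exact mul_nonpos_of_nonneg_of_nonpos (by positivity) hs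
  · intro t ht hs
    exact mul_nonneg (h.u_nonneg ⟨ht.1.le, ht.2.le⟩) hs
  · intro t ht hs
    exact mul_nonpos_of_nonneg_of_nonpos (h.u_nonneg ⟨ht.1.le, ht.2.le⟩) hs

theorem oneSignChange_deriv_amp (h : HalfPhase φ u v v₁ v₂ T m V) :
    OneSignChange (fun t => -v t / u t ^ 2 + √(2 / v 0) * u t / (4 * √(φ t) ^ 3)) 0 T := by
  have hp := h.v_pos h.zero_mem
  have key : ∀ t ∈ Set.Ioo 0 T, ∃ a b c : ℝ, 0 < c ∧ 0 ≤ a ∧ 0 ≤ b ∧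
      u t ^ 2 * v t ^ (-(2 / 3) : ℝ) = a ∧ 2 * v 0 ^ (1 / 3 : ℝ) * φ t = b ∧
      ∃ x y : ℝ, 0 ≤ x ∧ 0 ≤ y ∧ x ^ 2 = a ^ 3 ∧ y ^ 2 = b ^ 3 ∧
      -v t / u t ^ 2 + √(2 / v 0) * u t / (4 * √(φ t) ^ 3) = c * (x - y) := by
    intro t ht
    have ht' : t ∈ Set.Ioc 0 T := ⟨ht.1, ht.2.le⟩
    have hu := h.u_pos ht'
    have hφ := h.phase_pos ht'
    have hv := h.v_pos ⟨ht.1.le, ht.2.le⟩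
    have hs0 : 0 < √(φ t) := sqrt_pos.mpr hφ
    have hs2 : √(φ t) ^ 2 = φ t := sq_sqrt hφ.le
    have hw0 : 0 < √(2 / v 0) := sqrt_pos.mpr (by positivity)
    have hw2 : √(2 / v 0) ^ 2 = 2 / v 0 := sq_sqrt (by positivity)
    refine ⟨_, _, √(2 / v 0) * v t / (4 * √(φ t) ^ 3 * u t ^ 2), by positivity, by positivity,
      by positivity, rfl, rfl, u t ^ 3 / v t, 2 * v 0 * √(2 / v 0) * √(φ t) ^ 3, by positivity,
      by positivity, ?_, ?_, ?_⟩
    · have e1 : (v t ^ (-(2 / 3) : ℝ)) ^ 3 = (v t ^ 2)⁻¹ := by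
        rw [← rpow_natCast (v t ^ (-(2 / 3) : ℝ)), ← rpow_mul hv.le]
        norm_num
      rw [mul_pow, e1, div_pow]
      ring
    · have e1 : (v 0 ^ (1 / 3 : ℝ)) ^ 3 = v 0 := by
        rw [← rpow_natCast (v 0 ^ (1 / 3 : ℝ)), ← rpow_mul hp.le]
        norm_num
      rw [mul_pow, mul_pow, mul_pow, mul_pow, mul_pow, e1, hw2, ← pow_mul, mul_comm 3 2, pow_mul, hs2]
      field_simp
    · have hw3 : v 0 * √(2 / v 0) ^ 2 = 2 := by rw [hw2]; field_simp
      field_simp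
      linear_combination (2 * v t * √(φ t) ^ 3) * hw3
  refine h.oneSignChange_aux.transfer ?_ ?_
  · intro t ht hz
    obtain ⟨a, b, c, hc, ha, hb, rfl, rfl, x, y, hx, hy, hxa, hyb, he⟩ := key t ht
    rw [he]
    have hab := pow_le_pow_left₀ hb (sub_nonneg.mp hz) 3
    rw [← hxa, ← hyb] at hab
    have := (pow_le_pow_iff_left₀ hy hx two_ne_zero).mp hab
    exact mul_nonneg hc.le (by linarith)
  · intro t ht hz
    obtain ⟨a, b, c, hc, ha, hb, rfl, rfl, x, y, hx, hy, hxa, hyb, he⟩ := key t ht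
    rw [he]
    have hab := pow_le_pow_left₀ ha (sub_nonpos.mp hz) 3
    rw [← hxa, ← hyb] at hab
    have := (pow_le_pow_iff_left₀ hx hy two_ne_zero).mp hab
    exact mul_nonpos_of_nonneg_of_nonpos hc.le (by linarith)

theorem norm_integral_sub_quadratic_le (h : HalfPhase φ u v v₁ v₂ T m V) {δ : ℝ}
    (hδ : δ ∈ Set.Ioc 0 T) :
    ‖(∫ t in δ..T, e (φ t)) - (√(2 / v 0) : ℝ) * ∫ x in √(φ δ)..√(φ T), e (x ^ 2)‖ ≤
      V / m ^ 2 := by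
  have hsub : ∀ t ∈ Set.Icc δ T, t ∈ Set.Ioc 0 T := fun t ht => ⟨hδ.1.trans_le ht.1, ht.2⟩
  have hsub' : ∀ t ∈ Set.Icc δ T, t ∈ Set.Icc 0 T := fun t ht => ⟨hδ.1.le.trans ht.1, ht.2⟩
  have hu : Set.uIcc δ T = Set.Icc δ T := Set.uIcc_of_le hδ.2
  have cφ : ContinuousOn φ (Set.Icc δ T) := fun t ht =>
    (h.hasDeriv_phase t (hsub' t ht)).continuousAt.continuousWithinAt
  have cu : ContinuousOn u (Set.Icc δ T) := fun t ht =>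
    (h.hasDeriv_u t (hsub' t ht)).continuousAt.continuousWithinAt
  have cv : ContinuousOn v (Set.Icc δ T) := fun t ht =>
    (h.hasDeriv_v t (hsub' t ht)).continuousAt.continuousWithinAt
  have cs : ContinuousOn (fun t => √(φ t)) (Set.Icc δ T) := continuous_sqrt.comp_continuousOn cφ
  have hs0 : ∀ t ∈ Set.Icc δ T, 0 < √(φ t) := fun t ht => sqrt_pos.mpr (h.phase_pos (hsub t ht))
  have hu0 : ∀ t ∈ Set.Icc δ T, 0 < u t := fun t ht => h.u_pos (hsub t ht)
  have hmain := norm_integral_e_mul_deriv_mul_le (f := φ) (f' := u) (Q := amp φ u (v 0)) hδ.2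
    (fun t ht => h.hasDeriv_phase t (hsub' t ht)) cu (fun t ht => h.hasDerivAt_amp (hsub t ht))
    ((cv.neg.div (cu.pow 2) (fun t ht => (pow_pos (hu0 t ht) 2).ne')).add
      ((continuousOn_const.mul cu).div (continuousOn_const.mul (cs.pow 3))
        (fun t ht => by have := hs0 t ht; positivity)))
    (h.oneSignChange_deriv_amp.mono hδ.1.le le_rfl hδ.2) (fun t ht => h.abs_amp_le (hsub t ht))
  have hsubst : ∫ t in δ..T, e (√(φ t) ^ 2) * ((u t / (2 * √(φ t)) : ℝ) : ℂ) =
      ∫ x in √(φ δ)..√(φ T), e (x ^ 2) := by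
    have := intervalIntegral.integral_deriv_smul_comp (f := fun t => √(φ t))
      (f' := fun t => u t / (2 * √(φ t))) (g := fun x => e (x ^ 2)) (a := δ) (b := T)
      (fun t ht => (h.hasDeriv_phase t (hsub' t (hu ▸ ht))).sqrt (h.phase_pos (hsub t (hu ▸ ht))).ne')
      (hu ▸ cu.div (continuousOn_const.mul cs) (fun t ht => by have := hs0 t ht; positivity))
      (continuous_e.comp (continuous_pow 2))
    rw [← this]
    refine intervalIntegral.integral_congr fun t _ => ?_
    simp only [Function.comp, Complex.real_smul]
    ring
  have ce : ContinuousOn (fun t => e (φ t)) (Set.Icc δ T) := continuous_e.comp_continuousOn cφ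
  rw [← hsubst, ← intervalIntegral.integral_const_mul, ← intervalIntegral.integral_sub]
  · convert! hmain using 2
    refine intervalIntegral.integral_congr fun t ht => ?_
    have hs := hs0 t (hu ▸ ht)
    have hut := hu0 t (hu ▸ ht)
    have e1 : √(φ t) ^ 2 = φ t := sq_sqrt (h.phase_pos (hsub t (hu ▸ ht))).le
    have e2 : u t * amp φ u (v 0) t = 1 - √(2 / v 0) * (u t / (2 * √(φ t))) := by
      simp only [amp]
      field_simp
    simp only [e1, e2]
    push_cast
    ring
  · exact ContinuousOn.intervalIntegrable (hu ▸ ce)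
  · refine ContinuousOn.intervalIntegrable (hu ▸ continuousOn_const.mul (ContinuousOn.mul
      (continuous_e.comp_continuousOn (cs.pow 2)) (Complex.continuous_ofReal.comp_continuousOn
      (cu.div (continuousOn_const.mul cs) (fun t ht => by have := hs0 t ht; positivity)))))

/-- The contribution of one side of a stationary point is half of the classical main term. -/
theorem norm_integral_sub_main_le (h : HalfPhase φ u v v₁ v₂ T m V) :
    ‖(∫ t in (0 : ℝ)..T, e (φ t)) - e (1 / 8) * ((1 / √(v 0) : ℝ) : ℂ) / 2‖ ≤
      V / m ^ 2 + 2 / (m * T) := by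
  have hT := h.T_pos
  have hm := h.m_pos
  have hp := h.v_pos h.zero_mem
  have hu : Set.uIcc 0 T = Set.Icc 0 T := Set.uIcc_of_le hT.le
  have cφ : ContinuousOn φ (Set.Icc 0 T) := fun t ht =>
    (h.hasDeriv_phase t ht).continuousAt.continuousWithinAt
  have ce : ContinuousOn (fun t => e (φ t)) (Set.Icc 0 T) := continuous_e.comp_continuousOn cφ
  -- the stationary point itself is reached by continuity
  have hlim : ‖(∫ t in (0 : ℝ)..T, e (φ t)) -
      (√(2 / v 0) : ℝ) * ∫ x in √(φ 0)..√(φ T), e (x ^ 2)‖ ≤ V / m ^ 2 := by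
    have c1 : ContinuousOn (fun δ => ∫ t in δ..T, e (φ t)) (Set.Icc 0 T) := by
      have := intervalIntegral.continuousOn_primitive_interval_left (μ := MeasureTheory.volume)
        (f := fun t => e (φ t)) (a := 0) (b := T) (hu ▸ ce.integrableOn_Icc)
      rwa [hu] at this
    have c2 : Continuous fun y : ℝ => ∫ x in y..√(φ T), e (x ^ 2) := by
      have h1 : Continuous fun y : ℝ => ∫ x in √(φ T)..y, e (x ^ 2) :=
        intervalIntegral.continuous_primitive (fun a b =>
          (continuous_e.comp (continuous_pow 2)).intervalIntegrable _ _) _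
      have h2 : (fun y : ℝ => ∫ x in y..√(φ T), e (x ^ 2)) =
          fun y => -∫ x in √(φ T)..y, e (x ^ 2) := by
        funext y; exact intervalIntegral.integral_symm _ _
      rw [h2]; exact h1.neg
    have c3 : ContinuousOn (fun δ => ‖(∫ t in δ..T, e (φ t)) -
        (√(2 / v 0) : ℝ) * ∫ x in √(φ δ)..√(φ T), e (x ^ 2)‖) (Set.Icc 0 T) :=
      (c1.sub (continuousOn_const.mul (c2.comp_continuousOn
        (continuous_sqrt.comp_continuousOn cφ)))).norm
    have c4 := (c3 0 h.zero_mem).mono (Set.Ioc_subset_Icc_self (a := (0 : ℝ)) (b := T))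
    have : (nhdsWithin (0 : ℝ) (Set.Ioc 0 T)).NeBot := by
      rw [nhdsWithin_Ioc_eq_nhdsGT hT]; infer_instance
    refine le_of_tendsto c4.tendsto ?_
    filter_upwards [self_mem_nhdsWithin] with δ hδ
    exact h.norm_integral_sub_quadratic_le hδ
  rw [h.phase_zero, sqrt_zero] at hlim
  have hφT := h.phase_pos ⟨hT, le_rfl⟩
  have hX : 0 < √(φ T) := sqrt_pos.mpr hφT
  have hfr := norm_fresnel_sub_le hX
  set w := √(2 / v 0) with hw
  have hw0 : 0 < w := sqrt_pos.mpr (by positivity)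
  have hmain : e (1 / 8) * ((1 / √(v 0) : ℝ) : ℂ) / 2 = (w : ℂ) * (e (1 / 8) / (2 * (√2 : ℝ))) := by
    rw [hw, sqrt_div (by norm_num)]
    have : ((√2 : ℝ) : ℂ) ≠ 0 := by simp
    push_cast
    field_simp
  have h2 : ‖(w : ℂ) * ((∫ x in (0 : ℝ)..√(φ T), e (x ^ 2)) - e (1 / 8) / (2 * (√2 : ℝ)))‖ ≤
      2 / (m * T) := by
    rw [norm_mul, Complex.norm_real, Real.norm_eq_abs, abs_of_pos hw0]
    calc _ ≤ w * (1 / √(φ T)) := by gcongr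
      _ ≤ 2 / (m * T) := by
        rw [mul_one_div, div_le_div_iff₀ hX (by positivity)]
        refine (pow_le_pow_iff_left₀ (by positivity) (by positivity) two_ne_zero).mp ?_
        rw [mul_pow w, mul_pow 2 √(φ T), sq_sqrt hφT.le, hw, sq_sqrt (by positivity)]
        have h3 := h.sq_le_phase ⟨hT.le, le_rfl⟩
        have h4 : 2 / v 0 ≤ 2 / m := by
          have := h.m_le 0 h.zero_mem
          gcongr
        calc 2 / v 0 * (m * T) ^ 2 ≤ 2 / m * (m * T) ^ 2 := by gcongr
          _ = 4 * (m * T ^ 2 / 2) := by field_simp; ring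
          _ ≤ 4 * φ T := by gcongr
          _ = 2 ^ 2 * φ T := by ring
  rw [hmain]
  have e3 : (∫ t in (0 : ℝ)..T, e (φ t)) - (w : ℂ) * (e (1 / 8) / (2 * (√2 : ℝ))) =
      ((∫ t in (0 : ℝ)..T, e (φ t)) - (w : ℂ) * ∫ x in (0 : ℝ)..√(φ T), e (x ^ 2)) +
      (w : ℂ) * ((∫ x in (0 : ℝ)..√(φ T), e (x ^ 2)) - e (1 / 8) / (2 * (√2 : ℝ))) := by ring
  rw [e3]
  exact (norm_add_le _ _).trans (add_le_add hlim h2)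

end HalfPhase

/-! ### From exponential sums to exponential integrals -/

/-- The continuous periodic antiderivative of `psi`, half the second Bernoulli function. -/
def psiInt (t : ℝ) : ℝ := Int.fract t ^ 2 / 2 - Int.fract t / 2 + 1 / 12

theorem hasSum_psiInt (t : ℝ) :
    HasSum (fun n : ℕ => 1 / (2 * π ^ 2 * (n : ℝ) ^ 2) * cos (2 * π * n * t)) (psiInt t) := by
  have h := hasSum_one_div_nat_pow_mul_cos one_ne_zero (x := Int.fract t)
    ⟨Int.fract_nonneg t, (Int.fract_lt_one t).le⟩
  have h2 := h.mul_left (1 / (2 * π ^ 2))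
  have e1 : (Polynomial.map (algebraMap ℚ ℝ) (Polynomial.bernoulli (2 * 1))).eval (Int.fract t) =
      Int.fract t ^ 2 - Int.fract t + 1 / 6 := by
    simp [Polynomial.bernoulli, Finset.sum_range_succ, bernoulli_one,
      bernoulli_eq_bernoulli'_of_ne_one (show (2 : ℕ) ≠ 1 by norm_num), bernoulli'_two,
      Polynomial.eval_add]
    ring
  rw [e1] at h2
  convert! h2 using 1
  · funext n
    have : 2 * π * n * t = 2 * π * n * Int.fract t + ((n * ⌊t⌋ : ℤ) : ℝ) * (2 * π) := by
      conv_lhs => rw [← Int.fract_add_floor t]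
      push_cast; ring
    rw [this, cos_add_int_mul_two_pi]
    by_cases hn : n = 0
    · subst hn; simp
    · have : (n : ℝ) ≠ 0 := by exact_mod_cast hn
      field_simp
      rw [mul_one, mul_comm]
  · simp only [psiInt]
    norm_num [Nat.factorial]
    field_simp
    ring

theorem summable_psiInt_coeff : Summable fun n : ℕ => 1 / (2 * π ^ 2 * (n : ℝ) ^ 2) := by
  have := (hasSum_psiInt 0).summable
  simpa using this

theorem continuous_psiInt : Continuous psiInt := by
  have : psiInt = fun t => ∑' n : ℕ, 1 / (2 * π ^ 2 * (n : ℝ) ^ 2) * cos (2 * π * n * t) := by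
    funext t; exact (hasSum_psiInt t).tsum_eq.symm
  rw [this]
  refine continuous_tsum (fun n => by fun_prop) summable_psiInt_coeff fun n t => ?_
  rw [norm_mul, Real.norm_eq_abs, abs_of_nonneg (by positivity)]
  exact mul_le_of_le_one_right (by positivity) (abs_cos_le_one _)

theorem hasDerivWithinAt_psiInt (t : ℝ) : HasDerivWithinAt psiInt (psi t) (Set.Ioi t) t := by
  have h : HasDerivAt (fun s : ℝ => (s - ⌊t⌋) ^ 2 / 2 - (s - ⌊t⌋) / 2 + 1 / 12) (psi t) t := by
    have h1 : HasDerivAt (fun s : ℝ => s - ⌊t⌋) 1 t := (hasDerivAt_id t).sub_const _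
    refine ((((h1.pow 2).div_const 2).sub (h1.div_const 2)).add_const _).congr_deriv ?_
    simp [psi]
  refine h.hasDerivWithinAt.congr_of_eventuallyEq ?_ rfl
  filter_upwards [Ioo_mem_nhdsGT (Int.lt_floor_add_one t)] with s hs
  have : ⌊s⌋ = ⌊t⌋ := by
    rw [Int.floor_eq_iff]
    exact ⟨(Int.floor_le t).trans hs.1.le, hs.2⟩
  simp only [psiInt, Int.fract, this]

theorem abs_psi_le (t : ℝ) : |psi t| ≤ 1 / 2 := by
  have h1 := Int.floor_le t
  have h2 := (Int.lt_floor_add_one t).le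
  unfold psi
  exact abs_le.mpr ⟨by linarith, by linarith⟩

theorem measurable_psi : Measurable psi := by
  have : Measurable fun w : ℝ => ((⌊w⌋ : ℤ) : ℝ) :=
    (measurable_from_top (f := fun n : ℤ => (n : ℝ))).comp Int.measurable_floor
  exact (measurable_id.sub this).sub_const _

theorem intervalIntegrable_psi (A B : ℝ) :
    IntervalIntegrable (fun t => (psi t : ℂ)) MeasureTheory.volume A B := by
  have h := (intervalIntegrable_const (μ := MeasureTheory.volume) (a := A) (b := B) (c := (1 / 2 : ℝ)))
  refine h.mono_fun (Complex.measurable_ofReal.comp measurable_psi).aestronglyMeasurable ?_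
  refine Filter.Eventually.of_forall fun t => ?_
  simp only [Complex.norm_real, Real.norm_eq_abs]
  exact (abs_psi_le t).trans (le_abs_self _)

/-- The Fourier series of `psi` may be integrated termwise against `F'`. -/
theorem hasSum_integral_psi {F' F'' : ℝ → ℂ} {A B : ℝ} (hAB : A ≤ B)
    (hF : ∀ t ∈ Set.Icc A B, HasDerivAt F' (F'' t) t) (hF'' : ContinuousOn F'' (Set.Icc A B)) :
    HasSum (fun n : ℕ => ((-1 / (π * n) : ℝ) : ℂ) *
      ∫ t in A..B, ((sin (2 * π * n * t) : ℝ) : ℂ) * F' t) (∫ t in A..B, (psi t : ℂ) * F' t) := by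
  have hu : Set.uIcc A B = Set.Icc A B := Set.uIcc_of_le hAB
  have hIoo : ∀ t ∈ Set.Ioo (min A B) (max A B), t ∈ Set.Icc A B := by
    intro t ht
    rw [min_eq_left hAB, max_eq_right hAB] at ht
    exact ⟨ht.1.le, ht.2.le⟩
  have hi'' : IntervalIntegrable F'' MeasureTheory.volume A B :=
    ContinuousOn.intervalIntegrable (hu ▸ hF'')
  have cF : ContinuousOn F' (Set.Icc A B) := fun t ht => (hF t ht).continuousAt.continuousWithinAt
  have p1 := intervalIntegral.integral_mul_deriv_eq_deriv_mul_of_hasDeriv_right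
    (u := fun t => (psiInt t : ℂ)) (u' := fun t => (psi t : ℂ)) (v := F') (v' := F'')
    (Complex.continuous_ofReal.comp continuous_psiInt).continuousOn (hu ▸ cF)
    (fun t _ => (hasDerivWithinAt_psiInt t).ofReal_comp)
    (fun t ht => (hF t (hIoo t ht)).hasDerivWithinAt) (intervalIntegrable_psi A B) hi''
  have p2 : ∀ n : ℕ, ∫ t in A..B, ((cos (2 * π * n * t) : ℝ) : ℂ) * F'' t =
      ((cos (2 * π * n * B) : ℝ) : ℂ) * F' B - ((cos (2 * π * n * A) : ℝ) : ℂ) * F' A +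
      ((2 * π * n : ℝ) : ℂ) * ∫ t in A..B, ((sin (2 * π * n * t) : ℝ) : ℂ) * F' t := by
    intro n
    have hd : ∀ t : ℝ, HasDerivAt (fun t => ((cos (2 * π * n * t) : ℝ) : ℂ))
        ((-(2 * π * n) * sin (2 * π * n * t) : ℝ) : ℂ) t := by
      intro t
      have := (((hasDerivAt_id t).const_mul (2 * π * n)).cos).ofReal_comp
      refine this.congr_deriv ?_
      simp; ring
    rw [intervalIntegral.integral_mul_deriv_eq_deriv_mul (fun t _ => hd t)
      (fun t ht => hF t (hu ▸ ht)) (Continuous.intervalIntegrable (by fun_prop) _ _) hi'']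
    have : ∫ t in A..B, ((-(2 * π * n) * sin (2 * π * n * t) : ℝ) : ℂ) * F' t =
        -(((2 * π * n : ℝ) : ℂ) * ∫ t in A..B, ((sin (2 * π * n * t) : ℝ) : ℂ) * F' t) := by
      rw [← intervalIntegral.integral_const_mul, ← intervalIntegral.integral_neg]
      refine intervalIntegral.integral_congr fun t _ => ?_
      push_cast; ring
    rw [this]
    ring
  have hs : ∀ t, HasSum (fun n : ℕ => ((1 / (2 * π ^ 2 * (n : ℝ) ^ 2) : ℝ) : ℂ) *
      ((cos (2 * π * n * t) : ℝ) : ℂ)) (psiInt t : ℂ) := by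
    intro t
    have := Complex.hasSum_ofReal.mpr (hasSum_psiInt t)
    simpa using this
  have hint : HasSum (fun n : ℕ => ∫ t in A..B, ((1 / (2 * π ^ 2 * (n : ℝ) ^ 2) : ℝ) : ℂ) *
      ((cos (2 * π * n * t) : ℝ) : ℂ) * F'' t) (∫ t in A..B, (psiInt t : ℂ) * F'' t) := by
    refine intervalIntegral.hasSum_integral_of_dominated_convergence
      (fun n t => 1 / (2 * π ^ 2 * (n : ℝ) ^ 2) * ‖F'' t‖) ?_ ?_ ?_ ?_ ?_
    · intro n
      refine MeasureTheory.AEStronglyMeasurable.mul (Continuous.aestronglyMeasurable (by fun_prop)) ?_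
      exact hi''.aestronglyMeasurable_restrict_uIoc
    · intro n
      refine Filter.Eventually.of_forall fun t _ => ?_
      rw [norm_mul, norm_mul, Complex.norm_real, Complex.norm_real, Real.norm_eq_abs,
        Real.norm_eq_abs, abs_of_nonneg (by positivity)]
      gcongr
      exact mul_le_of_le_one_right (by positivity) (abs_cos_le_one _)
    · exact Filter.Eventually.of_forall fun t _ => summable_psiInt_coeff.mul_right _
    · simp_rw [tsum_mul_right]
      exact hi''.norm.const_mul _
    · exact Filter.Eventually.of_forall fun t _ => (hs t).mul_right _
  have htot := (((hs B).mul_right (F' B)).sub ((hs A).mul_right (F' A))).sub hint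
  have e1 : ∫ t in A..B, (psi t : ℂ) * F' t =
      (psiInt B : ℂ) * F' B - (psiInt A : ℂ) * F' A - ∫ t in A..B, (psiInt t : ℂ) * F'' t := by
    rw [p1]; ring
  rw [e1]
  convert! htot using 1
  funext n
  simp_rw [mul_assoc (((1 / (2 * π ^ 2 * (n : ℝ) ^ 2) : ℝ) : ℂ))]
  rw [intervalIntegral.integral_const_mul, p2]
  by_cases hn : n = 0
  · subst hn; simp
  · have hn' : (n : ℂ) ≠ 0 := by exact_mod_cast hn
    have hπ : (π : ℂ) ≠ 0 := by exact_mod_cast pi_ne_zero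
    push_cast
    field_simp
    ring

/-- The first-order Euler–Maclaurin formula. -/
theorem sum_eq_integral_add_integral_psi {F F' : ℝ → ℂ} {A B : ℝ} (hA : 0 ≤ A) (hAB : A ≤ B)
    (hF : ∀ t ∈ Set.Icc A B, HasDerivAt F (F' t) t) (hF' : ContinuousOn F' (Set.Icc A B)) :
    ∑ n ∈ Ioc ⌊A⌋₊ ⌊B⌋₊, F n = (∫ t in A..B, F t) + (∫ t in A..B, (psi t : ℂ) * F' t) -
      psi B * F B + psi A * F A := by
  have hu : Set.uIcc A B = Set.Icc A B := Set.uIcc_of_le hAB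
  have cF : ContinuousOn F (Set.Icc A B) := fun t ht => (hF t ht).continuousAt.continuousWithinAt
  have hi' : IntervalIntegrable F' MeasureTheory.volume A B :=
    ContinuousOn.intervalIntegrable (hu ▸ hF')
  have habel := sum_mul_eq_sub_sub_integral_mul (f := F) (fun _ => (1 : ℂ)) hA hAB
    (fun t ht => (hF t ht).differentiableAt)
    ((hF'.integrableOn_Icc).congr_fun (fun t ht => (hF t ht).deriv.symm) measurableSet_Icc)
  simp only [mul_one] at habel
  have hcard : ∀ t : ℝ, 0 ≤ t → (∑ _k ∈ Icc 0 ⌊t⌋₊, (1 : ℂ)) = (t : ℂ) + 1 / 2 - psi t := by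
    intro t ht
    have : ((⌊t⌋₊ : ℕ) : ℂ) = ((⌊t⌋ : ℤ) : ℂ) := by
      rw [← Int.cast_natCast, Int.natCast_floor_eq_floor ht]
    rw [sum_const, Nat.card_Icc, nsmul_eq_mul, mul_one, Nat.sub_zero]
    simp only [psi]
    push_cast
    rw [this]
    ring
  rw [hcard B (hA.trans hAB), hcard A hA, ← intervalIntegral.integral_of_le hAB] at habel
  have e1 : ∫ t in A..B, deriv F t * ∑ _k ∈ Icc 0 ⌊t⌋₊, (1 : ℂ) =
      ∫ t in A..B, (((t : ℂ) + 1 / 2) * F' t - (psi t : ℂ) * F' t) := by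
    refine intervalIntegral.integral_congr fun t ht => ?_
    rw [hu] at ht
    rw [(hF t ht).deriv, hcard t (hA.trans ht.1)]
    ring
  have hip : IntervalIntegrable (fun t => (psi t : ℂ) * F' t) MeasureTheory.volume A B :=
    (intervalIntegrable_psi A B).mul_continuousOn (hu ▸ hF')
  rw [e1, intervalIntegral.integral_sub _ hip] at habel
  · have p := intervalIntegral.integral_mul_deriv_eq_deriv_mul (a := A) (b := B)
      (u := fun t : ℝ => (t : ℂ) + 1 / 2) (u' := fun _ => 1) (v := F) (v' := F')
      (fun t _ => by simpa using ((hasDerivAt_id t).ofReal_comp.add_const (1 / 2 : ℂ)))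
      (fun t ht => hF t (hu ▸ ht)) (Continuous.intervalIntegrable (by fun_prop) _ _) hi'
    rw [p] at habel
    simp only [one_mul] at habel
    rw [habel]
    ring
  · exact ContinuousOn.intervalIntegrable (hu ▸ ContinuousOn.mul
      (Continuous.continuousOn (by fun_prop)) hF')

theorem sum_one_div_le (m : ℕ) : ∑ i ∈ range m, 1 / ((i : ℝ) + 1) ≤ 1 + log m := by
  have := harmonic_le_one_add_log m
  simpa [harmonic] using this

/-- The sum telescopes up to at most `m` terms `1 / (i + 1)`, whatever its length `N`. -/
theorem sum_one_div_sub_le (N m : ℕ) :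
    ∑ i ∈ range N, (1 / ((i : ℝ) + 1) - 1 / ((i : ℝ) + 1 + m)) ≤ 1 + log m := by
  have h1 := sum_range_add (fun i : ℕ => 1 / ((i : ℝ) + 1)) N m
  have h2 := sum_range_add (fun i : ℕ => 1 / ((i : ℝ) + 1)) m N
  rw [add_comm m N, h1] at h2
  have h3 : ∑ i ∈ range N, 1 / ((i : ℝ) + 1 + m) = ∑ i ∈ range N, 1 / (((m + i : ℕ) : ℝ) + 1) :=
    sum_congr rfl fun i _ => by push_cast; ring
  have h4 : 0 ≤ ∑ i ∈ range m, 1 / (((N + i : ℕ) : ℝ) + 1) :=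
    sum_nonneg fun i _ => by positivity
  rw [sum_sub_distrib, h3]
  linarith [sum_one_div_le m]

/-! ### Reduction of the exponential sum to integrals with a stationary point -/

theorem OneSignChange.of_nonneg {f : ℝ → ℝ} {a b : ℝ} (hab : a ≤ b)
    (hf : ∀ t ∈ Set.Ioo a b, 0 ≤ f t) : OneSignChange f a b :=
  ⟨a, ⟨le_rfl, hab⟩, 1, Or.inl rfl, by simp, by simpa using hf⟩

theorem OneSignChange.of_nonpos {f : ℝ → ℝ} {a b : ℝ} (hab : a ≤ b)
    (hf : ∀ t ∈ Set.Ioo a b, f t ≤ 0) : OneSignChange f a b :=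
  ⟨b, ⟨hab, le_rfl⟩, 1, Or.inl rfl, by simpa using hf, by simp⟩

/-- A phase `g` on `[A, B]` with derivatives `g₁, …, g₄`, whose slope increases from the positive
integer `a` to `2 * a`. All bounds below depend on `a` alone, thanks to the scale-invariant
inequality `g₁ * g₃ ≤ 3 * g₂ ^ 2`. -/
structure ArcPhase (g g₁ g₂ g₃ g₄ : ℝ → ℝ) (A B : ℝ) (a : ℕ) : Prop where
  A_nonneg : 0 ≤ A
  A_lt_B : A < B
  one_le : 1 ≤ a
  slope_left : g₁ A = a
  slope_right : g₁ B = 2 * a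
  hasDeriv : ∀ t ∈ Set.Icc A B, HasDerivAt g (g₁ t) t
  hasDeriv₁ : ∀ t ∈ Set.Icc A B, HasDerivAt g₁ (g₂ t) t
  hasDeriv₂ : ∀ t ∈ Set.Icc A B, HasDerivAt g₂ (g₃ t) t
  hasDeriv₃ : ∀ t ∈ Set.Icc A B, HasDerivAt g₃ (g₄ t) t
  g₂_pos : ∀ t ∈ Set.Icc A B, 0 < g₂ t
  g₃_nonneg : ∀ t ∈ Set.Icc A B, 0 ≤ g₃ t
  growth : ∀ t ∈ Set.Icc A B, g₁ t * g₃ t ≤ 3 * g₂ t ^ 2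
  sign : OneSignChange (fun t => 5 * g₃ t ^ 2 - 3 * g₂ t * g₄ t) A B

namespace ArcPhase

variable {g g₁ g₂ g₃ g₄ : ℝ → ℝ} {A B : ℝ} {a : ℕ}

theorem a_pos (h : ArcPhase g g₁ g₂ g₃ g₄ A B a) : (0 : ℝ) < a := by exact_mod_cast h.one_le

theorem left_mem (h : ArcPhase g g₁ g₂ g₃ g₄ A B a) : A ∈ Set.Icc A B := ⟨le_rfl, h.A_lt_B.le⟩

theorem right_mem (h : ArcPhase g g₁ g₂ g₃ g₄ A B a) : B ∈ Set.Icc A B := ⟨h.A_lt_B.le, le_rfl⟩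

theorem cont₁ (h : ArcPhase g g₁ g₂ g₃ g₄ A B a) : ContinuousOn g₁ (Set.Icc A B) :=
  fun t ht => (h.hasDeriv₁ t ht).continuousAt.continuousWithinAt

theorem cont₂ (h : ArcPhase g g₁ g₂ g₃ g₄ A B a) : ContinuousOn g₂ (Set.Icc A B) :=
  fun t ht => (h.hasDeriv₂ t ht).continuousAt.continuousWithinAt

theorem strictMonoOn_slope (h : ArcPhase g g₁ g₂ g₃ g₄ A B a) :
    StrictMonoOn g₁ (Set.Icc A B) := by
  refine strictMonoOn_of_hasDerivWithinAt_pos (f' := g₂) (convex_Icc _ _) h.cont₁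
    (fun t ht => (h.hasDeriv₁ t (interior_subset ht)).hasDerivWithinAt)
    (fun t ht => h.g₂_pos t (interior_subset ht))

theorem monotoneOn_g₂ (h : ArcPhase g g₁ g₂ g₃ g₄ A B a) : MonotoneOn g₂ (Set.Icc A B) :=
  monotoneOn_of_hasDerivWithinAt_nonneg (f' := g₃) (convex_Icc _ _) h.cont₂
    (fun t ht => (h.hasDeriv₂ t (interior_subset ht)).hasDerivWithinAt)
    (fun t ht => h.g₃_nonneg t (interior_subset ht))

theorem le_slope (h : ArcPhase g g₁ g₂ g₃ g₄ A B a) {t : ℝ} (ht : t ∈ Set.Icc A B) :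
    (a : ℝ) ≤ g₁ t := h.slope_left ▸ h.strictMonoOn_slope.monotoneOn h.left_mem ht ht.1

theorem slope_le (h : ArcPhase g g₁ g₂ g₃ g₄ A B a) {t : ℝ} (ht : t ∈ Set.Icc A B) :
    g₁ t ≤ 2 * a := h.slope_right ▸ h.strictMonoOn_slope.monotoneOn ht h.right_mem ht.2

/-- The inequality `g₁ * g₃ ≤ 3 * g₂ ^ 2` says that `g₂ / g₁ ^ 3` decreases. -/
theorem g₂_right_le (h : ArcPhase g g₁ g₂ g₃ g₄ A B a) : g₂ B ≤ 8 * g₂ A := by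
  have hpos : ∀ t ∈ Set.Icc A B, 0 < g₁ t := fun t ht => h.a_pos.trans_le (h.le_slope ht)
  have hd : ∀ t ∈ Set.Icc A B, HasDerivAt (fun t => g₂ t / g₁ t ^ 3)
      ((g₁ t * g₃ t - 3 * g₂ t ^ 2) / g₁ t ^ 4) t := by
    intro t ht
    have hp := hpos t ht
    refine ((h.hasDeriv₂ t ht).div ((h.hasDeriv₁ t ht).pow 3) (pow_pos hp 3).ne').congr_deriv ?_
    simp only [Pi.pow_apply]
    field_simp
    push_cast
    ring
  have hanti : AntitoneOn (fun t => g₂ t / g₁ t ^ 3) (Set.Icc A B) :=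
    antitoneOn_of_hasDerivWithinAt_nonpos (convex_Icc _ _)
      (fun t ht => (hd t ht).continuousAt.continuousWithinAt)
      (fun t ht => (hd t (interior_subset ht)).hasDerivWithinAt)
      (fun t ht => div_nonpos_of_nonpos_of_nonneg
        (by linarith [h.growth t (interior_subset ht)])
        (pow_pos (hpos t (interior_subset ht)) 4).le)
  have := hanti h.left_mem h.right_mem h.A_lt_B.le
  simp only [h.slope_left, h.slope_right] at this
  have ha := h.a_pos
  rw [div_le_div_iff₀ (by positivity) (by positivity)] at this
  have h3 : 0 < (a : ℝ) ^ 3 := by positivity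
  nlinarith

theorem g₃_le (h : ArcPhase g g₁ g₂ g₃ g₄ A B a) {t : ℝ} (ht : t ∈ Set.Icc A B) :
    g₃ t ≤ 192 * g₂ A ^ 2 / a := by
  rw [le_div_iff₀ h.a_pos]
  have h1 := h.growth t ht
  have h2 := h.le_slope ht
  have h3 := (h.monotoneOn_g₂ ht h.right_mem ht.2).trans h.g₂_right_le
  have h4 := h.g₂_pos t ht
  have h5 := h.g₃_nonneg t ht
  have h6 : g₂ t ^ 2 ≤ (8 * g₂ A) ^ 2 := pow_le_pow_left₀ h4.le h3 2
  nlinarith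

theorem hasDeriv_sub (h : ArcPhase g g₁ g₂ g₃ g₄ A B a) (x : ℝ) {t : ℝ} (ht : t ∈ Set.Icc A B) :
    HasDerivAt (fun t => g t - x * t) (g₁ t - x) t := by
  exact ((h.hasDeriv t ht).sub ((hasDerivAt_id t).const_mul x)).congr_deriv (by simp)

/-- First derivative test for the phase `g t - x t` and the amplitude `g₁`, where `x` lies outside
of the range `[a, 2a]` of `g₁`. -/
theorem norm_integral_slope_le (h : ArcPhase g g₁ g₂ g₃ g₄ A B a) {x M : ℝ}
    (hx : ∀ t ∈ Set.Icc A B, g₁ t - x ≠ 0) (hM : ∀ t ∈ Set.Icc A B, |g₁ t / (g₁ t - x)| ≤ M) :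
    ‖∫ t in A..B, e (g t - x * t) * (g₁ t : ℂ)‖ ≤ M := by
  have hd : ∀ t ∈ Set.Icc A B, HasDerivAt (fun t => g₁ t / (g₁ t - x))
      (-x * g₂ t / (g₁ t - x) ^ 2) t := by
    intro t ht
    refine ((h.hasDeriv₁ t ht).div ((h.hasDeriv₁ t ht).sub_const x) (hx t ht)).congr_deriv ?_
    congr 1
    ring
  have hs : OneSignChange (fun t => -x * g₂ t / (g₁ t - x) ^ 2) A B := by
    rcases le_total 0 x with h0 | h0
    · refine OneSignChange.of_nonpos h.A_lt_B.le fun t ht => div_nonpos_of_nonpos_of_nonneg ?_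
        (sq_nonneg _)
      have := mul_nonneg h0 (h.g₂_pos t ⟨ht.1.le, ht.2.le⟩).le
      linarith
    · refine OneSignChange.of_nonneg h.A_lt_B.le fun t ht => div_nonneg ?_ (sq_nonneg _)
      exact mul_nonneg (by linarith) (h.g₂_pos t ⟨ht.1.le, ht.2.le⟩).le
  have := norm_integral_e_mul_deriv_mul_le h.A_lt_B.le (fun t ht => h.hasDeriv_sub x ht)
    (h.cont₁.sub continuousOn_const) hd
    ((continuousOn_const.mul h.cont₂).div ((h.cont₁.sub continuousOn_const).pow 2)
      (fun t ht => pow_ne_zero 2 (hx t ht))) hs hM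
  convert! this using 2
  refine intervalIntegral.integral_congr fun t ht => ?_
  rw [Set.uIcc_of_le h.A_lt_B.le] at ht
  have := hx t ht
  rw [mul_div_cancel₀ _ this]

theorem norm_integral_e_le (h : ArcPhase g g₁ g₂ g₃ g₄ A B a) :
    ‖∫ t in A..B, e (g t)‖ ≤ 1 := by
  have hpos : ∀ t ∈ Set.Icc A B, 0 < g₁ t := fun t ht => h.a_pos.trans_le (h.le_slope ht)
  have hd : ∀ t ∈ Set.Icc A B, HasDerivAt (fun t => 1 / g₁ t) (-g₂ t / g₁ t ^ 2) t := by
    intro t ht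
    simpa using (h.hasDeriv₁ t ht).fun_inv (hpos t ht).ne'
  have := norm_integral_e_mul_deriv_mul_le (M := 1) h.A_lt_B.le h.hasDeriv h.cont₁ hd
    (h.cont₂.neg.div (h.cont₁.pow 2) (fun t ht => (pow_pos (hpos t ht) 2).ne'))
    (OneSignChange.of_nonpos h.A_lt_B.le fun t ht => div_nonpos_of_nonpos_of_nonneg
      (by linarith [h.g₂_pos t ⟨ht.1.le, ht.2.le⟩]) (sq_nonneg _))
    (fun t ht => by
      have h1 : (1 : ℝ) ≤ g₁ t := le_trans (by exact_mod_cast h.one_le) (h.le_slope ht)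
      rw [abs_of_nonneg (by positivity)]
      exact (div_le_one (hpos t ht)).mpr h1)
  convert! this using 2
  refine intervalIntegral.integral_congr fun t ht => ?_
  rw [Set.uIcc_of_le h.A_lt_B.le] at ht
  have := (hpos t ht).ne'
  rw [mul_one_div_cancel this]
  simp

theorem norm_integral_slope_sub_le (h : ArcPhase g g₁ g₂ g₃ g₄ A B a) (x : ℝ) :
    ‖(∫ t in A..B, e (g t - x * t) * (g₁ t : ℂ)) - x * ∫ t in A..B, e (g t - x * t)‖ ≤ 1 := by
  have hu : Set.uIcc A B = Set.Icc A B := Set.uIcc_of_le h.A_lt_B.le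
  have ce : ContinuousOn (fun t => e (g t - x * t)) (Set.Icc A B) :=
    continuous_e.comp_continuousOn fun t ht => (h.hasDeriv_sub x ht).continuousAt.continuousWithinAt
  have := norm_integral_e_mul_deriv_mul_le (M := 1) (Q := fun _ => 1) (Q' := fun _ => 0)
    h.A_lt_B.le (fun t ht => h.hasDeriv_sub x ht) (h.cont₁.sub continuousOn_const)
    (fun t _ => hasDerivAt_const _ _) continuousOn_const
    (OneSignChange.of_nonneg h.A_lt_B.le fun _ _ => le_rfl) (fun t _ => by simp)
  convert! this using 2
  rw [← intervalIntegral.integral_const_mul, ← intervalIntegral.integral_sub]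
  · refine intervalIntegral.integral_congr fun t _ => ?_
    push_cast; ring
  · exact ContinuousOn.intervalIntegrable
      (hu ▸ ce.mul (Complex.continuous_ofReal.comp_continuousOn h.cont₁))
  · exact ContinuousOn.intervalIntegrable (hu ▸ continuousOn_const.mul ce)

/-- The term of index `n` of the Fourier expansion that `hasSum_integral_psi` provides for
`F = e ∘ g`, split into its two exponentials. -/
theorem fourier_term_eq (h : ArcPhase g g₁ g₂ g₃ g₄ A B a) (n : ℕ) :
    ((-1 / (π * n) : ℝ) : ℂ) * ∫ t in A..B, ((sin (2 * π * n * t) : ℝ) : ℂ) *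
        (2 * π * Complex.I * g₁ t * e (g t)) =
      ((1 / (n : ℝ) : ℝ) : ℂ) * (∫ t in A..B, e (g t - n * t) * (g₁ t : ℂ)) -
      ((1 / (n : ℝ) : ℝ) : ℂ) * ∫ t in A..B, e (g t - (-n : ℝ) * t) * (g₁ t : ℂ) := by
  have hu : Set.uIcc A B = Set.Icc A B := Set.uIcc_of_le h.A_lt_B.le
  have hi : ∀ x : ℝ, IntervalIntegrable (fun t => e (g t - x * t) * (g₁ t : ℂ))
      MeasureTheory.volume A B := fun x => by
    refine ContinuousOn.intervalIntegrable (hu ▸ ContinuousOn.mul ?_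
      (Complex.continuous_ofReal.comp_continuousOn h.cont₁))
    exact continuous_e.comp_continuousOn fun t ht =>
      (h.hasDeriv_sub x ht).continuousAt.continuousWithinAt
  rw [← mul_sub, ← intervalIntegral.integral_sub (hi _) (hi _),
    ← intervalIntegral.integral_const_mul, ← intervalIntegral.integral_const_mul]
  refine intervalIntegral.integral_congr fun t _ => ?_
  have hsin : ((sin (2 * π * n * t) : ℝ) : ℂ) = (e (-(n * t)) - e (n * t)) * Complex.I / 2 := by
    rw [Complex.ofReal_sin, Complex.sin]
    simp only [e]
    congr 4 <;> (push_cast; ring)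
  have e1 : e (g t - n * t) = e (g t) * e (-(n * t)) := by rw [← e_add, sub_eq_add_neg]
  have e2 : e (g t - (-n : ℝ) * t) = e (g t) * e (n * t) := by
    rw [← e_add]; congr 1; ring
  rw [hsin, e1, e2]
  by_cases hn : n = 0
  · subst hn; simp
  · have hn' : (n : ℂ) ≠ 0 := by exact_mod_cast hn
    have hπ : (π : ℂ) ≠ 0 := by exact_mod_cast pi_ne_zero
    push_cast
    field_simp
    linear_combination (-(g₁ t : ℂ) * e (g t) * (e (-(n * t)) - e (n * t))) * Complex.I_sq

theorem norm_plus_term_le (h : ArcPhase g g₁ g₂ g₃ g₄ A B a) (n : ℕ) :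
    ‖((1 / (n : ℝ) : ℝ) : ℂ) * ∫ t in A..B, e (g t - (-n : ℝ) * t) * (g₁ t : ℂ)‖ ≤
      1 / n * (2 * a / (n + 2 * a)) := by
  have hn : (0 : ℝ) ≤ n := by positivity
  have ha := h.a_pos
  rw [norm_mul, Complex.norm_real, Real.norm_eq_abs, abs_of_nonneg (by positivity)]
  refine mul_le_mul_of_nonneg_left (h.norm_integral_slope_le (fun t ht => ?_) fun t ht => ?_)
    (by positivity)
  · have := h.le_slope ht
    linarith
  · have h1 := h.le_slope ht
    have h2 := h.slope_le ht
    have h3 : 0 < g₁ t := by linarith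
    rw [sub_neg_eq_add, abs_of_nonneg (by positivity), div_le_div_iff₀ (by positivity) (by positivity)]
    nlinarith

theorem norm_minus_term_le_of_lt (h : ArcPhase g g₁ g₂ g₃ g₄ A B a) {n : ℕ} (hn : n < a) :
    ‖((1 / (n : ℝ) : ℝ) : ℂ) * ∫ t in A..B, e (g t - n * t) * (g₁ t : ℂ)‖ ≤
      1 / n * (a / (a - n)) := by
  have hn' : (n : ℝ) < a := by exact_mod_cast hn
  have hn0 : (0 : ℝ) ≤ n := by positivity
  rw [norm_mul, Complex.norm_real, Real.norm_eq_abs, abs_of_nonneg (by positivity)]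
  refine mul_le_mul_of_nonneg_left (h.norm_integral_slope_le (fun t ht => ?_) fun t ht => ?_)
    (by positivity)
  · have := h.le_slope ht
    intro h0; linarith
  · have h1 := h.le_slope ht
    have h3 : 0 < g₁ t - n := by linarith
    have h4 : 0 < g₁ t := by linarith
    rw [abs_of_nonneg (by positivity), div_le_div_iff₀ h3 (by linarith)]
    nlinarith

theorem norm_minus_term_le_of_gt (h : ArcPhase g g₁ g₂ g₃ g₄ A B a) {n : ℕ} (hn : 2 * a < n) :
    ‖((1 / (n : ℝ) : ℝ) : ℂ) * ∫ t in A..B, e (g t - n * t) * (g₁ t : ℂ)‖ ≤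
      1 / n * (2 * a / (n - 2 * a)) := by
  have hn' : 2 * (a : ℝ) < n := by exact_mod_cast hn
  have ha := h.a_pos
  rw [norm_mul, Complex.norm_real, Real.norm_eq_abs, abs_of_nonneg (by positivity)]
  refine mul_le_mul_of_nonneg_left (h.norm_integral_slope_le (fun t ht => ?_) fun t ht => ?_)
    (by positivity)
  · have := h.slope_le ht
    intro h0; linarith
  · have h1 := h.slope_le ht
    have h2 := h.le_slope ht
    have h3 : 0 < n - g₁ t := by linarith
    have h4 : 0 < g₁ t := by linarith
    rw [abs_div, abs_of_pos h4, abs_sub_comm, abs_of_pos h3, div_le_div_iff₀ h3 (by linarith)]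
    nlinarith

theorem norm_minus_term_sub_le (h : ArcPhase g g₁ g₂ g₃ g₄ A B a) {n : ℕ} (hn : 0 < n) :
    ‖((1 / (n : ℝ) : ℝ) : ℂ) * (∫ t in A..B, e (g t - n * t) * (g₁ t : ℂ)) -
      ∫ t in A..B, e (g t - n * t)‖ ≤ 1 / n := by
  have hn' : (n : ℂ) ≠ 0 := by exact_mod_cast hn.ne'
  have : ((1 / (n : ℝ) : ℝ) : ℂ) * (∫ t in A..B, e (g t - n * t) * (g₁ t : ℂ)) -
      ∫ t in A..B, e (g t - n * t) = ((1 / (n : ℝ) : ℝ) : ℂ) *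
      ((∫ t in A..B, e (g t - n * t) * (g₁ t : ℂ)) - ((n : ℝ) : ℂ) *
        ∫ t in A..B, e (g t - n * t)) := by
    push_cast
    field_simp
  rw [this, norm_mul, Complex.norm_real, Real.norm_eq_abs, abs_of_nonneg (by positivity)]
  exact mul_le_of_le_one_right (by positivity) (h.norm_integral_slope_sub_le n)

theorem sum_plus_le (h : ArcPhase g g₁ g₂ g₃ g₄ A B a) (N : ℕ) :
    ∑ n ∈ range N, 1 / (n : ℝ) * (2 * a / (n + 2 * a)) ≤ 1 + log (2 * a) := by
  have ha := h.a_pos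
  have hl : 0 ≤ log (2 * a) := log_nonneg (by
    have : (1 : ℝ) ≤ a := by exact_mod_cast h.one_le
    linarith)
  cases N with
  | zero => simp; linarith
  | succ N =>
    rw [sum_range_succ']
    have := sum_one_div_sub_le N (2 * a)
    have e1 : ∀ i : ℕ, 1 / ((i + 1 : ℕ) : ℝ) * (2 * a / (((i + 1 : ℕ) : ℝ) + 2 * a)) =
        1 / ((i : ℝ) + 1) - 1 / ((i : ℝ) + 1 + (2 * a : ℕ)) := by
      intro i
      push_cast
      field_simp
      ring
    simp_rw [e1]
    push_cast at this ⊢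
    simpa using this

theorem sum_lt_le (h : ArcPhase g g₁ g₂ g₃ g₄ A B a) :
    ∑ n ∈ range a, 1 / (n : ℝ) * (a / (a - n)) ≤ 2 * (1 + log a) := by
  obtain ⟨m, rfl⟩ : ∃ m, a = m + 1 := ⟨a - 1, by have := h.one_le; omega⟩
  rw [sum_range_succ']
  have e1 : ∀ i ∈ range m, 1 / ((i + 1 : ℕ) : ℝ) * (((m + 1 : ℕ) : ℝ) / (((m + 1 : ℕ) : ℝ) -
      ((i + 1 : ℕ) : ℝ))) = 1 / ((i : ℝ) + 1) + 1 / (((m - 1 - i : ℕ) : ℝ) + 1) := by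
    intro i hi
    rw [mem_range] at hi
    have hc : (((m - 1 - i : ℕ) : ℝ) + 1) = m - i := by
      rw [Nat.sub_sub, Nat.cast_sub (by omega)]
      push_cast; ring
    have : (i : ℝ) < m := by exact_mod_cast hi
    have h3 : (m : ℝ) - i ≠ 0 := by linarith
    have h4 : (m : ℝ) + 1 - (i + 1) ≠ 0 := by intro h0; apply h3; linarith
    rw [hc]
    push_cast
    field_simp
    ring
  rw [sum_congr rfl e1, sum_add_distrib, sum_range_reflect (fun i : ℕ => 1 / ((i : ℝ) + 1))]
  have h1 := sum_one_div_le m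
  have h2 : log m ≤ log ((m + 1 : ℕ) : ℝ) := by
    rcases Nat.eq_zero_or_pos m with rfl | hm
    · simp
    · exact log_le_log (by exact_mod_cast hm) (by push_cast; linarith)
  simp only [Nat.cast_zero, div_zero, zero_mul, add_zero]
  linarith

theorem sum_gt_le (N : ℕ) (h : ArcPhase g g₁ g₂ g₃ g₄ A B a) :
    ∑ i ∈ range N, 1 / ((a + (a + 1) + i : ℕ) : ℝ) *
      (2 * a / (((a + (a + 1) + i : ℕ) : ℝ) - 2 * a)) ≤ 1 + log (2 * a) := by
  have ha := h.a_pos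
  have := sum_one_div_sub_le N (2 * a)
  have e1 : ∀ i : ℕ, 1 / ((a + (a + 1) + i : ℕ) : ℝ) *
      (2 * a / (((a + (a + 1) + i : ℕ) : ℝ) - 2 * a)) =
      1 / ((i : ℝ) + 1) - 1 / ((i : ℝ) + 1 + (2 * a : ℕ)) := by
    intro i
    have : (((a + (a + 1) + i : ℕ) : ℝ) - 2 * a) = i + 1 := by push_cast; ring
    rw [this]
    push_cast
    field_simp
    ring
  simp_rw [e1]
  push_cast at this ⊢
  exact this

/-- Truncated Poisson summation. -/
theorem norm_sum_sub_integrals_le (h : ArcPhase g g₁ g₂ g₃ g₄ A B a) :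
    ‖(∑ n ∈ Ioc ⌊A⌋₊ ⌊B⌋₊, e (g n)) -
      ∑ i ∈ range (a + 1), ∫ t in A..B, e (g t - (a + i : ℕ) * t)‖ ≤
      8 + 2 * log (2 * a) + 2 * log a := by
  have hu : Set.uIcc A B = Set.Icc A B := Set.uIcc_of_le h.A_lt_B.le
  have cg : ContinuousOn g (Set.Icc A B) :=
    fun t ht => (h.hasDeriv t ht).continuousAt.continuousWithinAt
  have ce : ContinuousOn (fun t => e (g t)) (Set.Icc A B) := continuous_e.comp_continuousOn cg
  have c1 : ContinuousOn (fun t => (g₁ t : ℂ)) (Set.Icc A B) :=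
    Complex.continuous_ofReal.comp_continuousOn h.cont₁
  have c2 : ContinuousOn (fun t => (g₂ t : ℂ)) (Set.Icc A B) :=
    Complex.continuous_ofReal.comp_continuousOn h.cont₂
  have hF : ∀ t ∈ Set.Icc A B, HasDerivAt (fun t => e (g t))
      (2 * π * Complex.I * g₁ t * e (g t)) t := fun t ht => hasDerivAt_e_comp (h.hasDeriv t ht)
  have hF' : ∀ t ∈ Set.Icc A B, HasDerivAt (fun t => 2 * π * Complex.I * g₁ t * e (g t))
      (2 * π * Complex.I * g₂ t * e (g t) +
        2 * π * Complex.I * g₁ t * (2 * π * Complex.I * g₁ t * e (g t))) t := fun t ht =>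
    (((h.hasDeriv₁ t ht).ofReal_comp.const_mul (2 * π * Complex.I))).mul (hF t ht)
  have hem := sum_eq_integral_add_integral_psi h.A_nonneg h.A_lt_B.le hF
    ((continuousOn_const.mul c1).mul ce)
  have hsum := hasSum_integral_psi h.A_lt_B.le hF'
    (((continuousOn_const.mul c2).mul ce).add ((continuousOn_const.mul c1).mul
      ((continuousOn_const.mul c1).mul ce)))
  simp_rw [h.fourier_term_eq] at hsum
  set P : ℕ → ℂ := fun n => ((1 / (n : ℝ) : ℝ) : ℂ) * ∫ t in A..B, e (g t - n * t) * (g₁ t : ℂ)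
    with hP
  set R : ℕ → ℂ := fun n => ((1 / (n : ℝ) : ℝ) : ℂ) *
    ∫ t in A..B, e (g t - (-n : ℝ) * t) * (g₁ t : ℂ) with hR
  have hlim : ‖(∫ t in A..B, (psi t : ℂ) * (2 * π * Complex.I * g₁ t * e (g t))) -
      ∑ i ∈ range (a + 1), ∫ t in A..B, e (g t - (a + i : ℕ) * t)‖ ≤
      6 + 2 * log (2 * a) + 2 * log a := by
    have ht := hsum.tendsto_sum_nat.comp
      ((Filter.tendsto_add_atTop_iff_nat (a + (a + 1))).mpr Filter.tendsto_id)
    have ht2 := (ht.sub_const (∑ i ∈ range (a + 1),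
      ∫ t in A..B, e (g t - (a + i : ℕ) * t))).norm
    refine le_of_tendsto ht2 (Filter.Eventually.of_forall fun N => ?_)
    simp only [Function.comp, id]
    have h1 : ‖∑ n ∈ range (N + (a + (a + 1))), R n‖ ≤ 1 + log (2 * a) :=
      (norm_sum_le_of_le _ fun n _ => h.norm_plus_term_le n).trans (h.sum_plus_le _)
    have h2 : ‖∑ n ∈ range a, P n‖ ≤ 2 * (1 + log a) :=
      (norm_sum_le_of_le _ fun n hn =>
        h.norm_minus_term_le_of_lt (mem_range.mp hn)).trans h.sum_lt_le
    have h3 : ‖∑ i ∈ range N, P (a + (a + 1) + i)‖ ≤ 1 + log (2 * a) :=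
      (norm_sum_le_of_le _ fun i _ =>
        h.norm_minus_term_le_of_gt (by omega)).trans (sum_gt_le N h)
    have h4 : ‖∑ i ∈ range (a + 1), (P (a + i) - ∫ t in A..B, e (g t - (a + i : ℕ) * t))‖ ≤ 2 := by
      have ha := h.a_pos
      have h5 : ∀ i ∈ range (a + 1),
          ‖P (a + i) - ∫ t in A..B, e (g t - (a + i : ℕ) * t)‖ ≤ 1 / a := by
        intro i _
        refine (h.norm_minus_term_sub_le (n := a + i) (by have := h.one_le; omega)).trans ?_
        push_cast
        gcongr
        have : (0 : ℝ) ≤ i := by positivity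
        linarith
      refine (norm_sum_le_of_le _ h5).trans ?_
      rw [sum_const, card_range, nsmul_eq_mul, mul_one_div, div_le_iff₀ ha]
      have : (1 : ℝ) ≤ a := by exact_mod_cast h.one_le
      push_cast
      linarith
    have e1 : ∑ n ∈ range (N + (a + (a + 1))), (P n - R n) -
        ∑ i ∈ range (a + 1), ∫ t in A..B, e (g t - (a + i : ℕ) * t) =
        ∑ n ∈ range a, P n +
        ∑ i ∈ range (a + 1), (P (a + i) - ∫ t in A..B, e (g t - (a + i : ℕ) * t)) +
        ∑ i ∈ range N, P (a + (a + 1) + i) - ∑ n ∈ range (N + (a + (a + 1))), R n := by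
      rw [sum_sub_distrib, sum_sub_distrib]
      have : ∑ n ∈ range (N + (a + (a + 1))), P n = ∑ n ∈ range a, P n +
        ∑ i ∈ range (a + 1), P (a + i) + ∑ i ∈ range N, P (a + (a + 1) + i) := by
        rw [add_comm N, sum_range_add, sum_range_add]
      rw [this]
      ring
    rw [e1]
    refine (norm_sub_le _ _).trans ?_
    have h6 := norm_add_le (∑ n ∈ range a, P n +
        ∑ i ∈ range (a + 1), (P (a + i) - ∫ t in A..B, e (g t - (a + i : ℕ) * t)))
        (∑ i ∈ range N, P (a + (a + 1) + i))
    have h7 := norm_add_le (∑ n ∈ range a, P n)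
        (∑ i ∈ range (a + 1), (P (a + i) - ∫ t in A..B, e (g t - (a + i : ℕ) * t)))
    linarith
  have hpsi : ∀ t : ℝ, ‖(psi t : ℂ) * e (g t)‖ ≤ 1 / 2 := by
    intro t
    rw [norm_mul, norm_e, mul_one, Complex.norm_real, Real.norm_eq_abs]
    exact abs_psi_le t
  rw [hem]
  have e2 : (∫ t in A..B, e (g t)) + (∫ t in A..B, (psi t : ℂ) *
      (2 * π * Complex.I * g₁ t * e (g t))) - psi B * e (g B) + psi A * e (g A) -
      ∑ i ∈ range (a + 1), ∫ t in A..B, e (g t - (a + i : ℕ) * t) =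
      (∫ t in A..B, e (g t)) + ((∫ t in A..B, (psi t : ℂ) *
      (2 * π * Complex.I * g₁ t * e (g t))) -
      ∑ i ∈ range (a + 1), ∫ t in A..B, e (g t - (a + i : ℕ) * t)) +
      (psi A * e (g A) - psi B * e (g B)) := by ring
  rw [e2]
  refine (norm_add₃_le).trans ?_
  have h8 := norm_sub_le ((psi A : ℂ) * e (g A)) (psi B * e (g B))
  linarith [hpsi A, hpsi B, h.norm_integral_e_le]

end ArcPhase

/-! ### The van der Corput transform -/

namespace ArcPhase

variable {g g₁ g₂ g₃ g₄ : ℝ → ℝ} {A B : ℝ} {a : ℕ}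

theorem slope_sub_le (h : ArcPhase g g₁ g₂ g₃ g₄ A B a) {s t : ℝ} (hs : s ∈ Set.Icc A B)
    (ht : t ∈ Set.Icc A B) (hst : s ≤ t) : g₁ t - g₁ s ≤ 8 * g₂ A * (t - s) := by
  have hanti : AntitoneOn (fun t => g₁ t - 8 * g₂ A * t) (Set.Icc A B) := by
    refine antitoneOn_of_hasDerivWithinAt_nonpos (f' := fun t => g₂ t - 8 * g₂ A) (convex_Icc _ _)
      (h.cont₁.sub (by fun_prop)) (fun t ht => ?_) (fun t ht => ?_)
    · refine (((h.hasDeriv₁ t (interior_subset ht)).sub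
        ((hasDerivAt_id t).const_mul (8 * g₂ A))).congr_deriv ?_).hasDerivWithinAt
      simp
    · have := h.monotoneOn_g₂ (interior_subset ht) h.right_mem (interior_subset ht).2
      linarith [h.g₂_right_le]
  have := hanti hs ht hst
  simp only at this
  linarith

theorem halfPhase_right (h : ArcPhase g g₁ g₂ g₃ g₄ A B a) {τ : ℝ} (hτ : τ ∈ Set.Ico A B) :
    HalfPhase (fun s => g (τ + s) - g τ - g₁ τ * s) (fun s => g₁ (τ + s) - g₁ τ)
      (fun s => g₂ (τ + s)) (fun s => g₃ (τ + s)) (fun s => g₄ (τ + s)) (B - τ) (g₂ A)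
      (192 * g₂ A ^ 2 / a) := by
  have hm : ∀ s ∈ Set.Icc 0 (B - τ), τ + s ∈ Set.Icc A B := fun s hs =>
    ⟨by linarith [hs.1, hτ.1], by linarith [hs.2]⟩
  refine ⟨h.g₂_pos A h.left_mem, by linarith [hτ.2], by simp, by simp, fun s hs => ?_,
    fun s hs => ?_, fun s hs => ?_, fun s hs => ?_, fun s hs => ?_, fun s hs => ?_, ?_⟩
  · exact ((((h.hasDeriv _ (hm s hs)).comp_const_add τ s).sub_const _).sub
      ((hasDerivAt_id s).const_mul (g₁ τ))).congr_deriv (by simp)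
  · exact ((h.hasDeriv₁ _ (hm s hs)).comp_const_add τ s).sub_const _
  · exact (h.hasDeriv₂ _ (hm s hs)).comp_const_add τ s
  · exact (h.hasDeriv₃ _ (hm s hs)).comp_const_add τ s
  · exact h.monotoneOn_g₂ h.left_mem (hm s hs) (hm s hs).1
  · rw [abs_of_nonneg (h.g₃_nonneg _ (hm s hs))]
    exact h.g₃_le (hm s hs)
  · have := (h.sign.mono hτ.1 le_rfl hτ.2.le).comp_add τ
    rwa [sub_self] at this

theorem halfPhase_left (h : ArcPhase g g₁ g₂ g₃ g₄ A B a) {τ : ℝ} (hτ : τ ∈ Set.Ioc A B) :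
    HalfPhase (fun s => g (τ - s) - g τ + g₁ τ * s) (fun s => g₁ τ - g₁ (τ - s))
      (fun s => g₂ (τ - s)) (fun s => -g₃ (τ - s)) (fun s => g₄ (τ - s)) (τ - A) (g₂ A)
      (192 * g₂ A ^ 2 / a) := by
  have hm : ∀ s ∈ Set.Icc 0 (τ - A), τ - s ∈ Set.Icc A B := fun s hs =>
    ⟨by linarith [hs.2], by linarith [hs.1, hτ.2]⟩
  refine ⟨h.g₂_pos A h.left_mem, by linarith [hτ.1], by simp, by simp, fun s hs => ?_,
    fun s hs => ?_, fun s hs => ?_, fun s hs => ?_, fun s hs => ?_, fun s hs => ?_, ?_⟩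
  · exact ((((h.hasDeriv _ (hm s hs)).comp_const_sub τ s).sub_const _).add
      ((hasDerivAt_id s).const_mul (g₁ τ))).congr_deriv (by simp; ring)
  · exact (((h.hasDeriv₁ _ (hm s hs)).comp_const_sub τ s).const_sub _).congr_deriv (by simp)
  · exact (h.hasDeriv₂ _ (hm s hs)).comp_const_sub τ s
  · exact ((h.hasDeriv₃ _ (hm s hs)).comp_const_sub τ s).fun_neg.congr_deriv (by simp)
  · exact h.monotoneOn_g₂ h.left_mem (hm s hs) (hm s hs).1
  · rw [abs_neg, abs_of_nonneg (h.g₃_nonneg _ (hm s hs))]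
    exact h.g₃_le (hm s hs)
  · have := (h.sign.mono le_rfl hτ.2 hτ.1.le).comp_sub τ
    rw [sub_self] at this
    simpa only [neg_sq] using this

theorem error_le (h : ArcPhase g g₁ g₂ g₃ g₄ A B a) {s t : ℝ} (hs : s ∈ Set.Icc A B)
    (ht : t ∈ Set.Icc A B) (hst : s < t) :
    192 * g₂ A ^ 2 / a / g₂ A ^ 2 + 2 / (g₂ A * (t - s)) ≤ 192 / a + 16 / (g₁ t - g₁ s) := by
  have hm := h.g₂_pos A h.left_mem
  have h1 := h.slope_sub_le hs ht hst.le
  have h2 : 0 < g₁ t - g₁ s := sub_pos.mpr (h.strictMonoOn_slope hs ht hst)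
  have h3 : 0 < t - s := by linarith
  refine add_le_add (le_of_eq ?_) ?_
  · have := h.a_pos
    field_simp
  · rw [div_le_div_iff₀ (by positivity) h2]
    linarith

theorem norm_integral_right_le (h : ArcPhase g g₁ g₂ g₃ g₄ A B a) {τ : ℝ}
    (hτ : τ ∈ Set.Ico A B) :
    ‖(∫ t in τ..B, e (g t - g₁ τ * t)) -
      e (1 / 8) * ((1 / √(g₂ τ) : ℝ) * e (g τ - g₁ τ * τ)) / 2‖ ≤
      192 / a + 16 / (2 * a - g₁ τ) := by
  have hmain := (h.halfPhase_right hτ).norm_integral_sub_main_le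
  have herr := h.error_le ⟨hτ.1, hτ.2.le⟩ h.right_mem hτ.2
  rw [h.slope_right] at herr
  have hint : ∫ t in τ..B, e (g t - g₁ τ * t) = e (g τ - g₁ τ * τ) *
      ∫ s in (0 : ℝ)..(B - τ), e (g (τ + s) - g τ - g₁ τ * s) := by
    have := intervalIntegral.integral_comp_add_left (a := 0) (b := B - τ)
      (fun t => e (g t - g₁ τ * t)) τ
    rw [add_zero, add_sub_cancel] at this
    rw [← this, ← intervalIntegral.integral_const_mul]
    refine intervalIntegral.integral_congr fun s _ => ?_
    rw [← e_add]
    congr 1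
    ring
  rw [hint]
  have e1 : e (g τ - g₁ τ * τ) * (∫ s in (0 : ℝ)..(B - τ), e (g (τ + s) - g τ - g₁ τ * s)) -
      e (1 / 8) * ((1 / √(g₂ τ) : ℝ) * e (g τ - g₁ τ * τ)) / 2 = e (g τ - g₁ τ * τ) *
      ((∫ s in (0 : ℝ)..(B - τ), e (g (τ + s) - g τ - g₁ τ * s)) -
        e (1 / 8) * ((1 / √(g₂ (τ + 0)) : ℝ) : ℂ) / 2) := by
    rw [add_zero]; ring
  rw [e1, norm_mul, norm_e, one_mul]
  exact hmain.trans herr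

theorem norm_integral_left_le (h : ArcPhase g g₁ g₂ g₃ g₄ A B a) {τ : ℝ}
    (hτ : τ ∈ Set.Ioc A B) :
    ‖(∫ t in A..τ, e (g t - g₁ τ * t)) -
      e (1 / 8) * ((1 / √(g₂ τ) : ℝ) * e (g τ - g₁ τ * τ)) / 2‖ ≤
      192 / a + 16 / (g₁ τ - a) := by
  have hmain := (h.halfPhase_left hτ).norm_integral_sub_main_le
  have herr := h.error_le h.left_mem ⟨hτ.1.le, hτ.2⟩ hτ.1
  rw [h.slope_left] at herr
  have hint : ∫ t in A..τ, e (g t - g₁ τ * t) = e (g τ - g₁ τ * τ) *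
      ∫ s in (0 : ℝ)..(τ - A), e (g (τ - s) - g τ + g₁ τ * s) := by
    have := intervalIntegral.integral_comp_sub_left (a := 0) (b := τ - A)
      (fun t => e (g t - g₁ τ * t)) τ
    rw [sub_zero, sub_sub_cancel] at this
    rw [← this, ← intervalIntegral.integral_const_mul]
    refine intervalIntegral.integral_congr fun s _ => ?_
    rw [← e_add]
    congr 1
    ring
  rw [hint]
  have e1 : e (g τ - g₁ τ * τ) * (∫ s in (0 : ℝ)..(τ - A), e (g (τ - s) - g τ + g₁ τ * s)) -
      e (1 / 8) * ((1 / √(g₂ τ) : ℝ) * e (g τ - g₁ τ * τ)) / 2 = e (g τ - g₁ τ * τ) *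
      ((∫ s in (0 : ℝ)..(τ - A), e (g (τ - s) - g τ + g₁ τ * s)) -
        e (1 / 8) * ((1 / √(g₂ (τ - 0)) : ℝ) : ℂ) / 2) := by
    rw [sub_zero]; ring
  rw [e1, norm_mul, norm_e, one_mul]
  exact hmain.trans herr

theorem starSum_eq (Φ : ℕ → ℂ) (ha : 1 ≤ a) :
    starSum a (2 * a) Φ = ∑ i ∈ range a, Φ (a + i) / 2 + ∑ i ∈ range a, Φ (a + (i + 1)) / 2 := by
  have h1 : ∑ i ∈ range a, Φ (a + i) = Φ a + ∑ ℓ ∈ Ioo a (2 * a), Φ ℓ := by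
    obtain ⟨m, rfl⟩ : ∃ m, a = m + 1 := ⟨a - 1, by omega⟩
    rw [sum_range_succ', add_comm, add_zero]
    congr 1
    refine sum_nbij (fun i => m + 1 + (i + 1)) ?_ ?_ ?_ fun _ _ => rfl
    · intro i hi; simp at hi ⊢; omega
    · intro i _ j _ hij; simp at hij; omega
    · intro l hl
      simp at hl
      exact ⟨l - (m + 2), by simp; omega, by simp; omega⟩
  have h2 : ∑ i ∈ range a, Φ (a + (i + 1)) = ∑ ℓ ∈ Ioo a (2 * a), Φ ℓ + Φ (2 * a) := by
    have e1 := sum_range_succ (fun i => Φ (a + i)) a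
    have e2 := sum_range_succ' (fun i => Φ (a + i)) a
    rw [e1, h1, add_zero, ← two_mul] at e2
    linear_combination -e2
  rw [← sum_div, ← sum_div, h1, h2, starSum]
  ring

/-- The van der Corput transform (the "B-process") with an absolute constant, for an arc whose
slopes at the end points are integers. The frequency `ℓ` has its stationary point at `t ℓ`; at the
two extreme frequencies only one side of the stationary point lies in `[A, B]`. -/
theorem norm_sum_sub_starSum_le (h : ArcPhase g g₁ g₂ g₃ g₄ A B a) {t : ℕ → ℝ}
    (ht : ∀ ℓ, a ≤ ℓ → ℓ ≤ 2 * a → t ℓ ∈ Set.Icc A B ∧ g₁ (t ℓ) = ℓ) :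
    ‖(∑ n ∈ Ioc ⌊A⌋₊ ⌊B⌋₊, e (g n)) - e (1 / 8) * starSum a (2 * a) fun ℓ =>
      (1 / √(g₂ (t ℓ)) : ℝ) * e (g (t ℓ) - ℓ * t ℓ)‖ ≤ 500 * (1 + log a) := by
  have ha := h.a_pos
  have ha1 : (1 : ℝ) ≤ a := by exact_mod_cast h.one_le
  set Φ : ℕ → ℂ := fun ℓ => (1 / √(g₂ (t ℓ)) : ℝ) * e (g (t ℓ) - ℓ * t ℓ) with hΦ
  have cint : ∀ (x : ℝ) (c d : ℝ), c ∈ Set.Icc A B → d ∈ Set.Icc A B →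
      IntervalIntegrable (fun t => e (g t - x * t)) MeasureTheory.volume c d := by
    intro x c d hc hd
    refine ContinuousOn.intervalIntegrable (ContinuousOn.mono ?_ (Set.uIcc_subset_Icc hc hd))
    exact continuous_e.comp_continuousOn fun t ht =>
      (h.hasDeriv_sub x ht).continuousAt.continuousWithinAt
  have hR : ∀ i ∈ range a, ‖(∫ s in t (a + i)..B, e (g s - (a + i : ℕ) * s)) -
      e (1 / 8) * Φ (a + i) / 2‖ ≤ 192 / a + 16 / (a - i) := by
    intro i hi
    rw [mem_range] at hi
    obtain ⟨hm, hs⟩ := ht (a + i) (by omega) (by omega)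
    have hlt : t (a + i) < B := by
      refine lt_of_le_of_ne hm.2 fun hB => ?_
      rw [hB, h.slope_right] at hs
      have : 2 * a = a + i := by exact_mod_cast hs
      omega
    have := h.norm_integral_right_le ⟨hm.1, hlt⟩
    rw [hs] at this
    have e1 : (2 * a - ((a + i : ℕ) : ℝ)) = a - i := by push_cast; ring
    rwa [e1] at this
  have hL : ∀ i ∈ range a, ‖(∫ s in A..t (a + (i + 1)), e (g s - (a + (i + 1) : ℕ) * s)) -
      e (1 / 8) * Φ (a + (i + 1)) / 2‖ ≤ 192 / a + 16 / (i + 1) := by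
    intro i hi
    rw [mem_range] at hi
    obtain ⟨hm, hs⟩ := ht (a + (i + 1)) (by omega) (by omega)
    have hlt : A < t (a + (i + 1)) := by
      refine lt_of_le_of_ne hm.1 fun hA => ?_
      rw [← hA, h.slope_left] at hs
      have : a = a + (i + 1) := by exact_mod_cast hs
      omega
    have := h.norm_integral_left_le ⟨hlt, hm.2⟩
    rw [hs] at this
    have e1 : (((a + (i + 1) : ℕ) : ℝ) - a) = i + 1 := by push_cast; ring
    rwa [e1] at this
  -- at the extreme frequencies one of the two halves is empty
  have hA : t a = A := by
    obtain ⟨hm, hs⟩ := ht a le_rfl (by omega)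
    exact h.strictMonoOn_slope.injOn hm h.left_mem (by rw [hs, h.slope_left])
  have hB : t (a + a) = B := by
    obtain ⟨hm, hs⟩ := ht (a + a) (by omega) (by omega)
    refine h.strictMonoOn_slope.injOn hm h.right_mem ?_
    rw [hs, h.slope_right]
    push_cast; ring
  have hsplit : ∑ i ∈ range (a + 1), ∫ s in A..B, e (g s - (a + i : ℕ) * s) =
      ∑ i ∈ range a, (∫ s in t (a + i)..B, e (g s - (a + i : ℕ) * s)) +
      ∑ i ∈ range a, ∫ s in A..t (a + (i + 1)), e (g s - (a + (i + 1) : ℕ) * s) := by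
    have e1 : ∀ i ∈ range (a + 1), ∫ s in A..B, e (g s - (a + i : ℕ) * s) =
        (∫ s in A..t (a + i), e (g s - (a + i : ℕ) * s)) +
        ∫ s in t (a + i)..B, e (g s - (a + i : ℕ) * s) := by
      intro i hi
      rw [mem_range] at hi
      obtain ⟨hm, _⟩ := ht (a + i) (by omega) (by omega)
      exact (intervalIntegral.integral_add_adjacent_intervals
        (cint _ _ _ h.left_mem hm) (cint _ _ _ hm h.right_mem)).symm
    rw [sum_congr rfl e1, sum_add_distrib, sum_range_succ' (fun i => ∫ s in A..t (a + i), _),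
      sum_range_succ (fun i => ∫ s in t (a + i)..B, _), hB, add_zero, hA]
    simp only [intervalIntegral.integral_same, add_zero]
    rw [add_comm]
  have hrefl : ∑ i ∈ range a, 16 / ((a : ℝ) - i) = 16 * ∑ i ∈ range a, 1 / ((i : ℝ) + 1) := by
    rw [← sum_range_reflect (fun i : ℕ => 1 / ((i : ℝ) + 1)), mul_sum]
    refine sum_congr rfl fun i hi => ?_
    rw [mem_range] at hi
    have : (((a - 1 - i : ℕ) : ℝ) + 1) = a - i := by
      rw [Nat.sub_sub, Nat.cast_sub (by omega)]
      push_cast; ring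
    rw [this, mul_one_div]
  have hharm := sum_one_div_le a
  have hc : ∑ i ∈ range a, 192 / (a : ℝ) = 192 := by
    rw [sum_const, card_range, nsmul_eq_mul]
    field_simp
  have hR' := norm_sum_le_of_le _ hR
  have hL' := norm_sum_le_of_le _ hL
  rw [sum_add_distrib, hc, hrefl] at hR'
  have hL2 : ∑ i ∈ range a, 16 / ((i : ℝ) + 1) = 16 * ∑ i ∈ range a, 1 / ((i : ℝ) + 1) := by
    rw [mul_sum]; exact sum_congr rfl fun i _ => by rw [mul_one_div]
  rw [sum_add_distrib, hc, hL2] at hL'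
  have hP := h.norm_sum_sub_integrals_le
  have hlog : log (2 * a) ≤ 1 + log a := by
    rw [log_mul (by norm_num) ha.ne']
    linarith [log_two_lt_d9]
  have hlog0 : 0 ≤ log a := log_nonneg ha1
  have efin : (∑ n ∈ Ioc ⌊A⌋₊ ⌊B⌋₊, e (g n)) - e (1 / 8) * starSum a (2 * a) Φ =
      ((∑ n ∈ Ioc ⌊A⌋₊ ⌊B⌋₊, e (g n)) -
        ∑ i ∈ range (a + 1), ∫ t in A..B, e (g t - (a + i : ℕ) * t)) +
      (∑ i ∈ range a, ((∫ s in t (a + i)..B, e (g s - (a + i : ℕ) * s)) -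
        e (1 / 8) * Φ (a + i) / 2)) +
      ∑ i ∈ range a, ((∫ s in A..t (a + (i + 1)), e (g s - (a + (i + 1) : ℕ) * s)) -
        e (1 / 8) * Φ (a + (i + 1)) / 2) := by
    rw [starSum_eq Φ h.one_le, hsplit, sum_sub_distrib, sum_sub_distrib, mul_add, mul_sum, mul_sum]
    simp_rw [mul_div_assoc]
    ring
  rw [efin]
  refine norm_add₃_le.trans ?_
  linarith

end ArcPhase

/-! ### Calculus on the Lamé curve -/

/-- Minus `c` times the ordinate of the Lamé curve `x ^ k + y ^ k = W` over the abscissa `t`. -/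
def curve (k W c t : ℝ) : ℝ := -(c * (W - t ^ k) ^ (1 / k))

/-- The derivative of `curve`. -/
def curve₁ (k W c t : ℝ) : ℝ := c * (t ^ (k - 1) * (W - t ^ k) ^ (1 / k - 1))

/-- The second derivative of `curve`. -/
def curve₂ (k W c t : ℝ) : ℝ := c * (k - 1) * W * (t ^ (k - 2) * (W - t ^ k) ^ (1 / k - 2))

/-- The logarithmic derivative of `curve₂`. -/
def curveLog (k W t : ℝ) : ℝ := ((k - 2) * W + (k + 1) * t ^ k) / (t * (W - t ^ k))

/-- The derivative of `curveLog`. -/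
def curveLog₁ (k W t : ℝ) : ℝ :=
  (-(k - 2) * W ^ 2 + (k + 1) * (2 * k - 3) * t ^ k * W + (k + 1) * (t ^ k) ^ 2) /
    (t * (W - t ^ k)) ^ 2

section Calculus

variable {k W c t : ℝ}

theorem hasDerivAt_curve_base (ht : 0 < t) :
    HasDerivAt (fun t => W - t ^ k) (-(k * t ^ (k - 1))) t :=
  (hasDerivAt_rpow_const (Or.inl ht.ne')).const_sub W

theorem hasDerivAt_curve (hk : k ≠ 0) (ht : 0 < t) (hs : 0 < W - t ^ k) :
    HasDerivAt (curve k W c) (curve₁ k W c t) t := by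
  refine ((((hasDerivAt_curve_base ht).rpow_const (p := 1 / k) (Or.inl hs.ne')).const_mul c).fun_neg
    ).congr_deriv ?_
  simp only [curve₁]
  field_simp

theorem hasDerivAt_curve₁ (hk : k ≠ 0) (ht : 0 < t) (hs : 0 < W - t ^ k) :
    HasDerivAt (curve₁ k W c) (curve₂ k W c t) t := by
  have d1 : HasDerivAt (fun t : ℝ => t ^ (k - 1)) ((k - 1) * t ^ (k - 1 - 1)) t :=
    hasDerivAt_rpow_const (Or.inl ht.ne')
  refine ((d1.mul ((hasDerivAt_curve_base ht).rpow_const (p := 1 / k - 1)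
    (Or.inl hs.ne'))).const_mul c).congr_deriv ?_
  have e1 : t ^ (k - 1) = t ^ (k - 2) * t := by rw [← rpow_add_one ht.ne']; ring_nf
  have e0 : t ^ k = t ^ (k - 2) * t ^ 2 := by
    rw [← rpow_natCast, ← rpow_add ht]; norm_num
  have e2 : t ^ (k - 1 - 1) = t ^ (k - 2) := by ring_nf
  have e3 : (W - t ^ k) ^ (1 / k - 1) = (W - t ^ k) ^ (1 / k - 2) * (W - t ^ k) := by
    rw [← rpow_add_one hs.ne']; ring_nf
  have e4 : (W - t ^ k) ^ (1 / k - 1 - 1) = (W - t ^ k) ^ (1 / k - 2) := by ring_nf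
  simp only [curve₂]
  rw [e4, e3, e2, e1]
  have e5 : k * (1 / k - 1) = 1 - k := by field_simp
  set S := (W - t ^ k) ^ (1 / k - 2)
  rw [e0]
  linear_combination (-c * t ^ (k - 2) * t * t ^ (k - 2) * t * S) * e5

theorem hasDerivAt_curve₂ (hk : k ≠ 0) (ht : 0 < t) (hs : 0 < W - t ^ k) :
    HasDerivAt (curve₂ k W c) (curve₂ k W c t * curveLog k W t) t := by
  have d1 : HasDerivAt (fun t : ℝ => t ^ (k - 2)) ((k - 2) * t ^ (k - 2 - 1)) t :=
    hasDerivAt_rpow_const (Or.inl ht.ne')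
  refine ((d1.mul ((hasDerivAt_curve_base ht).rpow_const (p := 1 / k - 2)
    (Or.inl hs.ne'))).const_mul (c * (k - 1) * W)).congr_deriv ?_
  rw [rpow_sub_one ht.ne' (k - 2), rpow_sub_one hs.ne' (1 / k - 2), rpow_sub_one ht.ne' k]
  simp only [curve₂, curveLog]
  field_simp
  ring

theorem hasDerivAt_curveLog (ht : 0 < t) (hs : 0 < W - t ^ k) :
    HasDerivAt (curveLog k W) (curveLog₁ k W t) t := by
  have d0 : HasDerivAt (fun t : ℝ => t ^ k) (k * t ^ (k - 1)) t :=
    hasDerivAt_rpow_const (Or.inl ht.ne')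
  refine (((d0.const_mul (k + 1)).const_add ((k - 2) * W)).div
    ((hasDerivAt_id t).mul (hasDerivAt_curve_base ht)) (mul_pos ht hs).ne').congr_deriv ?_
  rw [rpow_sub_one ht.ne' k]
  simp only [curveLog₁, id, Pi.mul_apply]
  field_simp
  ring

theorem hasDerivAt_curve₃ (hk : k ≠ 0) (ht : 0 < t) (hs : 0 < W - t ^ k) :
    HasDerivAt (fun t => curve₂ k W c t * curveLog k W t)
      (curve₂ k W c t * (curveLog k W t ^ 2 + curveLog₁ k W t)) t := by
  refine ((hasDerivAt_curve₂ hk ht hs).mul (hasDerivAt_curveLog ht hs)).congr_deriv ?_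
  ring

theorem curve₂_pos (hk : 2 < k) (hc : 0 < c) (hW : 0 < W) (ht : 0 < t) (hs : 0 < W - t ^ k) :
    0 < curve₂ k W c t := by
  have : 0 < k - 1 := by linarith
  unfold curve₂
  positivity

theorem curveLog_nonneg (hk : 2 < k) (hW : 0 < W) (ht : 0 < t) (hs : 0 < W - t ^ k) :
    0 ≤ curveLog k W t := by
  have : 0 < k - 2 := by linarith
  unfold curveLog
  positivity

/-- The constant `3` suffices because `2 * k - 1 ≤ 3 * (k - 1)` for `k ≥ 2`. -/
theorem curve_growth (hk : 2 < k) (hc : 0 < c) (hW : 0 < W) (ht : 0 < t) (hs : 0 < W - t ^ k) :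
    curve₁ k W c t * (curve₂ k W c t * curveLog k W t) ≤ 3 * curve₂ k W c t ^ 2 := by
  have h2 := curve₂_pos hk hc hW ht hs
  have h1 : curve₁ k W c t * curveLog k W t ≤ 3 * curve₂ k W c t := by
    have e1 : t ^ (k - 1) = t ^ (k - 2) * t := by rw [← rpow_add_one ht.ne']; ring_nf
    have e3 : (W - t ^ k) ^ (1 / k - 1) = (W - t ^ k) ^ (1 / k - 2) * (W - t ^ k) := by
      rw [← rpow_add_one hs.ne']; ring_nf
    have e4 : curve₁ k W c t * curveLog k W t =
        c * (t ^ (k - 2) * (W - t ^ k) ^ (1 / k - 2)) * ((k - 2) * W + (k + 1) * t ^ k) := by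
      simp only [curve₁, curveLog]
      rw [e1, e3]
      field_simp
    have e5 : 3 * curve₂ k W c t =
        c * (t ^ (k - 2) * (W - t ^ k) ^ (1 / k - 2)) * (3 * (k - 1) * W) := by
      simp only [curve₂]; ring
    rw [e4, e5]
    refine mul_le_mul_of_nonneg_left ?_ (by positivity)
    nlinarith
  nlinarith

/-- The expression whose sign is opposite to that of the equiaffine curvature of the Lamé curve. The
last factor increases for `t ^ k ≥ W / 2`; it takes both signs there when `k < 3`. -/
theorem curve_sign_eq (ht : 0 < t) (hs : 0 < W - t ^ k) :
    5 * (curve₂ k W c t * curveLog k W t) ^ 2 -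
      3 * curve₂ k W c t * (curve₂ k W c t * (curveLog k W t ^ 2 + curveLog₁ k W t)) =
    curve₂ k W c t ^ 2 * (2 * k - 1) / (t * (W - t ^ k)) ^ 2 *
      ((k - 2) * W ^ 2 - (k + 1) * (t ^ k * (W - t ^ k))) := by
  simp only [curveLog, curveLog₁]
  field_simp
  ring

end Calculus

/-- The abscissa at which the Lamé curve has slope `-x`. -/
def slopePoint (k W x : ℝ) : ℝ := W ^ (1 / k) * (1 + x ^ (-q k)) ^ (-1 / k)

theorem node_eq_slopePoint (k W : ℝ) (j : ℕ) : node k W j = slopePoint k W (2 ^ j) := by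
  unfold node slopePoint
  rw [← rpow_natCast, ← rpow_mul (by norm_num), neg_mul, mul_neg]

section SlopePoint

variable {k W x : ℝ}

theorem slopePoint_pos (hW : 0 < W) (hx : 0 < x) : 0 < slopePoint k W x := by
  unfold slopePoint; positivity

theorem slopePoint_rpow (hk : k ≠ 0) (hW : 0 < W) (hx : 0 < x) :
    slopePoint k W x ^ k = W / (1 + x ^ (-q k)) := by
  unfold slopePoint
  rw [mul_rpow (by positivity) (by positivity), ← rpow_mul hW.le, ← rpow_mul (by positivity),
    one_div_mul_cancel hk, div_mul_cancel₀ _ hk, rpow_one, rpow_neg_one, div_eq_mul_inv]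

theorem sub_slopePoint_rpow (hk : k ≠ 0) (hW : 0 < W) (hx : 0 < x) :
    W - slopePoint k W x ^ k = W * x ^ (-q k) / (1 + x ^ (-q k)) := by
  have : 0 < x ^ (-q k) := by positivity
  rw [slopePoint_rpow hk hW hx]
  field_simp
  ring

theorem sub_slopePoint_rpow_pos (hk : k ≠ 0) (hW : 0 < W) (hx : 0 < x) :
    0 < W - slopePoint k W x ^ k := by
  rw [sub_slopePoint_rpow hk hW hx]; positivity

theorem q_pos (hk : 2 < k) : 0 < q k := by
  have : 0 < k - 1 := by linarith
  unfold q; positivity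

theorem slopePoint_lt {y : ℝ} (hk : 2 < k) (hW : 0 < W) (hx : 0 < x) (hxy : x < y) :
    slopePoint k W x < slopePoint k W y := by
  unfold slopePoint
  have h1 : y ^ (-q k) < x ^ (-q k) :=
    rpow_lt_rpow_of_neg hx hxy (by linarith [q_pos hk])
  have h0 : 0 < y ^ (-q k) := rpow_pos_of_pos (hx.trans hxy) _
  refine mul_lt_mul_of_pos_left ?_ (by positivity)
  refine rpow_lt_rpow_of_neg (by positivity) (by linarith) ?_
  exact div_neg_of_neg_of_pos (by norm_num) (by linarith)

theorem slopePoint_le {y : ℝ} (hk : 2 < k) (hW : 0 < W) (hx : 0 < x) (hxy : x ≤ y) :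
    slopePoint k W x ≤ slopePoint k W y := by
  rcases hxy.eq_or_lt with rfl | h
  · exact le_rfl
  · exact (slopePoint_lt hk hW hx h).le

theorem curve₁_slopePoint {c : ℝ} (hk : 2 < k) (hW : 0 < W) (hx : 0 < x) :
    curve₁ k W c (slopePoint k W x) = c * x := by
  have hk0 : k ≠ 0 := by linarith
  have hk1 : k - 1 ≠ 0 := by linarith
  have ht := slopePoint_pos (k := k) hW hx
  have hz : 0 < x ^ (-q k) := by positivity
  unfold curve₁
  congr 1
  have e1 : slopePoint k W x ^ (k - 1) = (slopePoint k W x ^ k) ^ ((k - 1) / k) := by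
    rw [← rpow_mul ht.le]; congr 1; field_simp
  rw [e1, sub_slopePoint_rpow hk0 hW hx, slopePoint_rpow hk0 hW hx]
  have e2 : (1 / k - 1 : ℝ) = -((k - 1) / k) := by field_simp; ring
  rw [e2, rpow_neg (x := W * x ^ (-q k) / (1 + x ^ (-q k))) (by positivity), ← div_eq_mul_inv, ← div_rpow (by positivity) (by positivity)]
  have e3 : W / (1 + x ^ (-q k)) / (W * x ^ (-q k) / (1 + x ^ (-q k))) = x ^ q k := by
    rw [rpow_neg hx.le]
    field_simp
  rw [e3, ← rpow_mul hx.le]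
  have e4 : q k * ((k - 1) / k) = 1 := by unfold q; field_simp
  rw [e4, rpow_one]

/-- Between two consecutive points of division the slope of `h` times the curve increases from
`2 ^ j * h` to `2 ^ (j + 1) * h`. -/
theorem arcPhase_curve (hk : 2 < k) (hW : 0 < W) {h : ℕ} (hh : 0 < h) (j : ℕ) :
    ArcPhase (curve k W h) (curve₁ k W h) (curve₂ k W h)
      (fun t => curve₂ k W h t * curveLog k W t)
      (fun t => curve₂ k W h t * (curveLog k W t ^ 2 + curveLog₁ k W t))
      (node k W j) (node k W (j + 1)) (2 ^ j * h) := by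
  have hk0 : k ≠ 0 := by linarith
  have hc : (0 : ℝ) < h := by exact_mod_cast hh
  have h2 : (0 : ℝ) < 2 ^ j := by positivity
  have h2' : (0 : ℝ) < 2 ^ (j + 1) := by positivity
  rw [node_eq_slopePoint, node_eq_slopePoint]
  have hA := slopePoint_pos (k := k) hW h2
  have hpos : ∀ t ∈ Set.Icc (slopePoint k W (2 ^ j)) (slopePoint k W (2 ^ (j + 1))), 0 < t :=
    fun t ht => hA.trans_le ht.1
  have hs : ∀ t ∈ Set.Icc (slopePoint k W (2 ^ j)) (slopePoint k W (2 ^ (j + 1))),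
      0 < W - t ^ k := by
    intro t ht
    have := rpow_le_rpow (hpos t ht).le ht.2 (by linarith : 0 ≤ k)
    linarith [sub_slopePoint_rpow_pos hk0 hW h2']
  have hlt : slopePoint k W (2 ^ j) < slopePoint k W (2 ^ (j + 1)) :=
    slopePoint_lt hk hW h2 (by rw [pow_succ]; linarith)
  have hhalf : ∀ t ∈ Set.Icc (slopePoint k W (2 ^ j)) (slopePoint k W (2 ^ (j + 1))),
      W / 2 ≤ t ^ k := by
    intro t ht
    have h3 := rpow_le_rpow hA.le ht.1 (by linarith : 0 ≤ k)
    rw [slopePoint_rpow hk0 hW h2] at h3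
    have h4 : ((2 : ℝ) ^ j) ^ (-q k) ≤ 1 :=
      rpow_le_one_of_one_le_of_nonpos (one_le_pow₀ (by norm_num)) (by linarith [q_pos hk])
    have h5 : W / 2 ≤ W / (1 + ((2 : ℝ) ^ j) ^ (-q k)) := by
      gcongr
      linarith
    exact h5.trans h3
  refine ⟨hA.le, hlt, Nat.mul_pos (by positivity) hh, ?_, ?_, fun t ht => ?_, fun t ht => ?_,
    fun t ht => ?_, fun t ht => ?_, fun t ht => ?_, fun t ht => ?_, fun t ht => ?_, ?_⟩
  · rw [curve₁_slopePoint hk hW h2]; push_cast; ring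
  · rw [curve₁_slopePoint hk hW h2']; push_cast; ring
  · exact hasDerivAt_curve hk0 (hpos t ht) (hs t ht)
  · exact hasDerivAt_curve₁ hk0 (hpos t ht) (hs t ht)
  · exact hasDerivAt_curve₂ hk0 (hpos t ht) (hs t ht)
  · exact hasDerivAt_curve₃ hk0 (hpos t ht) (hs t ht)
  · exact curve₂_pos hk hc hW (hpos t ht) (hs t ht)
  · exact mul_nonneg (curve₂_pos hk hc hW (hpos t ht) (hs t ht)).le
      (curveLog_nonneg hk hW (hpos t ht) (hs t ht))
  · exact curve_growth hk hc hW (hpos t ht) (hs t ht)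
  · have hmono : MonotoneOn (fun t => (k - 2) * W ^ 2 - (k + 1) * (t ^ k * (W - t ^ k)))
        (Set.Ioo (slopePoint k W (2 ^ j)) (slopePoint k W (2 ^ (j + 1)))) := by
      intro t ht u hu htu
      have ht' := Set.Ioo_subset_Icc_self ht
      have h6 := rpow_le_rpow (hpos t ht').le htu (by linarith : 0 ≤ k)
      have h7 := hhalf t ht'
      simp only
      have h8 : u ^ k * (W - u ^ k) ≤ t ^ k * (W - t ^ k) := by nlinarith
      nlinarith
    have hfac : ∀ t ∈ Set.Icc (slopePoint k W (2 ^ j)) (slopePoint k W (2 ^ (j + 1))),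
        0 ≤ curve₂ k W h t ^ 2 * (2 * k - 1) / (t * (W - t ^ k)) ^ 2 := by
      intro t _
      have : 0 ≤ 2 * k - 1 := by linarith
      positivity
    refine (OneSignChange.of_monotoneOn hlt.le hmono).transfer (fun t ht h9 => ?_) fun t ht h9 => ?_
    · have ht' := Set.Ioo_subset_Icc_self ht
      rw [curve_sign_eq (hpos t ht') (hs t ht')]
      exact mul_nonneg (hfac t ht') h9
    · have ht' := Set.Ioo_subset_Icc_self ht
      rw [curve_sign_eq (hpos t ht') (hs t ht')]
      exact mul_nonpos_of_nonneg_of_nonpos (hfac t ht') h9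

theorem one_add_div_rpow_neg {h l : ℝ} (hh : 0 < h) (hl : 0 < l) :
    1 + (l / h) ^ (-q k) = (h ^ q k + l ^ q k) / l ^ q k := by
  rw [rpow_neg (by positivity), div_rpow hl.le hh.le]
  field_simp
  ring

theorem div_rpow_neg_div {h l : ℝ} (hh : 0 < h) (hl : 0 < l) :
    W * (l / h) ^ (-q k) / (1 + (l / h) ^ (-q k)) = W * h ^ q k / (h ^ q k + l ^ q k) := by
  rw [one_add_div_rpow_neg hh hl, rpow_neg (by positivity), div_rpow hl.le hh.le]
  field_simp

/-- The Legendre transform of the phase: the tac-function of the Lamé disc is an `ℓ^q`-norm. -/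
theorem curve_slopePoint {h l : ℝ} (hk : 2 < k) (hW : 0 < W) (hh : 0 < h) (hl : 0 < l) :
    curve k W h (slopePoint k W (l / h)) - l * slopePoint k W (l / h) =
      -(W ^ (1 / k) * (h ^ q k + l ^ q k) ^ (1 / q k)) := by
  have hk0 : k ≠ 0 := by linarith
  have hk1 : k - 1 ≠ 0 := by linarith
  have hx : 0 < l / h := by positivity
  have hD : 0 < h ^ q k + l ^ q k := by positivity
  have e1 : h * (h ^ q k) ^ (1 / k) = h ^ q k := by
    rw [← rpow_mul hh.le]
    nth_rw 1 [← rpow_one h]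
    rw [← rpow_add hh]
    congr 1
    unfold q; field_simp; ring
  have e2 : l * (l ^ q k) ^ (1 / k) = l ^ q k := by
    rw [← rpow_mul hl.le]
    nth_rw 1 [← rpow_one l]
    rw [← rpow_add hl]
    congr 1
    unfold q; field_simp; ring
  have e3 : (h ^ q k + l ^ q k) ^ (1 / q k) =
      (h ^ q k + l ^ q k) / (h ^ q k + l ^ q k) ^ (1 / k) := by
    rw [eq_div_iff (by positivity), ← rpow_add hD]
    conv_rhs => rw [← rpow_one (h ^ q k + l ^ q k)]
    congr 1
    unfold q; field_simp; ring
  unfold curve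
  rw [sub_slopePoint_rpow hk0 hW hx, div_rpow_neg_div hh hl]
  unfold slopePoint
  rw [one_add_div_rpow_neg hh hl, neg_div, rpow_neg (by positivity),
    div_rpow (by positivity) (by positivity), div_rpow (by positivity) (by positivity),
    mul_rpow hW.le (by positivity), e3]
  have hDk : 0 < (h ^ q k + l ^ q k) ^ (1 / k) := by positivity
  field_simp
  linear_combination -e1 - e2

/-- The amplitude of the transformed sum; both sides are compared through their logarithms. -/
theorem one_div_sqrt_curve₂ {h l : ℝ} (hk : 2 < k) (hW : 0 < W) (hh : 0 < h) (hl : 0 < l) :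
    1 / √(curve₂ k W h (slopePoint k W (l / h))) =
      W ^ (1 / (2 * k)) / √(k - 1) * h * ((h * l) ^ (q k / 2 - 1) *
        (h ^ q k + l ^ q k) ^ (-1 + 1 / (2 * q k))) := by
  have hk0 : k ≠ 0 := by linarith
  have hk1 : 0 < k - 1 := by linarith
  have hx : 0 < l / h := by positivity
  have ht := slopePoint_pos (k := k) hW hx
  set D := h ^ q k + l ^ q k with hDdef
  have hD : 0 < D := by positivity
  have hs := sub_slopePoint_rpow_pos hk0 hW hx
  have hc2 := curve₂_pos hk hh hW ht hs
  have hlt : log (slopePoint k W (l / h)) = (log W + q k * log l - log D) / k := by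
    have := congrArg log (slopePoint_rpow hk0 hW hx)
    rw [log_rpow ht, one_add_div_rpow_neg hh hl, ← hDdef, div_div_eq_mul_div,
      log_div (by positivity) hD.ne', log_mul hW.ne' (by positivity), log_rpow hl] at this
    rw [eq_div_iff hk0, mul_comm]
    exact this
  have hls : log (W - slopePoint k W (l / h) ^ k) = log W + q k * log h - log D := by
    rw [sub_slopePoint_rpow hk0 hW hx, div_rpow_neg_div hh hl, ← hDdef,
      log_div (by positivity) hD.ne', log_mul hW.ne' (by positivity), log_rpow hh]
  refine log_injOn_pos (Set.mem_Ioi.mpr (by positivity)) (Set.mem_Ioi.mpr (by positivity)) ?_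
  rw [one_div, log_inv, log_sqrt hc2.le]
  unfold curve₂
  rw [log_mul (by positivity) (by positivity), log_mul (by positivity) hW.ne',
    log_mul hh.ne' hk1.ne', log_mul (by positivity) (by positivity), log_rpow ht, log_rpow hs, hlt,
    hls, log_mul (by positivity) (by positivity), log_mul (by positivity) hh.ne',
    log_div (by positivity) (by positivity), log_sqrt hk1.le, log_rpow hW,
    log_mul (by positivity) (by positivity), log_rpow (by positivity), log_rpow hD,
    log_mul hh.ne' hl.ne']
  have hk1' := hk1.ne'
  unfold q
  field_simp
  ring

end SlopePoint

theorem conj_e (x : ℝ) : (starRingEnd ℂ) (e x) = e (-x) := by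
  unfold e
  rw [← Complex.exp_conj]
  congr 1
  simp only [map_mul, Complex.conj_ofReal, Complex.conj_I, map_ofNat]
  push_cast
  ring

/-- The van der Corput transform for the Lamé curve, in the shape in which it enters `expSum`. The
convex phase `curve` is minus the one of the sum, whence the complex conjugation. -/
theorem norm_sum_sub_transform_le {k W : ℝ} (hk : 2 < k) (hW : 0 < W) {h : ℕ} (hh : 0 < h)
    (j : ℕ) :
    ‖(∑ n ∈ Ioc ⌊node k W j⌋₊ ⌊node k W (j + 1)⌋₊, e (h * (W - (n : ℝ) ^ k) ^ (1 / k))) -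
      ((W ^ (1 / (2 * k)) / √(k - 1) * h : ℝ) : ℂ) *
        starSum (2 ^ j * h) (2 ^ (j + 1) * h) fun ℓ =>
        ((((h : ℝ) * ℓ) ^ (q k / 2 - 1) *
          ((h : ℝ) ^ q k + (ℓ : ℝ) ^ q k) ^ (-1 + 1 / (2 * q k)) : ℝ) : ℂ) *
        e (W ^ (1 / k) * ((h : ℝ) ^ q k + (ℓ : ℝ) ^ q k) ^ (1 / q k) - 1 / 8)‖ ≤
      500 * (1 + log ((2 ^ j * h : ℕ) : ℝ)) := by
  have hc : (0 : ℝ) < h := by exact_mod_cast hh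
  have hph := arcPhase_curve hk hW hh j
  have hpos : ∀ ℓ : ℕ, 2 ^ j * h ≤ ℓ → (0 : ℝ) < ℓ := fun ℓ hℓ => by
    have : 0 < 2 ^ j * h := by positivity
    exact_mod_cast this.trans_le hℓ
  have ht : ∀ ℓ : ℕ, 2 ^ j * h ≤ ℓ → ℓ ≤ 2 * (2 ^ j * h) →
      slopePoint k W (ℓ / h) ∈ Set.Icc (node k W j) (node k W (j + 1)) ∧
        curve₁ k W h (slopePoint k W (ℓ / h)) = ℓ := by
    intro ℓ h1 h2
    have hl := hpos ℓ h1
    have h1' : (2 : ℝ) ^ j * h ≤ ℓ := by exact_mod_cast h1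
    have h2' : (ℓ : ℝ) ≤ 2 * (2 ^ j * h) := by exact_mod_cast h2
    rw [node_eq_slopePoint, node_eq_slopePoint]
    refine ⟨⟨slopePoint_le hk hW (by positivity) ?_, slopePoint_le hk hW (by positivity) ?_⟩, ?_⟩
    · rwa [le_div_iff₀ hc]
    · rw [div_le_iff₀ hc, pow_succ]; linarith
    · rw [curve₁_slopePoint hk hW (by positivity)]; field_simp
  have hmain := hph.norm_sum_sub_starSum_le ht
  rw [← RCLike.norm_conj] at hmain
  convert! hmain using 2
  rw [map_sub, map_sum, map_mul, conj_e]
  congr 1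
  · refine sum_congr rfl fun n _ => ?_
    rw [conj_e]
    congr 1
    simp only [curve]
    ring
  · have e0 : 2 * (2 ^ j * h) = 2 ^ (j + 1) * h := by ring
    rw [e0]
    have key : ∀ ℓ : ℕ, 2 ^ j * h ≤ ℓ → (starRingEnd ℂ)
        ((1 / √(curve₂ k W h (slopePoint k W (ℓ / h))) : ℝ) *
          e (curve k W h (slopePoint k W (ℓ / h)) - ℓ * slopePoint k W (ℓ / h))) * e (-(1 / 8)) =
        ((W ^ (1 / (2 * k)) / √(k - 1) * h : ℝ) : ℂ) * (((((h : ℝ) * ℓ) ^ (q k / 2 - 1) *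
          ((h : ℝ) ^ q k + (ℓ : ℝ) ^ q k) ^ (-1 + 1 / (2 * q k)) : ℝ) : ℂ) *
        e (W ^ (1 / k) * ((h : ℝ) ^ q k + (ℓ : ℝ) ^ q k) ^ (1 / q k) - 1 / 8)) := by
      intro ℓ hℓ
      have hl := hpos ℓ hℓ
      rw [map_mul, Complex.conj_ofReal, conj_e, curve_slopePoint hk hW hc hl,
        one_div_sqrt_curve₂ hk hW hc hl, neg_neg, mul_assoc, ← e_add, ← sub_eq_add_neg]
      push_cast
      ring
    unfold starSum
    rw [map_add, map_mul, map_add, map_sum]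
    conv_lhs => rw [mul_add, mul_sum]
    conv_rhs => rw [mul_add, mul_sum]
    have hle : 2 ^ j * h ≤ 2 ^ (j + 1) * h := by rw [← e0]; omega
    have k1 := key _ le_rfl
    have k2 := key _ hle
    congr 1
    · have hhalf : (starRingEnd ℂ) (1 / 2) = 1 / 2 := by
        rw [map_div₀, map_one, map_ofNat]
      rw [hhalf]
      linear_combination (-1 / 2 : ℂ) * k1 + (-1 / 2 : ℂ) * k2
    · refine sum_congr rfl fun ℓ hℓ => ?_
      rw [mem_Ioo] at hℓ
      rw [← key ℓ hℓ.1.le, mul_comm]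

/-! ### Assembly of the dyadic pieces -/

/-- `rho` is bounded by `π` on `(0, 1)`, since `2 ξ (1 - ξ) ≤ sin (π ξ)`. -/
theorem abs_alpha_le {h H : ℕ} (h0 : 0 < h) (hH : h < H) : |alpha h H| ≤ 1 / h := by
  have hh : (0 : ℝ) < h := by exact_mod_cast h0
  have hHr : (h : ℝ) < H := by exact_mod_cast hH
  have hπ := pi_pos
  set ξ := (h : ℝ) / H with hξ
  have ξ0 : 0 < ξ := by
    have : (0 : ℝ) < H := hh.trans hHr
    positivity
  have ξ1 : ξ < 1 := (div_lt_one (hh.trans hHr)).mpr hHr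
  have hsin : 2 * (ξ * (1 - ξ)) ≤ sin (π * ξ) := by
    rcases le_total ξ (1 / 2) with h1 | h1
    · have := mul_le_sin (x := π * ξ) (by positivity) (by nlinarith)
      have e1 : 2 / π * (π * ξ) = 2 * ξ := by field_simp
      rw [e1] at this
      nlinarith
    · have := mul_le_sin (x := π * (1 - ξ)) (mul_nonneg hπ.le (by linarith)) (by nlinarith)
      have e1 : 2 / π * (π * (1 - ξ)) = 2 * (1 - ξ) := by field_simp
      have e2 : π * (1 - ξ) = π - π * ξ := by ring
      rw [e1, e2, sin_pi_sub] at this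
      nlinarith
  have hpos : 0 < ξ * (1 - ξ) := mul_pos ξ0 (by linarith)
  have hsin0 : 0 < sin (π * ξ) := by linarith
  have hrho : |rho ξ| ≤ π := by
    have hcos := abs_le.mp (abs_cos_le_one (π * ξ))
    have hb : |π * ξ * (1 - ξ) * cot (π * ξ)| ≤ π / 2 := by
      rw [cot_eq_cos_div_sin, mul_div_assoc', abs_div, abs_of_pos hsin0, div_le_iff₀ hsin0,
        show π * ξ * (1 - ξ) * cos (π * ξ) = π * (ξ * (1 - ξ)) * cos (π * ξ) by ring, abs_mul,
        abs_of_pos (by positivity : 0 < π * (ξ * (1 - ξ)))]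
      calc π * (ξ * (1 - ξ)) * |cos (π * ξ)| ≤ π * (ξ * (1 - ξ)) * 1 := by
            gcongr
            exact abs_cos_le_one _
        _ ≤ π / 2 * sin (π * ξ) := by nlinarith
    unfold rho
    refine (abs_add_le _ _).trans ?_
    rw [abs_of_pos ξ0]
    linarith [pi_gt_three]
  unfold alpha
  rw [abs_mul, abs_of_pos (by positivity : 0 < 1 / (π * h))]
  calc 1 / (π * h) * |rho ξ| ≤ 1 / (π * h) * π := by gcongr
    _ = 1 / h := by field_simp

theorem beta_nonneg {h H : ℕ} (hH : h < H) : 0 ≤ beta h H := by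
  have hHr : (h : ℝ) < H := by exact_mod_cast hH
  have h0 : (0 : ℝ) ≤ h := by positivity
  have : (h : ℝ) / H ≤ 1 := (div_le_one (h0.trans_lt hHr)).mpr hHr.le
  unfold beta
  exact mul_nonneg (by positivity) (by linarith)

theorem beta_le {h H : ℕ} : beta h H ≤ 1 / H := by
  have : 0 ≤ (h : ℝ) / H := by positivity
  unfold beta
  exact mul_le_of_le_one_right (by positivity) (by linarith)

theorem sum_weights_le {H : ℕ} (hH : 1 < H) :
    ∑ h ∈ Ioo 0 H, (|alpha h H| + beta h H) ≤ 2 + log H := by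
  have hH0 : (0 : ℝ) < H := by exact_mod_cast (zero_lt_one.trans hH)
  rw [sum_add_distrib]
  have h1 : ∑ h ∈ Ioo 0 H, |alpha h H| ≤ 1 + log H := by
    calc ∑ h ∈ Ioo 0 H, |alpha h H| ≤ ∑ h ∈ Ioo 0 H, 1 / (h : ℝ) := by
          refine sum_le_sum fun h hh => ?_
          rw [mem_Ioo] at hh
          exact abs_alpha_le hh.1 hh.2
      _ ≤ ∑ i ∈ range H, 1 / ((i : ℝ) + 1) := by
          have e1 := sum_range_succ' (fun i : ℕ => 1 / (i : ℝ)) H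
          simp only [Nat.cast_zero, div_zero, add_zero, Nat.cast_add, Nat.cast_one] at e1
          rw [← e1]
          refine sum_le_sum_of_subset_of_nonneg (fun h hh => ?_) fun _ _ _ => by positivity
          simp at hh ⊢
          omega
      _ ≤ 1 + log H := sum_one_div_le H
  have h2 : ∑ h ∈ Ioo 0 H, beta h H ≤ 1 := by
    calc ∑ h ∈ Ioo 0 H, beta h H ≤ ∑ h ∈ Ioo 0 H, 1 / (H : ℝ) := sum_le_sum fun _ _ => beta_le
      _ = ((H - 0 - 1 : ℕ) : ℝ) * (1 / H) := by rw [sum_const, Nat.card_Ioo, nsmul_eq_mul]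
      _ ≤ H * (1 / H) := by
        gcongr
        omega
      _ = 1 := by field_simp
  linarith

theorem e_re (x : ℝ) : (e x).re = cos (2 * π * x) := by
  have : e x = Complex.exp ((2 * π * x : ℝ) * Complex.I) := by
    unfold e; congr 1; push_cast; ring
  rw [this, Complex.exp_ofReal_mul_I_re]

theorem e_im (x : ℝ) : (e x).im = sin (2 * π * x) := by
  have : e x = Complex.exp ((2 * π * x : ℝ) * Complex.I) := by
    unfold e; congr 1; push_cast; ring
  rw [this, Complex.exp_ofReal_mul_I_im]

/-- The contribution of one dyadic piece: Vaaler's inequality is summed over `n`, and each of the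
resulting exponential sums is replaced by its van der Corput transform. -/
theorem abs_piece_le {k W : ℝ} (hk : 2 < k) (hW : 0 < W) (j : ℕ) {H : ℕ} (hH : 1 < H) :
    |(∑ n ∈ Ioc ⌊node k W j⌋₊ ⌊node k W (j + 1)⌋₊, psi ((W - (n : ℝ) ^ k) ^ (1 / k))) +
      (expSum alpha H W k j).im| ≤
      (expSum beta H W k j).re + ((⌊node k W (j + 1)⌋₊ - ⌊node k W j⌋₊ : ℕ) : ℝ) / (2 * H) +
        500 * (1 + j + log H) * (2 + log H) := by
  have hH0 : (0 : ℝ) < H := by exact_mod_cast (zero_lt_one.trans hH)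
  set I := Ioc ⌊node k W j⌋₊ ⌊node k W (j + 1)⌋₊ with hI
  set f : ℕ → ℝ := fun n => (W - (n : ℝ) ^ k) ^ (1 / k) with hf
  set S : ℕ → ℂ := fun h => ∑ n ∈ I, e (h * f n) with hS
  set M : ℕ → ℂ := fun h => ((W ^ (1 / (2 * k)) / √(k - 1) * h : ℝ) : ℂ) *
        starSum (2 ^ j * h) (2 ^ (j + 1) * h) fun ℓ =>
        ((((h : ℝ) * ℓ) ^ (q k / 2 - 1) *
          ((h : ℝ) ^ q k + (ℓ : ℝ) ^ q k) ^ (-1 + 1 / (2 * q k)) : ℝ) : ℂ) *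
        e (W ^ (1 / k) * ((h : ℝ) ^ q k + (ℓ : ℝ) ^ q k) ^ (1 / q k) - 1 / 8) with hM
  have hexp : ∀ γ : ℕ → ℕ → ℝ, expSum γ H W k j = ∑ h ∈ Ioo 0 H, (γ h H : ℂ) * M h := by
    intro γ
    unfold expSum
    rw [mul_sum]
    refine sum_congr rfl fun h _ => ?_
    simp only [hM]
    push_cast
    ring
  have hSM : ∀ h ∈ Ioo 0 H, ‖S h - M h‖ ≤ 500 * (1 + j + log H) := by
    intro h hh
    rw [mem_Ioo] at hh
    refine (norm_sum_sub_transform_le hk hW hh.1 j).trans ?_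
    have hh0 : (0 : ℝ) < h := by exact_mod_cast hh.1
    have h1 : log ((2 ^ j * h : ℕ) : ℝ) ≤ j + log H := by
      push_cast
      rw [log_mul (by positivity) hh0.ne', log_pow]
      have h2 : log h ≤ log H := log_le_log hh0 (by exact_mod_cast hh.2.le)
      have h3 : (j : ℝ) * log 2 ≤ j * 1 := by
        gcongr
        linarith [log_two_lt_d9]
      linarith
    linarith
  have hv : |(∑ n ∈ I, psi (f n)) + ∑ h ∈ Ioo 0 H, alpha h H * (S h).im| ≤
      ((⌊node k W (j + 1)⌋₊ - ⌊node k W j⌋₊ : ℕ) : ℝ) / (2 * H) +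
        ∑ h ∈ Ioo 0 H, beta h H * (S h).re := by
    have e1 : ∑ h ∈ Ioo 0 H, alpha h H * (S h).im =
        ∑ n ∈ I, ∑ h ∈ Ioo 0 H, alpha h H * sin (2 * π * h * f n) := by
      rw [sum_comm]
      refine sum_congr rfl fun h _ => ?_
      rw [hS, Complex.im_sum, mul_sum]
      refine sum_congr rfl fun n _ => ?_
      rw [e_im]; ring_nf
    have e2 : ∑ h ∈ Ioo 0 H, beta h H * (S h).re =
        ∑ n ∈ I, ∑ h ∈ Ioo 0 H, beta h H * cos (2 * π * h * f n) := by
      rw [sum_comm]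
      refine sum_congr rfl fun h _ => ?_
      rw [hS, Complex.re_sum, mul_sum]
      refine sum_congr rfl fun n _ => ?_
      rw [e_re]; ring_nf
    rw [e1, e2, ← sum_add_distrib]
    refine (abs_sum_le_sum_abs _ _).trans
      ((sum_le_sum fun n _ => vaaler (by omega : 0 < H) (f n)).trans (le_of_eq ?_))
    rw [sum_add_distrib, sum_const, hI, Nat.card_Ioc, nsmul_eq_mul, mul_one_div]
  have hγ : ∀ (γ : ℕ → ℕ → ℝ), ‖∑ h ∈ Ioo 0 H, (γ h H : ℂ) * (M h - S h)‖ ≤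
      ∑ h ∈ Ioo 0 H, |γ h H| * (500 * (1 + j + log H)) := by
    intro γ
    refine norm_sum_le_of_le _ fun h hh => ?_
    rw [norm_mul, Complex.norm_real, Real.norm_eq_abs, norm_sub_rev]
    exact mul_le_mul_of_nonneg_left (hSM h hh) (abs_nonneg _)
  have him : (expSum alpha H W k j).im = ∑ h ∈ Ioo 0 H, alpha h H * (S h).im +
      (∑ h ∈ Ioo 0 H, (alpha h H : ℂ) * (M h - S h)).im := by
    rw [hexp, Complex.im_sum, Complex.im_sum, ← sum_add_distrib]
    refine sum_congr rfl fun h _ => ?_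
    rw [Complex.im_ofReal_mul _ (M h), Complex.im_ofReal_mul _ (M h - S h), Complex.sub_im]
    ring
  have hre : (expSum beta H W k j).re = ∑ h ∈ Ioo 0 H, beta h H * (S h).re +
      (∑ h ∈ Ioo 0 H, (beta h H : ℂ) * (M h - S h)).re := by
    rw [hexp, Complex.re_sum, Complex.re_sum, ← sum_add_distrib]
    refine sum_congr rfl fun h _ => ?_
    rw [Complex.re_ofReal_mul _ (M h), Complex.re_ofReal_mul _ (M h - S h), Complex.sub_re]
    ring
  have ha := (Complex.abs_im_le_norm _).trans (hγ alpha)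
  have hb := (Complex.abs_re_le_norm _).trans (hγ beta)
  have hw : ∑ h ∈ Ioo 0 H, |alpha h H| * (500 * (1 + j + log H)) +
      ∑ h ∈ Ioo 0 H, |beta h H| * (500 * (1 + j + log H)) ≤
      500 * (1 + j + log H) * (2 + log H) := by
    have hlog : 0 ≤ log H := log_nonneg (by exact_mod_cast hH.le)
    rw [← sum_add_distrib]
    calc _ = (∑ h ∈ Ioo 0 H, (|alpha h H| + beta h H)) * (500 * (1 + j + log H)) := by
          rw [sum_mul]
          refine sum_congr rfl fun h hh => ?_
          rw [mem_Ioo] at hh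
          rw [abs_of_nonneg (beta_nonneg hh.2)]
          ring
      _ ≤ (2 + log H) * (500 * (1 + j + log H)) := by
          gcongr
          exact sum_weights_le hH
      _ = _ := by ring
  rw [him, hre]
  have hv' := abs_le.mp hv
  have ha' := abs_le.mp ha
  have hb' := abs_le.mp hb
  rw [abs_le]
  constructor <;> linarith [hv'.1, hv'.2, ha'.1, ha'.2, hb'.1, hb'.2]

section Nodes

variable {k W : ℝ}

theorem node_pos (hW : 0 < W) (j : ℕ) : 0 < node k W j := by
  rw [node_eq_slopePoint]; exact slopePoint_pos hW (by positivity)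

theorem node_le_succ (hk : 2 < k) (hW : 0 < W) (j : ℕ) : node k W j ≤ node k W (j + 1) := by
  rw [node_eq_slopePoint, node_eq_slopePoint]
  exact slopePoint_le hk hW (by positivity) (pow_le_pow_right₀ (by norm_num) (Nat.le_succ j))

theorem node_zero (hW : 0 < W) : node k W 0 = (W / 2) ^ (1 / k) := by
  unfold node
  rw [Nat.cast_zero, neg_zero, zero_mul, rpow_zero, div_rpow hW.le (by norm_num), neg_div,
    rpow_neg (by norm_num), ← div_eq_mul_inv, one_add_one_eq_two]

theorem node_le (hk : 2 < k) (hW : 0 < W) (j : ℕ) : node k W j ≤ W ^ (1 / k) := by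
  unfold node
  refine mul_le_of_le_one_right (by positivity) (rpow_le_one_of_one_le_of_nonpos ?_ ?_)
  · have : (0 : ℝ) < 2 ^ (-(j : ℝ) * q k) := by positivity
    linarith
  · exact div_nonpos_of_nonpos_of_nonneg (by norm_num) (by linarith)

/-- From `(1 + z) ^ (-1 / k) ≥ (1 + z)⁻¹ ≥ 1 - z` for `z > 0`. -/
theorem le_node (hk : 2 < k) (hW : 0 < W) (j : ℕ) :
    W ^ (1 / k) * (1 - 2 ^ (-(j : ℝ) * q k)) ≤ node k W j := by
  unfold node
  refine mul_le_mul_of_nonneg_left ?_ (by positivity)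
  set z : ℝ := 2 ^ (-(j : ℝ) * q k) with hz
  have hz0 : 0 < z := by positivity
  have h1 : (1 + z) ^ (-1 : ℝ) ≤ (1 + z) ^ (-1 / k) := by
    refine rpow_le_rpow_of_exponent_le (by linarith) ?_
    rw [le_div_iff₀ (by linarith)]
    linarith
  refine le_trans ?_ h1
  rw [rpow_neg_one, ← one_div, le_div_iff₀ (by linarith)]
  nlinarith

/-- Decomposition of a sum of the kind of `Delta` at the points of division. -/
theorem sum_pieces (hk : 2 < k) (hW : 0 < W) (f : ℕ → ℝ) (J : ℕ) :
    ∑ n ∈ Ioc ⌊(W / 2) ^ (1 / k)⌋₊ ⌊W ^ (1 / k)⌋₊, f n =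
      ∑ j ∈ range J, ∑ n ∈ Ioc ⌊node k W j⌋₊ ⌊node k W (j + 1)⌋₊, f n +
        ∑ n ∈ Ioc ⌊node k W J⌋₊ ⌊W ^ (1 / k)⌋₊, f n := by
  induction J with
  | zero => rw [← node_zero hW]; simp
  | succ J ih =>
    rw [ih, sum_range_succ, add_assoc, sum_Ioc_consecutive _
      (Nat.floor_le_floor (node_le_succ hk hW J)) (Nat.floor_le_floor (node_le hk hW (J + 1)))]

theorem floor_sub_floor_le_ncard {a b : ℝ} (hb : 0 ≤ b) :
    ⌊b⌋₊ - ⌊a⌋₊ ≤ Set.ncard {n : ℤ | a ≤ n ∧ (n : ℝ) ≤ b} := by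
  have hfin : {n : ℤ | a ≤ n ∧ (n : ℝ) ≤ b}.Finite := by
    refine (Set.finite_Icc ⌈a⌉ ⌊b⌋).subset fun n hn => ?_
    exact ⟨Int.ceil_le.mpr hn.1, Int.le_floor.mpr hn.2⟩
  have hsub : (((Ioc ⌊a⌋₊ ⌊b⌋₊).map Nat.castEmbedding : Finset ℤ) : Set ℤ) ⊆
      {n : ℤ | a ≤ n ∧ (n : ℝ) ≤ b} := by
    intro n hn
    simp only [coe_map, Set.mem_image, coe_Ioc, Set.mem_Ioc, Nat.castEmbedding_apply] at hn
    obtain ⟨m, hm, rfl⟩ := hn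
    refine ⟨?_, ?_⟩
    · exact_mod_cast (Nat.lt_of_floor_lt hm.1).le
    · exact_mod_cast (Nat.le_floor_iff hb).mp hm.2
  have := Set.ncard_le_ncard hsub hfin
  rwa [Set.ncard_coe_finset, card_map, Nat.card_Ioc] at this

/-- Beyond the last point of division there are only `O(W ^ (lam / k))` abscissae. -/
theorem abs_tail_le {lam c₀ b₀ : ℝ} (hk : 2 < k) (hlam₀ : 0 ≤ lam)
    (hc₁ : 1 ≤ c₀) (hcb : c₀ ≤ b₀) (hW : 1 ≤ W) :
    |∑ n ∈ Ioc ⌊node k W (numPieces k lam c₀ W)⌋₊ ⌊W ^ (1 / k)⌋₊,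
      psi ((W - (n : ℝ) ^ k) ^ (1 / k))| ≤ b₀ * W ^ (lam / k) := by
  have hW0 : 0 < W := by linarith
  have hc0 : 0 < c₀ := by linarith
  set J := numPieces k lam c₀ W with hJ
  set P := (W / c₀) ^ ((1 - lam) / k) with hP
  have hP0 : 0 < P := by positivity
  have hq := q_pos hk
  have hl2 : 0 < log 2 := log_pos (by norm_num)
  have hz : (2 : ℝ) ^ (-(J : ℝ) * q k) ≤ 1 / P := by
    have h1 : log P / (q k * log 2) ≤ J := by
      have := Nat.le_ceil (log P / (q k * log 2))
      rw [hJ]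
      unfold numPieces
      push_cast
      linarith
    rw [div_le_iff₀ (by positivity)] at h1
    rw [rpow_def_of_pos (by norm_num), one_div, ← exp_log hP0, ← exp_neg]
    refine exp_le_exp.mpr ?_
    linarith
  have hcount : ((⌊W ^ (1 / k)⌋₊ - ⌊node k W J⌋₊ : ℕ) : ℝ) ≤ W ^ (1 / k) * (1 / P) + 1 := by
    rw [Nat.cast_sub (Nat.floor_le_floor (node_le hk hW0 J))]
    have h1 := Nat.floor_le (by positivity : 0 ≤ W ^ (1 / k))
    have h2 := Nat.lt_floor_add_one (node k W J)
    have h3 := le_node hk hW0 J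
    have h4 : W ^ (1 / k) * 2 ^ (-(J : ℝ) * q k) ≤ W ^ (1 / k) * (1 / P) := by gcongr
    linarith
  have hmain : W ^ (1 / k) * (1 / P) ≤ b₀ * W ^ (lam / k) := by
    have e1 : W ^ (1 / k) * (1 / P) = c₀ ^ ((1 - lam) / k) * W ^ (lam / k) := by
      rw [hP, div_rpow hW0.le hc0.le]
      have e2 : W ^ (1 / k) = W ^ ((1 - lam) / k) * W ^ (lam / k) := by
        rw [← rpow_add hW0]; congr 1; ring
      rw [e2]
      field_simp
    rw [e1]
    gcongr
    refine le_trans (rpow_le_rpow_of_exponent_le hc₁ ?_) ((rpow_one c₀).le.trans hcb)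
    rw [div_le_one (by linarith)]
    linarith
  have hone : 1 ≤ b₀ * W ^ (lam / k) := by
    have : 1 ≤ W ^ (lam / k) := one_le_rpow hW (div_nonneg hlam₀ (by linarith))
    nlinarith
  calc _ ≤ ∑ n ∈ Ioc ⌊node k W J⌋₊ ⌊W ^ (1 / k)⌋₊, (1 / 2 : ℝ) :=
        (abs_sum_le_sum_abs _ _).trans (sum_le_sum fun _ _ => abs_psi_le _)
    _ = ((⌊W ^ (1 / k)⌋₊ - ⌊node k W J⌋₊ : ℕ) : ℝ) * (1 / 2) := by
        rw [sum_const, Nat.card_Ioc, nsmul_eq_mul]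
    _ ≤ b₀ * W ^ (lam / k) := by linarith

theorem numPieces_le {lam c₀ : ℝ} (hk : 2 < k) (hlam₀ : 0 ≤ lam) (hlam₁ : lam < 1)
    (hc₁ : 1 ≤ c₀) (hcW : c₀ ≤ W) (hlog : 1 ≤ log W) :
    (numPieces k lam c₀ W : ℝ) ≤ 4 * log W := by
  have hc0 : 0 < c₀ := by linarith
  have hW0 : 0 < W := by linarith
  have hq : 1 ≤ q k := by
    unfold q
    rw [le_div_iff₀ (by linarith)]
    linarith
  have hr : 1 ≤ W / c₀ := by rwa [le_div_iff₀ hc0, one_mul]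
  have hlr : 0 ≤ log (W / c₀) := log_nonneg hr
  have hlr' : log (W / c₀) ≤ log W := log_le_log (by linarith) (div_le_self hW0.le hc₁)
  have hex0 : 0 ≤ (1 - lam) / k := div_nonneg (by linarith) (by linarith)
  have hex1 : (1 - lam) / k ≤ 1 := by
    rw [div_le_one (by linarith)]; linarith
  have hden : 1 / 2 ≤ q k * log 2 := by nlinarith [log_two_gt_d9]
  unfold numPieces
  rw [log_rpow (by linarith)]
  set x := (1 - lam) / k * log (W / c₀) / (q k * log 2) with hx
  have hx0 : 0 ≤ x := div_nonneg (mul_nonneg hex0 hlr) (by linarith)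
  have hx1 : x ≤ 2 * log W := by
    rw [hx, div_le_iff₀ (by linarith)]
    have : (1 - lam) / k * log (W / c₀) ≤ 1 * log W := mul_le_mul hex1 hlr' hlr zero_le_one
    nlinarith
  have := (Nat.ceil_lt_add_one hx0).le
  push_cast
  linarith

end Nodes

end LameDisc

end

theorem theorem2 (k lam b₀ K : ℝ) (hk : 2 < k) (hlam₀ : 0 ≤ lam) (hlam₁ : lam < 1)
    (hb₀ : 1 ≤ b₀) (hK : 0 < K) :
    ∃ C : ℝ, 0 < C ∧ ∃ W₀ : ℝ, ∀ W : ℝ, W₀ ≤ W →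
      ∀ c₀ : ℝ, 1 ≤ c₀ → c₀ ≤ b₀ →
      ∀ H : ℕ → ℕ,
        (∀ j < LameDisc.numPieces k lam c₀ W, 1 < H j ∧ Real.log (H j) ≤ K * Real.log W) →
        |LameDisc.Delta k W +
            (∑ j ∈ Finset.range (LameDisc.numPieces k lam c₀ W),
              (LameDisc.expSum LameDisc.alpha (H j) W k j).im)| ≤
          (∑ j ∈ Finset.range (LameDisc.numPieces k lam c₀ W),
              (LameDisc.expSum LameDisc.beta (H j) W k j).re) +
            (∑ j ∈ Finset.range (LameDisc.numPieces k lam c₀ W),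
              (Set.ncard {n : ℤ | LameDisc.node k W j ≤ n ∧ n ≤ LameDisc.node k W (j + 1)} : ℝ) /
                (H j : ℝ)) +
            C * (W ^ (lam / k) + Real.log W ^ 3) := by
  refine ⟨b₀ + 2000 * (5 + K) * (2 + K), by positivity, max b₀ 3, ?_⟩
  intro W hW c₀ hc₁ hcb H hH
  have hWb : b₀ ≤ W := (le_max_left _ _).trans hW
  have hW3 : 3 ≤ W := (le_max_right _ _).trans hW
  have hW0 : 0 < W := by linarith
  have hL : 1 ≤ Real.log W := by
    rw [Real.le_log_iff_exp_le hW0]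
    linarith [Real.exp_one_lt_d9]
  set L := Real.log W with hLdef
  have hJ := LameDisc.numPieces_le hk hlam₀ hlam₁ hc₁ (hcb.trans hWb) hL
  have htail := LameDisc.abs_tail_le hk hlam₀ hc₁ hcb (by linarith : 1 ≤ W)
  set J := LameDisc.numPieces k lam c₀ W with hJdef
  have hpiece : ∀ j ∈ Finset.range J,
      |(∑ n ∈ Finset.Ioc ⌊LameDisc.node k W j⌋₊ ⌊LameDisc.node k W (j + 1)⌋₊,
        LameDisc.psi ((W - (n : ℝ) ^ k) ^ (1 / k))) +
        (LameDisc.expSum LameDisc.alpha (H j) W k j).im| ≤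
      (LameDisc.expSum LameDisc.beta (H j) W k j).re +
        (Set.ncard {n : ℤ | LameDisc.node k W j ≤ n ∧ n ≤ LameDisc.node k W (j + 1)} : ℝ) /
          (H j : ℝ) + 500 * (5 + K) * (2 + K) * L ^ 2 := by
    intro j hj
    rw [Finset.mem_range] at hj
    obtain ⟨hH1, hHK⟩ := hH j hj
    have hH0 : (0 : ℝ) < H j := by exact_mod_cast (zero_lt_one.trans hH1)
    have hlogH : 0 ≤ Real.log (H j) := Real.log_nonneg (by exact_mod_cast hH1.le)
    refine (LameDisc.abs_piece_le hk hW0 j hH1).trans (add_le_add (add_le_add le_rfl ?_) ?_)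
    · have hcard := LameDisc.floor_sub_floor_le_ncard (a := LameDisc.node k W j)
        (LameDisc.node_pos (k := k) hW0 (j + 1)).le
      have hcard' : ((⌊LameDisc.node k W (j + 1)⌋₊ - ⌊LameDisc.node k W j⌋₊ : ℕ) : ℝ) ≤
          (Set.ncard {n : ℤ | LameDisc.node k W j ≤ n ∧ n ≤ LameDisc.node k W (j + 1)} : ℝ) := by
        exact_mod_cast hcard
      gcongr
      linarith
    · have hjJ : (j : ℝ) ≤ J := by exact_mod_cast hj.le
      have h1 : 1 + (j : ℝ) + Real.log (H j) ≤ (5 + K) * L := by linarith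
      have h2 : 2 + Real.log (H j) ≤ (2 + K) * L := by linarith
      calc 500 * (1 + (j : ℝ) + Real.log (H j)) * (2 + Real.log (H j))
          ≤ 500 * ((5 + K) * L) * ((2 + K) * L) := by gcongr
        _ = 500 * (5 + K) * (2 + K) * L ^ 2 := by ring
  have hsum := (Finset.abs_sum_le_sum_abs _ _).trans (Finset.sum_le_sum hpiece)
  rw [Finset.sum_add_distrib, Finset.sum_add_distrib, Finset.sum_add_distrib, Finset.sum_const,
    Finset.card_range, nsmul_eq_mul] at hsum
  have herr : (J : ℝ) * (500 * (5 + K) * (2 + K) * L ^ 2) ≤ 2000 * (5 + K) * (2 + K) * L ^ 3 := by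
    calc (J : ℝ) * (500 * (5 + K) * (2 + K) * L ^ 2)
        ≤ 4 * L * (500 * (5 + K) * (2 + K) * L ^ 2) := by gcongr
      _ = 2000 * (5 + K) * (2 + K) * L ^ 3 := by ring
  have hx0 : 0 ≤ 2000 * (5 + K) * (2 + K) * W ^ (lam / k) := by positivity
  have hx1 : 0 ≤ b₀ * L ^ 3 := by positivity
  rw [show LameDisc.Delta k W = _ from LameDisc.sum_pieces hk hW0
    (fun n => LameDisc.psi ((W - (n : ℝ) ^ k) ^ (1 / k))) J, add_right_comm]
  refine (abs_add_le _ _).trans ?_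
  linarith
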